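/- **Setting.** Let $d\in\{1,2,3\}$, $0<\alpha\le\beta$. Let $\Omega\subset\mathbb R^d$ be the interior of a finite non-empty union of closed cubes of side $H_0$ of a Cartesian grid; these cubes form the mesh $\mathcal T_0$. For $0\le\ell\le L$ let $\mathcal T_\ell$ be the mesh of cubes of side $H_\ell=2^{-\ell}H_0$ obtained by $\ell$ dyadic refinements, and let $\mathcal T_h$ be obtained by dividing each cube of $\mathcal T_L$ into $n^d$ cubes of side $h=H_L/n$, $n\ge2$. Let $\mathbf A$ be measurable on $\Omega$ with symmetric matrix values and $\alpha|\eta|^2\le \mathbf A(x)\eta\cdot\eta\le\beta|\eta|^2$ for a.e. $x$ and all $\eta$. For a union $\omega$ of elements put $a_\omega(u,v)=\int_\omega \mathbf A\nabla u\cdot\nabla v$, $\|v\|_{a_\omega}=a_\omega(v,v)^{1/2}$, let $V_{h,\omega}$ be the space of $v\in H^1_0(\omega)$ that are $\mathcal Q_1$ on each element of $\mathcal T_h$ in $\omega$ (extended by zero), and let $\mathcal A_{h,\omega}^{-1}g\in V_{h,\omega}$ solve $a_\omega(\mathcal A_{h,\omega}^{-1}g,w)=(g,w)_{L^2(\omega)}$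 for all $w\in V_{h,\omega}$. Put $a=a_\Omega$. Let $\Pi_\ell$ be the $L^2$-projection onto functions that are constant on each element of $\mathcal T_\ell$, and let $\mathcal T_{\ell,\omega}$ be the set of elements of $\mathcal T_\ell$ contained in $\omega$. The patch of order $0$ around $T\in\mathcal T_\ell$ is $T$; the patch of order $m+1$ is the union of the elements of $\mathcal T_\ell$ that meet the patch of order $m$. Fix a stability parameter $\delta_s$ and patch orders $m_\ell\ge1$. *SLOD functions.* Let $T\in\mathcal T_\ell$ and let $\widetilde\omega$ be its patch of order $m_\ell$ in $\mathcal T_\ell$. Let $\mathcal D=\Pi_\ell\mathcal A^{-1}_{h,\widetilde\omega}$ on the piecewise constants of $\mathcal T_{\ell,\widetilde\omega}$, $g_K=\mathcal D^{-1}\chi_K$ with coefficient vector $\mathbf d^{(K)}$ (with respect to the functions $\chi_\tau$), and $\psi_K=\mathcal A_{h,\widetilde\omega}^{-1}g_K$. Let $\mathbf B_{iK}=a_{\widetilde\omega}(\mathcal A^{-1}_{h,\widetilde\omega}\chi_K,\phi_i)-(\chi_K,\phi_i)_{L^2(\widetilde\omega)}$, where $\phi_i$ runs over the $\mathcal Q_1$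 nodal functions of the nodes of $\mathcal T_h$ on $\partial\widetilde\omega\setminus\partial\Omega$, and let $\mathbf D$ have the columns $\mathbf d^{(K)}$, $K\ne T$. With a singular value decomposition $(\mathbf{BD})^{T}\mathbf{BD}=\sum_{i\le r}\sigma_iu_iv_i^T$, $\sigma_1\ge\dots\ge\sigma_r>0$, and some $s\le r$, put $c=-\sum_{i\le s}\sigma_i^{-1}v_iu_i^T(\mathbf{BD})^T\mathbf B\mathbf d^{(T)}$, $\tilde\theta_T=\psi_T+\sum_{K\ne T}c_K\psi_K$, $\hat\theta_T=\tilde\theta_T/\|\tilde\theta_T\|_{a_{\widetilde\omega}}$, where $s$ is such that $\|z_T^{-1}\Pi_\ell\hat\theta_T-\chi_T\|_{L^\infty(\Omega)}\le\delta_s$, with $z_T$ the value of $\Pi_\ell\hat\theta_T$ on $T$. *HSLOD basis.* For $\ell=0$ the functions $\varphi_{0,i}$ are the $\hat\theta_T$, $T\in\mathcal T_0$. For $\ell>0$ choose for each $T\in\mathcal T_{\ell-1}$ a set $\widetilde{\mathrm{ref}}(T)$ of $2^d-1$ of the elements of $\mathcal T_\ell$ contained in $T$. There is one function $\varphi_{\ell,i}$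 for every $T\in\mathcal T_{\ell-1}$ and $\tau\in\widetilde{\mathrm{ref}}(T)$: with $\omega$ the patch of order $m_\ell$ of $T$ in $\mathcal T_{\ell-1}$, it is a linear combination of the $\hat\theta_K$ with $K\in\mathcal T_{\ell,\omega}$ and $\hat\theta_K=0$ in $\Omega\setminus\omega$, which satisfies $\Pi_{\ell-1}\varphi_{\ell,i}=0$ and, among all such combinations, minimizes the least-squares error $$e(\varphi)=\Big(\sum_{T'\in\mathcal T_{\ell-1,\omega}}\ \sum_{K\in\widetilde{\mathrm{ref}}(T')}\big(\Pi_\ell\varphi|_K-\delta_{K\tau}\big)^2\Big)^{1/2}.$$ Put $e_{\ell,i}=e(\varphi_{\ell,i})$ and $\hat\varphi_{\ell,i}=\varphi_{\ell,i}/\|\varphi_{\ell,i}\|_a$ (read as $0$ if $\varphi_{\ell,i}=0$). Let $\hat{\mathbb A}_{\ell\ell}=(a(\hat\varphi_{\ell,i},\hat\varphi_{\ell,j}))_{ij}$ be the level-$\ell$ diagonal block of the stiffness matrix of the hierarchical basis. Let $\widetilde{\mathbf P}$ and $\mathbf P$ be the matrices whose $i$-th columns contain the values of $\Pi_\ell\varphi_{\ell,i}$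 and $\Pi_\ell\hat\varphi_{\ell,i}$ on the elements of $\mathcal T_\ell$, and put $\hat{\mathbf P}=H_\ell^{d/2-1}\mathbf P$. Let $\mathfrak n_{o,\ell}$ be the maximal number of functions $\hat\varphi_{\ell,i}$ whose supports all contain a common non-empty open subset of $\Omega$. Let $\lambda_{\min},\lambda_{\max}$ denote extreme eigenvalues and $\kappa=\lambda_{\max}/\lambda_{\min}$. **Theorem.** 1. For every $0\le\ell\le L$, $$\lambda_{\min}(\hat{\mathbb A}_{\ell\ell})\ge\frac{\pi^2\alpha}{4}\lambda_{\min}(\hat{\mathbf P}^T\hat{\mathbf P})\ \ (\ell>0),\qquad \lambda_{\min}(\hat{\mathbb A}_{\ell\ell})\ge\frac{\pi^2\alpha}{\mathrm{diam}^2(\Omega)}H_\ell^2\,\lambda_{\min}(\hat{\mathbf P}^T\hat{\mathbf P})\ \ (\ell=0).$$ If $\lambda_{\min}(\hat{\mathbf P}^T\hat{\mathbf P})>0$, then $\lambda_{\min}(\hat{\mathbb A}_{\ell\ell})>0$ and $$\kappa(\hat{\mathbb A}_{\ell\ell})\le\frac{4\,\mathfrak n_{o,\ell}}{\pi^2\alpha\,\lambda_{\min}(\hat{\mathbf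 P}^T\hat{\mathbf P})}\ \ (\ell>0),\qquad \kappa(\hat{\mathbb A}_{\ell\ell})\le\frac{\mathrm{diam}^2(\Omega)\,\mathfrak n_{o,\ell}}{\pi^2\alpha\,\lambda_{\min}(\hat{\mathbf P}^T\hat{\mathbf P})}H_\ell^{-2}\ \ (\ell=0).$$ 2. (Mesh independence.) For every $m_0$ there are $\delta_0,\varepsilon_0>0$ depending only on $d$ and $m_0$, and for all $0<\alpha\le\beta$ a constant $C>0$ depending only on $d,m_0,\alpha,\beta$ (in particular not on $\Omega$, $\mathbf A$, the meshes, $L$ or $\ell$), such that whenever $\delta_s\le\delta_0$ and all $m_\ell\le m_0$: * for $\ell=0$: $\lambda_{\min}(\hat{\mathbf P}^T\hat{\mathbf P})>0$, $\lambda_{\min}^{-1}(\hat{\mathbf P}^T\hat{\mathbf P})\le C$ and $\kappa(\hat{\mathbb A}_{00})\le C\,\mathrm{diam}^2(\Omega)\,H_0^{-2}$; * for $\ell>0$ with $\lambda_{\min}(\widetilde{\mathbf P}^T\widetilde{\mathbf P})>0$: $\lambda_{\min}(\hat{\mathbf P}^T\hat{\mathbf P})>0$, $\lambda_{\min}^{-1}(\hat{\mathbf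 P}^T\hat{\mathbf P})\le C/\lambda_{\min}(\widetilde{\mathbf P}^T\widetilde{\mathbf P})$ and $\kappa(\hat{\mathbb A}_{\ell\ell})\le C/\lambda_{\min}(\widetilde{\mathbf P}^T\widetilde{\mathbf P})$; * for $\ell>0$, if all least-squares errors satisfy $e_{\ell,i}\le\varepsilon_0$: $\lambda_{\min}(\widetilde{\mathbf P}^T\widetilde{\mathbf P})\ge\frac12$, $\lambda_{\min}(\hat{\mathbf P}^T\hat{\mathbf P})>0$, $\lambda_{\min}^{-1}(\hat{\mathbf P}^T\hat{\mathbf P})\le C$ and $\kappa(\hat{\mathbb A}_{\ell\ell})\le C$. -/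

import Mathlib

open MeasureTheory
open scoped Matrix

noncomputable section

namespace HSLOD

/-- Euclidean space `ℝ^d`. -/
abbrev E (d : ℕ) : Type := EuclideanSpace ℝ (Fin d)

/-- Multi-indices of grid cells and of grid nodes. -/
abbrev Cell (d : ℕ) : Type := Fin d → ℤ

/-! ### Eigenvalues and condition number of symmetric matrices -/

section Matrices

variable {ι : Type} [Fintype ι] [DecidableEq ι]

/-- Smallest eigenvalue of a symmetric real matrix. -/
def lamMin (M : Matrix ι ι ℝ) : ℝ := sInf (spectrum ℝ M)

/-- Largest eigenvalue of a symmetric real matrix. -/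
def lamMax (M : Matrix ι ι ℝ) : ℝ := sSup (spectrum ℝ M)

/-- Spectral condition number of a symmetric positive definite matrix. -/
def condNum (M : Matrix ι ι ℝ) : ℝ := lamMax M / lamMin M

/-- `M = ∑ i, σ i u_i v_iᵀ` is a (reduced) singular value decomposition of the square matrix `M`,
with positive singular values in decreasing order (so that `r` is the rank of `M`). -/
structure IsSVD (M : Matrix ι ι ℝ) (r : ℕ) (σ : Fin r → ℝ) (u v : Fin r → ι → ℝ) : Prop where
  pos : ∀ i, 0 < σ i
  anti : Antitone σ
  orthonormal_left : ∀ i j, u i ⬝ᵥ u j = if i = j then 1 else 0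
  orthonormal_right : ∀ i j, v i ⬝ᵥ v j = if i = j then 1 else 0
  eq_sum : M = ∑ i, σ i • Matrix.vecMulVec (u i) (v i)

end Matrices

/-! ### Coefficient and energy form -/

/-- `A` is a symmetric coefficient on `Ω` with spectral bounds `α` and `β` (so `A ∈ L^∞`). -/
structure IsCoefficient {d : ℕ} (Ω : Set (E d)) (α β : ℝ)
    (A : E d → Matrix (Fin d) (Fin d) ℝ) : Prop where
  meas : ∀ i j, AEMeasurable (fun x => A x i j) (volume.restrict Ω)
  symm : ∀ᵐ x ∂(volume.restrict Ω), (A x).IsSymm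
  bounds : ∀ᵐ x ∂(volume.restrict Ω), ∀ η : Fin d → ℝ,
    α * (η ⬝ᵥ η) ≤ (A x *ᵥ η) ⬝ᵥ η ∧ (A x *ᵥ η) ⬝ᵥ η ≤ β * (η ⬝ᵥ η)

/-- The gradient as a coordinate vector. It is applied only to continuous piecewise polynomial
functions on a grid, for which it is, almost everywhere, the weak gradient. -/
def grad {d : ℕ} (v : E d → ℝ) (x : E d) : Fin d → ℝ :=
  fun k => fderiv ℝ v x (EuclideanSpace.single k 1)

/-- `a_ω(u, v) = ∫_ω (A ∇u) · ∇v`. -/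
def aForm {d : ℕ} (A : E d → Matrix (Fin d) (Fin d) ℝ) (ω : Set (E d)) (u v : E d → ℝ) : ℝ :=
  ∫ x in ω, (A x *ᵥ grad u x) ⬝ᵥ grad v x

/-- Energy norm `‖v‖_{a_ω} = a_ω(v, v)^{1/2}`. -/
def aNorm {d : ℕ} (A : E d → Matrix (Fin d) (Fin d) ℝ) (ω : Set (E d)) (v : E d → ℝ) : ℝ :=
  Real.sqrt (aForm A ω v v)

/-- On `K`, the function `v` is a polynomial of degree at most one in each variable. -/
def IsQ1On {d : ℕ} (K : Set (E d)) (v : E d → ℝ) : Prop :=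
  ∃ c : Finset (Fin d) → ℝ, ∀ x ∈ K, v x = ∑ s, c s * ∏ k ∈ s, x k

/-! ### Nested Cartesian meshes -/

/-- A domain that is a finite union of cubes of side `H₀` of a Cartesian grid, its `L` successive
dyadic refinements, and a fine mesh that divides every cube of level `L` into `n ^ d` cubes. -/
structure MeshHierarchy (d : ℕ) where
  origin : E d
  H₀ : ℝ
  H₀_pos : 0 < H₀
  cells₀ : Finset (Cell d)
  cells₀_nonempty : cells₀.Nonempty
  L : ℕ
  n : ℕ
  two_le_n : 2 ≤ n

namespace MeshHierarchy

variable {d : ℕ} (G : MeshHierarchy d)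

/-- Closed cube with multi-index `z` in the grid of mesh size `H`. -/
def cube (H : ℝ) (z : Cell d) : Set (E d) :=
  {x | ∀ k, G.origin k + H * z k ≤ x k ∧ x k ≤ G.origin k + H * (z k + 1)}

/-- Multi-indices of the cells obtained by dividing each cell of the initial mesh into `r ^ d`. -/
def refinedCells (r : ℕ) : Finset (Cell d) :=
  G.cells₀.biUnion fun z =>
    Fintype.piFinset fun k => Finset.Ico ((r : ℤ) * z k) ((r : ℤ) * z k + r)

/-- Mesh size `H_ℓ = H₀ / 2^ℓ`. -/
def size (ℓ : ℕ) : ℝ := G.H₀ / 2 ^ ℓ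

/-- The mesh `𝒯_ℓ` (as a set of multi-indices). -/
def mesh (ℓ : ℕ) : Finset (Cell d) := G.refinedCells (2 ^ ℓ)

/-- The element of `𝒯_ℓ` with multi-index `z`. -/
def elem (ℓ : ℕ) (z : Cell d) : Set (E d) := G.cube (G.size ℓ) z

/-- Fine mesh size `h = H_L / n`. -/
def fineSize : ℝ := G.size G.L / G.n

/-- The fine mesh `𝒯_h`. -/
def fineMesh : Finset (Cell d) := G.refinedCells (2 ^ G.L * G.n)

/-- The element of `𝒯_h` with multi-index `z`. -/
def fineElem (z : Cell d) : Set (E d) := G.cube G.fineSize z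

/-- Union of a set of elements of level `ℓ`. -/
def region (ℓ : ℕ) (P : Finset (Cell d)) : Set (E d) := ⋃ z ∈ P, G.elem ℓ z

/-- The (open) domain `Ω`. -/
def Ω : Set (E d) := interior (G.region 0 (G.mesh 0))

open Classical in
/-- Elements of the patch of order `m` around `T ∈ 𝒯_ℓ`: the patch of order `m + 1` consists of the
elements of `𝒯_ℓ` that meet the patch of order `m`. -/
def patch (ℓ : ℕ) (T : Cell d) : ℕ → Finset (Cell d)
  | 0 => {T}
  | m + 1 => (G.mesh ℓ).filter fun K => (G.elem ℓ K ∩ G.region ℓ (patch ℓ T m)).Nonempty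

open Classical in
/-- `𝒯_{ℓ,ω}`, the elements of `𝒯_ℓ` that are contained in `ω`. -/
def meshIn (ℓ : ℕ) (ω : Set (E d)) : Finset (Cell d) :=
  (G.mesh ℓ).filter fun K => G.elem ℓ K ⊆ ω

/-- `χ_K` for `K ∈ 𝒯_ℓ`. -/
def chi (ℓ : ℕ) (K : Cell d) : E d → ℝ := (G.elem ℓ K).indicator fun _ => 1

/-- Mean value on `K ∈ 𝒯_ℓ`, that is, the coefficient of `χ_K` in the `L²`-projection `Π_ℓ v`. -/
def mean (ℓ : ℕ) (K : Cell d) (v : E d → ℝ) : ℝ := ⨍ x in G.elem ℓ K, v x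

/-- The `Q₁` finite element space with zero boundary values on a union `ω` of elements; its members
are extended by zero outside `ω`. (A piecewise `Q₁` function is in `H¹₀(ω)` if and only if its
extension by zero is continuous.) -/
def femSpace (ω : Set (E d)) : Set (E d → ℝ) :=
  {v | Continuous v ∧ (∀ x, x ∉ interior ω → v x = 0) ∧
    ∀ τ ∈ G.fineMesh, G.fineElem τ ⊆ ω → IsQ1On (G.fineElem τ) v}

/-- The fine grid node with multi-index `z`. -/
def node (z : Cell d) : E d := WithLp.toLp 2 fun k => G.origin k + G.fineSize * z k

/-- The standard `Q₁` nodal basis function of the node `z`. -/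
def hat (z : Cell d) (x : E d) : ℝ :=
  ∏ k, max 0 (1 - |(x k - G.origin k) / G.fineSize - z k|)

open Classical in
/-- Nodes of the fine mesh of `ω` that lie on `Σ_ω = ∂ω \ ∂Ω`. -/
def sigmaNodes (ω : Set (E d)) : Finset (Cell d) :=
  ((G.fineMesh.filter fun τ => G.fineElem τ ⊆ ω).biUnion fun τ =>
    Fintype.piFinset fun k => ({τ k, τ k + 1} : Finset ℤ)).filter
      fun z => G.node z ∈ frontier ω \ frontier G.Ω

/-- `𝒜_{h,ω}⁻¹ g`: the `u` in the finite element space on `ω` such that `a_ω(u, w) = (g, w)_{L²(ω)}`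
for all `w` in that space. -/
def solve (A : E d → Matrix (Fin d) (Fin d) ℝ) (ω : Set (E d)) (g : E d → ℝ) : E d → ℝ :=
  Classical.epsilon fun u => u ∈ G.femSpace ω ∧
    ∀ w ∈ G.femSpace ω, aForm A ω u w = ∫ x in ω, g x * w x

/-! ### Localized orthogonal decomposition on a patch `ω`, at level `ℓ` -/

/-- The matrix of `𝒟 = Π ∘ 𝒜_{h,ω}⁻¹` on the piecewise constants of `𝒯_{ℓ,ω}`. -/
def dMat (A : E d → Matrix (Fin d) (Fin d) ℝ) (ℓ : ℕ) (ω : Set (E d)) :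
    Matrix (G.meshIn ℓ ω) (G.meshIn ℓ ω) ℝ :=
  Matrix.of fun K K' => G.mean ℓ K (G.solve A ω (G.chi ℓ K'))

/-- `g_K = 𝒟⁻¹ χ_K`. -/
def gLOD (A : E d → Matrix (Fin d) (Fin d) ℝ) (ℓ : ℕ) (ω : Set (E d)) (K : G.meshIn ℓ ω) :
    E d → ℝ :=
  fun x => ∑ τ, (G.dMat A ℓ ω)⁻¹ τ K * G.chi ℓ τ x

/-- `ψ_K = 𝒜_{h,ω}⁻¹ g_K`; for the central element this is the LOD basis function. -/
def psiLOD (A : E d → Matrix (Fin d) (Fin d) ℝ) (ℓ : ℕ) (ω : Set (E d)) (K : G.meshIn ℓ ω) :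
    E d → ℝ :=
  G.solve A ω (G.gLOD A ℓ ω K)

/-- The matrix `B` of conormal derivatives of the functions `𝒜_{h,ω}⁻¹ χ_K`, tested against the
nodal functions of the nodes on `Σ_ω`. -/
def bMat (A : E d → Matrix (Fin d) (Fin d) ℝ) (ℓ : ℕ) (ω : Set (E d)) :
    Matrix (G.sigmaNodes ω) (G.meshIn ℓ ω) ℝ :=
  Matrix.of fun i K =>
    aForm A ω (G.solve A ω (G.chi ℓ K)) (G.hat i) - ∫ x in ω, G.chi ℓ K x * G.hat i x

/-- `B D`, where the columns of `D` are the coefficient vectors of `g_K`, for `K ≠ T`. -/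
def bdMat (A : E d → Matrix (Fin d) (Fin d) ℝ) (ℓ : ℕ) (ω : Set (E d)) (T : G.meshIn ℓ ω) :
    Matrix (G.sigmaNodes ω) {K : G.meshIn ℓ ω // K ≠ T} ℝ :=
  G.bMat A ℓ ω * ((G.dMat A ℓ ω)⁻¹).submatrix id Subtype.val

/-- `c` is the solution of the least-squares problem `B D c ≈ -B d^(T)` obtained from a singular
value decomposition of `(B D)ᵀ B D` that is truncated after its `s` largest singular values. -/
def IsTruncatedCorrection (A : E d → Matrix (Fin d) (Fin d) ℝ) (ℓ : ℕ) (ω : Set (E d))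
    (T : G.meshIn ℓ ω) (c : {K : G.meshIn ℓ ω // K ≠ T} → ℝ) : Prop :=
  ∃ (r : ℕ) (σ : Fin r → ℝ) (u v : Fin r → {K : G.meshIn ℓ ω // K ≠ T} → ℝ) (s : ℕ),
    IsSVD ((G.bdMat A ℓ ω T)ᵀ * G.bdMat A ℓ ω T) r σ u v ∧ s ≤ r ∧
    c = -((∑ i : Fin r with i.val < s, (σ i)⁻¹ • Matrix.vecMulVec (v i) (u i)) *ᵥ
      ((G.bdMat A ℓ ω T)ᵀ *ᵥ (G.bMat A ℓ ω *ᵥ fun τ => (G.dMat A ℓ ω)⁻¹ τ T)))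

/-- The corrected function `ψ_T + ∑_{K ≠ T} c_K ψ_K`, before normalization. -/
def thetaRaw (A : E d → Matrix (Fin d) (Fin d) ℝ) (ℓ : ℕ) (ω : Set (E d)) (T : G.meshIn ℓ ω)
    (c : {K : G.meshIn ℓ ω // K ≠ T} → ℝ) : E d → ℝ :=
  fun x => G.psiLOD A ℓ ω T x + ∑ K, c K * G.psiLOD A ℓ ω K.1 x

/-- The normalized SLOD function. -/
def theta (A : E d → Matrix (Fin d) (Fin d) ℝ) (ℓ : ℕ) (ω : Set (E d)) (T : G.meshIn ℓ ω)
    (c : {K : G.meshIn ℓ ω // K ≠ T} → ℝ) : E d → ℝ :=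
  fun x => G.thetaRaw A ℓ ω T c x / aNorm A ω (G.thetaRaw A ℓ ω T c)

theorem elem_nonempty (ℓ : ℕ) (z : Cell d) : (G.elem ℓ z).Nonempty := by
  have h : 0 < G.size ℓ := div_pos G.H₀_pos (by positivity)
  refine ⟨WithLp.toLp 2 fun k => G.origin k + G.size ℓ * z k, fun k => ⟨le_rfl, ?_⟩⟩
  show G.origin k + G.size ℓ * z k ≤ G.origin k + G.size ℓ * (z k + 1)
  nlinarith

theorem self_mem_patch (ℓ : ℕ) {T : Cell d} (hT : T ∈ G.mesh ℓ) (m : ℕ) :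
    T ∈ G.patch ℓ T m := by
  induction m with
  | zero => simp [patch]
  | succ m ih =>
    obtain ⟨x, hx⟩ := G.elem_nonempty ℓ T
    have h : x ∈ G.region ℓ (G.patch ℓ T m) := Set.mem_biUnion ih hx
    simp only [patch, Finset.mem_filter]
    exact ⟨hT, x, hx, h⟩

/-- The closed patch of order `m` around `T ∈ 𝒯_ℓ`. -/
def patchSet (ℓ m : ℕ) (T : Cell d) : Set (E d) := G.region ℓ (G.patch ℓ T m)

theorem self_mem_meshIn (ℓ m : ℕ) (T : G.mesh ℓ) : T.1 ∈ G.meshIn ℓ (G.patchSet ℓ m T) := by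
  simp only [meshIn, Finset.mem_filter]
  exact ⟨T.2, fun x hx => Set.mem_biUnion (G.self_mem_patch ℓ T.2 m) hx⟩

/-- `T`, as an element of its own patch. -/
def center (ℓ m : ℕ) (T : G.mesh ℓ) : G.meshIn ℓ (G.patchSet ℓ m T) :=
  ⟨T.1, G.self_mem_meshIn ℓ m T⟩

end MeshHierarchy

open MeshHierarchy

/-! ### The stabilized SLOD functions on all levels -/

/-- Stabilized SLOD functions on the levels `0, …, L`: patch orders `m ℓ ≥ 1` and, for every
element `T`, correction coefficients given by a truncated singular value decomposition, where the
truncation is such that the stability condition with parameter `δs` is satisfied. -/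
structure SLODFamily {d : ℕ} (G : MeshHierarchy d) (A : E d → Matrix (Fin d) (Fin d) ℝ)
    (δs : ℝ) where
  m : ℕ → ℕ
  one_le_m : ∀ ℓ ≤ G.L, 1 ≤ m ℓ
  corr : ∀ (ℓ : ℕ) (T : G.mesh ℓ),
    {K : G.meshIn ℓ (G.patchSet ℓ (m ℓ) T) // K ≠ G.center ℓ (m ℓ) T} → ℝ
  corr_spec : ∀ ℓ ≤ G.L, ∀ T : G.mesh ℓ,
    G.IsTruncatedCorrection A ℓ (G.patchSet ℓ (m ℓ) T) (G.center ℓ (m ℓ) T) (corr ℓ T)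
  stable : ∀ ℓ ≤ G.L, ∀ T : G.mesh ℓ, ∀ K ∈ G.mesh ℓ,
    |G.mean ℓ K (G.theta A ℓ (G.patchSet ℓ (m ℓ) T) (G.center ℓ (m ℓ) T) (corr ℓ T)) /
      G.mean ℓ T (G.theta A ℓ (G.patchSet ℓ (m ℓ) T) (G.center ℓ (m ℓ) T) (corr ℓ T)) -
      (if K = T.1 then 1 else 0)| ≤ δs

namespace SLODFamily

variable {d : ℕ} {G : MeshHierarchy d} {A : E d → Matrix (Fin d) (Fin d) ℝ} {δs : ℝ}
  (F : SLODFamily G A δs)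

/-- The normalized SLOD basis function of level `ℓ` associated with `T ∈ 𝒯_ℓ`. -/
def slod (ℓ : ℕ) (T : G.mesh ℓ) : E d → ℝ :=
  G.theta A ℓ (G.patchSet ℓ (F.m ℓ) T) (G.center ℓ (F.m ℓ) T) (F.corr ℓ T)

/-- The patch, made of elements of `𝒯_ℓ` and centred at `T ∈ 𝒯_ℓ`, on which the hierarchical basis
functions of level `ℓ + 1` are supported. -/
def bigPatch (ℓ : ℕ) (T : G.mesh ℓ) : Set (E d) := G.patchSet ℓ (F.m (ℓ + 1)) T

open Classical in
/-- The elements of `𝒯_{ℓ+1}` in the patch `ω` of `T ∈ 𝒯_ℓ` whose SLOD function vanishes in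
`Ω \ ω`. -/
def sSet (ℓ : ℕ) (T : G.mesh ℓ) : Finset (G.mesh (ℓ + 1)) :=
  (Finset.univ : Finset (G.mesh (ℓ + 1))).filter fun K => G.elem (ℓ + 1) K ⊆ F.bigPatch ℓ T ∧
    ∀ x ∈ G.Ω \ F.bigPatch ℓ T, F.slod (ℓ + 1) K x = 0

/-- The combination `∑ d_K θ_K` over the SLOD functions supported in the patch of `T ∈ 𝒯_ℓ`. -/
def combo (ℓ : ℕ) (T : G.mesh ℓ) (c : G.mesh (ℓ + 1) → ℝ) : E d → ℝ :=
  fun x => ∑ K ∈ F.sSet ℓ T, c K * F.slod (ℓ + 1) K x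

/-- The condition `Π_ℓ φ = 0`. -/
def MeanFree (G : MeshHierarchy d) (ℓ : ℕ) (v : E d → ℝ) : Prop :=
  ∀ T ∈ G.mesh ℓ, G.mean ℓ T v = 0

open Classical in
/-- Squared (Euclidean) residual of the condition `Π̃ φ = χ_τ` on the patch of `T ∈ 𝒯_ℓ`, where `Π̃` is
the projection onto the piecewise constants on the selected children of the elements of `𝒯_ℓ` in
this patch. -/
def residual (ℓ : ℕ) (keep : G.mesh ℓ → Finset (Cell d)) (T : G.mesh ℓ) (τ : Cell d)
    (v : E d → ℝ) : ℝ :=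
  ∑ T' ∈ (Finset.univ : Finset (G.mesh ℓ)).filter
      (fun T' : G.mesh ℓ => G.elem ℓ T' ⊆ F.bigPatch ℓ T),
    ∑ K ∈ keep T', (G.mean (ℓ + 1) K v - if K = τ then 1 else 0) ^ 2

end SLODFamily

open Classical in
/-- The children `ref(T) ⊂ 𝒯_{ℓ+1}` of `T ∈ 𝒯_ℓ`. -/
def children {d : ℕ} (G : MeshHierarchy d) (ℓ : ℕ) (T : Cell d) : Finset (Cell d) :=
  (G.mesh (ℓ + 1)).filter fun K => G.elem (ℓ + 1) K ⊆ G.elem ℓ T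

/-! ### The hierarchical basis -/

/-- The HSLOD construction: for every element `T` of `𝒯_ℓ`, `ℓ < L`, a selection of `2^d - 1` of its
children and, for every selected child `τ`, coefficients of a combination of SLOD functions of level
`ℓ + 1` that has vanishing means on `𝒯_ℓ` and, subject to this constraint, satisfies the condition
`Π̃ φ = χ_τ` in the least-squares sense. -/
structure HSLODFamily {d : ℕ} (G : MeshHierarchy d) (A : E d → Matrix (Fin d) (Fin d) ℝ)
    (δs : ℝ) extends SLODFamily G A δs where
  keep : ∀ ℓ : ℕ, G.mesh ℓ → Finset (Cell d)
  keep_subset : ∀ ℓ < G.L, ∀ T : G.mesh ℓ, keep ℓ T ⊆ children G ℓ T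
  keep_card : ∀ ℓ < G.L, ∀ T : G.mesh ℓ, (keep ℓ T).card = 2 ^ d - 1
  coef : ∀ (ℓ : ℕ) (T : G.mesh ℓ), keep ℓ T → G.mesh (ℓ + 1) → ℝ
  meanFree : ∀ ℓ < G.L, ∀ (T : G.mesh ℓ) (τ : keep ℓ T),
    SLODFamily.MeanFree G ℓ (toSLODFamily.combo ℓ T (coef ℓ T τ))
  leastSquares : ∀ ℓ < G.L, ∀ (T : G.mesh ℓ) (τ : keep ℓ T) (c : G.mesh (ℓ + 1) → ℝ),
    SLODFamily.MeanFree G ℓ (toSLODFamily.combo ℓ T c) →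
    toSLODFamily.residual ℓ (keep ℓ) T τ (toSLODFamily.combo ℓ T (coef ℓ T τ)) ≤
      toSLODFamily.residual ℓ (keep ℓ) T τ (toSLODFamily.combo ℓ T c)

namespace HSLODFamily

variable {d : ℕ} {G : MeshHierarchy d} {A : E d → Matrix (Fin d) (Fin d) ℝ} {δs : ℝ}
  (F : HSLODFamily G A δs)

/-- Index set of the basis functions of level `ℓ`: the elements of `𝒯_0` for `ℓ = 0`, and the
selected children of the elements of `𝒯_{ℓ-1}` for `ℓ > 0`. -/
def Idx : ℕ → Type
  | 0 => G.mesh 0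
  | ℓ + 1 => Σ T : G.mesh ℓ, F.keep ℓ T

instance (ℓ : ℕ) : Fintype (F.Idx ℓ) :=
  match ℓ with
  | 0 => inferInstanceAs (Fintype (G.mesh 0))
  | ℓ + 1 => inferInstanceAs (Fintype (Σ T : G.mesh ℓ, F.keep ℓ T))

instance (ℓ : ℕ) : DecidableEq (F.Idx ℓ) :=
  match ℓ with
  | 0 => inferInstanceAs (DecidableEq (G.mesh 0))
  | ℓ + 1 => inferInstanceAs (DecidableEq (Σ T : G.mesh ℓ, F.keep ℓ T))

/-- The HSLOD functions before normalization. -/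
def hslod : (ℓ : ℕ) → F.Idx ℓ → E d → ℝ
  | 0, T => F.slod 0 T
  | ℓ + 1, ⟨T, τ⟩ => F.combo ℓ T (F.coef ℓ T τ)

/-- The basis functions of level `ℓ`, normalized in the energy norm. -/
def basisFun (ℓ : ℕ) (i : F.Idx ℓ) : E d → ℝ :=
  fun x => F.hslod ℓ i x / aNorm A G.Ω (F.hslod ℓ i)

/-- Least-squares error in the condition `Π̃ φ = χ_τ` (there is no such condition on level `0`). -/
def lsqError : (ℓ : ℕ) → F.Idx ℓ → ℝ
  | 0, _ => 0
  | ℓ + 1, ⟨T, τ⟩ => Real.sqrt (F.residual ℓ (F.keep ℓ) T τ (F.combo ℓ T (F.coef ℓ T τ)))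

/-- Stiffness matrix of the hierarchical basis (all levels `0, …, L`). -/
def stiffness : Matrix (Σ ℓ : Fin (G.L + 1), F.Idx ℓ) (Σ ℓ : Fin (G.L + 1), F.Idx ℓ) ℝ :=
  Matrix.of fun i j => aForm A G.Ω (F.basisFun i.1 i.2) (F.basisFun j.1 j.2)

/-- Diagonal block of level `ℓ` of the stiffness matrix. -/
def block (ℓ : Fin (G.L + 1)) : Matrix (F.Idx ℓ) (F.Idx ℓ) ℝ := F.stiffness.blockDiag' ℓ

/-- The matrix `P̃`: coefficients of `Π_ℓ` of the functions of level `ℓ` before normalization. -/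
def pTilde (ℓ : ℕ) : Matrix (G.mesh ℓ) (F.Idx ℓ) ℝ :=
  Matrix.of fun K i => G.mean ℓ K (F.hslod ℓ i)

/-- The matrix `P`: coefficients of `Π_ℓ` of the normalized functions of level `ℓ`. -/
def pMat (ℓ : ℕ) : Matrix (G.mesh ℓ) (F.Idx ℓ) ℝ :=
  Matrix.of fun K i => G.mean ℓ K (F.basisFun ℓ i)

/-- The scaled matrix `P̂ = H_ℓ^{d/2 - 1} P`. -/
def pHat (ℓ : ℕ) : Matrix (G.mesh ℓ) (F.Idx ℓ) ℝ :=
  (G.size ℓ ^ ((d : ℝ) / 2 - 1)) • F.pMat ℓ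

open Classical in
/-- The maximal number of basis functions of level `ℓ` whose supports overlap over a common region
(nonempty open subset) of `Ω`. -/
def overlap (ℓ : ℕ) : ℕ :=
  ((Finset.univ : Finset (Finset (F.Idx ℓ))).filter fun I =>
    ∃ U : Set (E d), IsOpen U ∧ U.Nonempty ∧ U ⊆ G.Ω ∧
      ∀ i ∈ I, U ⊆ tsupport (F.basisFun ℓ i)).sup Finset.card

end HSLODFamily

end HSLOD

end

open HSLOD

namespace HSLOD

/-! Write `v = ∑ x_i φ̂_i`, so that the quadratic form of the diagonal block at `x` is `a(v, v)`.

Lower bound. Ellipticity gives `a(v, v) ≥ α ‖∇v‖²`. For `ℓ > 0` the function `v` has mean zero on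
every cube of side `H_{ℓ-1} = 2 H_ℓ`, and Poincaré's inequality with the sharp constant `H_{ℓ-1} /
π` (`FE.poincare`) bounds `‖v‖²` by `4 H_ℓ² / π² ‖∇v‖²`; for `ℓ = 0` Friedrichs' inequality with the
constant `diam Ω / π` replaces it (`FE.friedrichs`). The projection onto piecewise constants is a
contraction, so `H_ℓ^d |P x|² = H_ℓ² |P̂ x|²` is at most `‖v‖²`. Both inequalities come from sharp
one-dimensional ones, by tensorization of the variance and by integration over lines respectively.

Upper bound. At almost every point at most `overlap` of the gradients are nonzero, and each `φ̂_i`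
has energy at most one, so `lamMax` of the block is at most `overlap` (`lamMax_block_le`). This
number is bounded by counting elements whose indices are close to each other.

Mesh independence. The SLOD function of `T`, rescaled to have mean one on `T`, is energy-orthogonal
to the functions without means on its patch. Hence it minimizes the energy among functions with the
same means, and comparison with a sum of bubbles bounds its energy by a constant times `H_ℓ^(d-2)`
(`aForm_le_of_orthogonal`, `exists_slod_eq_smul`). Stability makes the matrix of means of the
rescaled functions a sparse small perturbation of the identity, which is bounded below
(`half_sum_sq_le`). On level `0` these two facts bound `P̂` from below.

For `ℓ > 0` the zero combination competes in the least-squares problem, so the residual of `φ_{ℓ,i}`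
is bounded; this bounds the means on selected children, and the vanishing mean on the parent then
bounds the one on the omitted child. By the perturbation lemma the means control the coefficients,
hence the energy of `φ_{ℓ,i}` is at most a constant times `H_ℓ^(d-2)` (`aForm_hslod_le`). Since `P`
is `P̃` with its columns divided by the energy norms, the bound passes from `P̃` to `P̂`. If the
least-squares errors are small, the rows of `P̃` at selected children are once more a sparse small
perturbation of the identity. -/

theorem isHermitian_gram {ι κ : Type} [Fintype κ] (P : Matrix κ ι ℝ) : (Pᵀ * P).IsHermitian := by
  rw [Matrix.IsHermitian, Matrix.conjTranspose_eq_transpose_of_trivial]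
  simp [Matrix.transpose_mul]

/-! ### Gram matrices and extreme eigenvalues of symmetric matrices -/

section Gram

variable {ι κ : Type} [Fintype ι] [Fintype κ]

theorem dotProduct_self_pos_of_ne_zero {x : ι → ℝ} (hx : x ≠ 0) : 0 < x ⬝ᵥ x := by
  have := Matrix.dotProduct_star_self_pos_iff.2 hx
  simpa using this

theorem dotProduct_gram (P : Matrix κ ι ℝ) (x : ι → ℝ) :
    x ⬝ᵥ ((Pᵀ * P) *ᵥ x) = ∑ k, (P *ᵥ x) k ^ 2 := by
  rw [← Matrix.mulVec_mulVec, Matrix.dotProduct_mulVec, Matrix.vecMul_transpose]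
  simp [dotProduct, sq]

end Gram

section Spectral

variable {ι : Type} [Fintype ι] [DecidableEq ι]

theorem spectrum_finite_matrix (M : Matrix ι ι ℝ) : (spectrum ℝ M).Finite := by
  exact Module.End.finite_spectrum (Matrix.toLin' M) |>.subset (by rw [Matrix.spectrum_toLin'])

theorem spectrum_nonempty_of_isHermitian [Nonempty ι] {M : Matrix ι ι ℝ} (hM : M.IsHermitian) :
    (spectrum ℝ M).Nonempty := by
  rw [hM.spectrum_real_eq_range_eigenvalues]
  exact Set.range_nonempty _

theorem lamMin_mem_spectrum [Nonempty ι] {M : Matrix ι ι ℝ} (hM : M.IsHermitian) :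
    lamMin M ∈ spectrum ℝ M :=
  (spectrum_nonempty_of_isHermitian hM).csInf_mem (spectrum_finite_matrix M)

theorem lamMax_mem_spectrum [Nonempty ι] {M : Matrix ι ι ℝ} (hM : M.IsHermitian) :
    lamMax M ∈ spectrum ℝ M :=
  (spectrum_nonempty_of_isHermitian hM).csSup_mem (spectrum_finite_matrix M)

theorem exists_eigenvector_of_mem_spectrum {M : Matrix ι ι ℝ} {μ : ℝ} (h : μ ∈ spectrum ℝ M) :
    ∃ x : ι → ℝ, x ≠ 0 ∧ M *ᵥ x = μ • x := by
  rw [← Matrix.spectrum_toLin', ← Module.End.hasEigenvalue_iff_mem_spectrum] at h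
  obtain ⟨x, hx⟩ := h.exists_hasEigenvector
  exact ⟨x, hx.2, by simpa using hx.apply_eq_smul⟩

theorem le_lamMin [Nonempty ι] {M : Matrix ι ι ℝ} (hM : M.IsHermitian) {c : ℝ}
    (h : ∀ x : ι → ℝ, c * (x ⬝ᵥ x) ≤ x ⬝ᵥ (M *ᵥ x)) : c ≤ lamMin M := by
  obtain ⟨x, hx, he⟩ := exists_eigenvector_of_mem_spectrum (lamMin_mem_spectrum hM)
  have h1 := h x
  rw [he, dotProduct_smul, smul_eq_mul] at h1
  exact le_of_mul_le_mul_right h1 (dotProduct_self_pos_of_ne_zero hx)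

theorem lamMax_le [Nonempty ι] {M : Matrix ι ι ℝ} (hM : M.IsHermitian) {c : ℝ}
    (h : ∀ x : ι → ℝ, x ⬝ᵥ (M *ᵥ x) ≤ c * (x ⬝ᵥ x)) : lamMax M ≤ c := by
  obtain ⟨x, hx, he⟩ := exists_eigenvector_of_mem_spectrum (lamMax_mem_spectrum hM)
  have h1 := h x
  rw [he, dotProduct_smul, smul_eq_mul] at h1
  exact le_of_mul_le_mul_right h1 (dotProduct_self_pos_of_ne_zero hx)

/-- Subtracting `lamMin M` times the identity shifts the spectrum into `[0, ∞)`, so the shifted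
matrix is positive semidefinite. -/
theorem lamMin_mul_le {M : Matrix ι ι ℝ} (hM : M.IsHermitian) (x : ι → ℝ) :
    lamMin M * (x ⬝ᵥ x) ≤ x ⬝ᵥ (M *ᵥ x) := by
  have hN : (M - lamMin M • (1 : Matrix ι ι ℝ)).IsHermitian :=
    hM.sub (by rw [Matrix.IsHermitian, Matrix.conjTranspose_smul]; simp)
  have h : (M - lamMin M • (1 : Matrix ι ι ℝ)).PosSemidef := by
    rw [Matrix.posSemidef_iff_isHermitian_and_spectrum_nonneg]
    refine ⟨hN, fun μ hμ => ?_⟩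
    have h2 : μ + lamMin M ∈ spectrum ℝ M := by
      have := (spectrum.add_mem_add_iff (a := M - lamMin M • (1 : Matrix ι ι ℝ)) (r := μ)
        (s := lamMin M)).2 hμ
      rw [Algebra.algebraMap_eq_smul_one] at this
      simpa [add_comm] using this
    have h3 : lamMin M ≤ μ + lamMin M := csInf_le (spectrum_finite_matrix M).bddBelow h2
    simpa using h3
  have := h.dotProduct_mulVec_nonneg x
  simp only [star_trivial, Matrix.sub_mulVec, Matrix.smul_mulVec, Matrix.one_mulVec,
    dotProduct_sub, dotProduct_smul, smul_eq_mul] at this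
  linarith

end Spectral

/-! ### Sparse matrices with small entries -/

section Schur

variable {ι κ : Type*} [Fintype ι] [Fintype κ]

/-- A matrix with small entries and few of them in every row and column has a small norm. -/
theorem sum_sq_sparse_le (e : κ → ι → ℝ) (R : κ → ι → Prop) [∀ k i, Decidable (R k i)]
    {δ N : ℝ} (hR : ∀ k i, ¬ R k i → e k i = 0) (hδ : ∀ k i, |e k i| ≤ δ)
    (hrow : ∀ k, ((Finset.univ.filter fun i => R k i).card : ℝ) ≤ N)
    (hcol : ∀ i, ((Finset.univ.filter fun k => R k i).card : ℝ) ≤ N) (hN : 0 ≤ N)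
    (x : ι → ℝ) :
    ∑ k, (∑ i, e k i * x i) ^ 2 ≤ (N * δ) ^ 2 * ∑ i, x i ^ 2 := by
  have h1 : ∀ k, (∑ i, e k i * x i) ^ 2 ≤ N * δ ^ 2 * ∑ i, if R k i then x i ^ 2 else 0 := by
    intro k
    have h2 : ∑ i, e k i * x i = ∑ i with R k i, e k i * x i := by
      rw [Finset.sum_filter]
      refine Finset.sum_congr rfl fun i _ => ?_
      split_ifs with h
      · rfl
      · rw [hR k i h, zero_mul]
    rw [h2, ← Finset.sum_filter]
    calc _ ≤ ((Finset.univ.filter fun i => R k i).card : ℝ) * ∑ i with R k i, (e k i * x i) ^ 2 :=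
          sq_sum_le_card_mul_sum_sq
      _ ≤ N * ∑ i with R k i, δ ^ 2 * x i ^ 2 := by
          refine mul_le_mul (hrow k) (Finset.sum_le_sum fun i _ => ?_)
            (Finset.sum_nonneg fun i _ => sq_nonneg _) hN
          rw [mul_pow]
          exact mul_le_mul_of_nonneg_right
            (sq_le_sq' (abs_le.1 (hδ k i)).1 (abs_le.1 (hδ k i)).2) (sq_nonneg _)
      _ = _ := by rw [← Finset.mul_sum]; ring
  calc _ ≤ ∑ k, N * δ ^ 2 * ∑ i, (if R k i then x i ^ 2 else 0) :=
        Finset.sum_le_sum fun k _ => h1 k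
    _ = N * δ ^ 2 * ∑ i, ((Finset.univ.filter fun k => R k i).card : ℝ) * x i ^ 2 := by
        rw [← Finset.mul_sum, Finset.sum_comm]
        congr 1
        refine Finset.sum_congr rfl fun i _ => ?_
        rw [← Finset.sum_filter, Finset.sum_const, nsmul_eq_mul]
    _ ≤ N * δ ^ 2 * ∑ i, N * x i ^ 2 := by
        gcongr with i
        exact hcol i
    _ = _ := by rw [← Finset.mul_sum]; ring

/-- Termwise, the difference of the two sides is the square `(y/2 + 2e)²`. -/
theorem sum_sq_add_ge (y e : κ → ℝ) :
    3 / 4 * ∑ k, y k ^ 2 - 3 * ∑ k, e k ^ 2 ≤ ∑ k, (y k + e k) ^ 2 := by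
  rw [Finset.mul_sum, Finset.mul_sum, ← Finset.sum_sub_distrib]
  refine Finset.sum_le_sum fun k _ => ?_
  nlinarith [sq_nonneg (y k / 2 + 2 * e k)]

end Schur

/-! ### Sharp Friedrichs and Poincaré inequalities on an interval -/

section Interval

variable {a b : ℝ} {u u' : ℝ → ℝ} {S : Set ℝ}

/-- Riccati argument: `τ = c tan (c (x - m))`, with `m` the midpoint, satisfies `τ' = c² + τ²`, so
`(u' + τ u)² ≥ 0` says `u'² ≥ c² u² - (τ u²)'`. The last term integrates to zero because `u`
vanishes at both ends. The strict inequality for `c` keeps the tangent finite on the closed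
interval. -/
theorem sq_mul_integral_sq_le_of_lt (hab : a < b) (hS : S.Countable)
    (hu : ContinuousOn u (Set.Icc a b)) (hd : ∀ x ∈ Set.Ioo a b \ S, HasDerivAt u (u' x) x)
    (hi : IntervalIntegrable u' volume a b)
    (hi2 : IntervalIntegrable (fun x => u' x ^ 2) volume a b) (ha : u a = 0) (hb : u b = 0)
    {c : ℝ} (hc0 : 0 < c) (hc : c < Real.pi / (b - a)) :
    c ^ 2 * ∫ x in a..b, u x ^ 2 ≤ ∫ x in a..b, u' x ^ 2 := by
  have hba : 0 < b - a := sub_pos.2 hab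
  rw [lt_div_iff₀ hba] at hc
  set m := (a + b) / 2 with hm
  have hcos : ∀ x ∈ Set.Icc a b, 0 < Real.cos (c * (x - m)) := by
    intro x hx
    apply Real.cos_pos_of_mem_Ioo
    constructor <;> nlinarith [hx.1, hx.2]
  have htan : ContinuousOn (fun x => Real.tan (c * (x - m))) (Set.Icc a b) := by
    refine ContinuousOn.congr (f := fun x => Real.sin (c * (x - m)) / Real.cos (c * (x - m)))
      ?_ fun x _ => Real.tan_eq_sin_div_cos _
    exact ContinuousOn.div (by fun_prop) (by fun_prop) fun x hx => (hcos x hx).ne'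
  have hcc : ContinuousOn (fun x => 1 / Real.cos (c * (x - m)) ^ 2) (Set.Icc a b) :=
    ContinuousOn.div (by fun_prop) (by fun_prop) fun x hx => (pow_pos (hcos x hx) 2).ne'
  have hIcc : Set.uIcc a b = Set.Icc a b := Set.uIcc_of_le hab.le
  -- `W'` is the derivative of `c tan (c (x - m)) u²` off `S`; the countable exceptional set is
  -- harmless in the fundamental theorem of calculus.
  set W' : ℝ → ℝ := fun x => c * (1 / Real.cos (c * (x - m)) ^ 2 * c) * u x ^ 2 +
    c * Real.tan (c * (x - m)) * (2 * u x) * u' x with hW'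
  have hWi : IntervalIntegrable W' volume a b := by
    refine IntervalIntegrable.add (ContinuousOn.intervalIntegrable ?_) ?_
    · rw [hIcc]
      exact (continuousOn_const.mul (hcc.mul continuousOn_const)).mul (hu.pow 2)
    · refine hi.continuousOn_mul ?_
      rw [hIcc]
      exact (continuousOn_const.mul htan).mul (continuousOn_const.mul hu)
  have hW : ∫ x in a..b, W' x = 0 := by
    rw [integral_eq_of_hasDerivAt_off_countable_of_le
      (fun x => c * Real.tan (c * (x - m)) * u x ^ 2) W' hab.le hS
      ((continuousOn_const.mul htan).mul (hu.pow 2)) _ hWi]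
    · simp [ha, hb]
    · intro x hx
      have h1 := hd x hx
      have h2 : HasDerivAt (fun x => c * (x - m)) c x := by
        simpa using ((hasDerivAt_id x).sub_const m).const_mul c
      have h3 := (Real.hasDerivAt_tan (hcos x (Set.Ioo_subset_Icc_self hx.1)).ne').comp x h2
      have h4 := (h3.const_mul c).mul (h1.pow 2)
      refine h4.congr_deriv ?_
      simp only [hW', Function.comp, Pi.pow_apply]
      push_cast
      ring
  have hui : IntervalIntegrable (fun x => c ^ 2 * u x ^ 2) volume a b := by
    refine ContinuousOn.intervalIntegrable ?_
    rw [hIcc]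
    exact continuousOn_const.mul (hu.pow 2)
  have key : ∫ x in a..b, (c ^ 2 * u x ^ 2 - W' x) ≤ ∫ x in a..b, u' x ^ 2 := by
    refine intervalIntegral.integral_mono_on hab.le (hui.sub hWi) hi2 fun x hx => ?_
    have h1 := (hcos x hx).ne'
    have h2 : 1 / Real.cos (c * (x - m)) ^ 2 = 1 + Real.tan (c * (x - m)) ^ 2 := by
      rw [Real.tan_eq_sin_div_cos, div_pow]
      field_simp
      nlinarith [Real.sin_sq_add_cos_sq (c * (x - m))]
    simp only [hW', h2]
    nlinarith [sq_nonneg (u' x + c * Real.tan (c * (x - m)) * u x)]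
  rw [intervalIntegral.integral_sub hui hWi, hW, intervalIntegral.integral_const_mul] at key
  linarith

/-- Friedrichs' inequality on an interval, with the sharp constant. -/
theorem integral_sq_le_of_zero_boundary (hab : a < b) (hS : S.Countable)
    (hu : ContinuousOn u (Set.Icc a b)) (hd : ∀ x ∈ Set.Ioo a b \ S, HasDerivAt u (u' x) x)
    (hi : IntervalIntegrable u' volume a b)
    (hi2 : IntervalIntegrable (fun x => u' x ^ 2) volume a b) (ha : u a = 0) (hb : u b = 0) :
    (Real.pi / (b - a)) ^ 2 * ∫ x in a..b, u x ^ 2 ≤ ∫ x in a..b, u' x ^ 2 := by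
  have hk : 0 < Real.pi / (b - a) := div_pos Real.pi_pos (sub_pos.2 hab)
  -- The critical constant itself is reached by letting `c` increase to `π / (b - a)`.
  have ht : Filter.Tendsto (fun c : ℝ => c ^ 2 * ∫ x in a..b, u x ^ 2)
      (nhdsWithin (Real.pi / (b - a)) (Set.Iio (Real.pi / (b - a))))
      (nhds ((Real.pi / (b - a)) ^ 2 * ∫ x in a..b, u x ^ 2)) :=
    (Continuous.tendsto (by fun_prop) _).mono_left nhdsWithin_le_nhds
  refine le_of_tendsto ht ?_
  filter_upwards [Ioo_mem_nhdsLT hk] with c hc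
  exact sq_mul_integral_sq_le_of_lt hab hS hu hd hi hi2 ha hb hc.1 hc.2

/-- Poincaré's inequality for functions with mean zero on an interval, with the sharp constant. -/
theorem integral_sq_le_of_integral_eq_zero (hab : a < b) (hS : S.Countable) (hu : Continuous u)
    (hd : ∀ x ∈ Set.Ioo a b \ S, HasDerivAt u (u' x) x)
    (hi : IntervalIntegrable u' volume a b)
    (hi2 : IntervalIntegrable (fun x => u' x ^ 2) volume a b) (h0 : ∫ x in a..b, u x = 0) :
    ∫ x in a..b, u x ^ 2 ≤ ((b - a) / Real.pi) ^ 2 * ∫ x in a..b, u' x ^ 2 := by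
  have hba : 0 < b - a := sub_pos.2 hab
  -- The antiderivative vanishes at both ends because `u` has mean zero, so Friedrichs' inequality
  -- applies to `U`, whose derivative is `u`.
  set U : ℝ → ℝ := fun x => ∫ t in a..x, u t with hU
  have hUd : ∀ x, HasDerivAt U (u x) x := fun x =>
    intervalIntegral.integral_hasDerivAt_right (hu.intervalIntegrable a x)
      (hu.stronglyMeasurableAtFilter _ _) hu.continuousAt
  have hUc : Continuous U := continuous_iff_continuousAt.2 fun x => (hUd x).continuousAt
  have hUa : U a = 0 := by simp [hU]
  have hUb : U b = 0 := h0
  have h1 := integral_sq_le_of_zero_boundary (u := U) (u' := u) hab Set.countable_empty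
    hUc.continuousOn (fun x _ => hUd x) (hu.intervalIntegrable a b)
    ((hu.pow 2).intervalIntegrable a b) hUa hUb
  set k := Real.pi / (b - a) with hk
  have hkpos : 0 < k := div_pos Real.pi_pos hba
  have hkinv : (b - a) / Real.pi = k⁻¹ := by rw [hk, inv_div]
  have hpi : IntervalIntegrable (fun x => U x * u' x) volume a b :=
    hi.continuousOn_mul hUc.continuousOn
  have hu2 : IntervalIntegrable (fun x => u x ^ 2) volume a b := (hu.pow 2).intervalIntegrable a b
  have h2 : ∫ x in a..b, (U x * u' x + u x ^ 2) = 0 := by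
    rw [integral_eq_of_hasDerivAt_off_countable_of_le (fun x => U x * u x)
      (fun x => U x * u' x + u x ^ 2) hab.le hS (hUc.mul hu).continuousOn _
      (hpi.add hu2)]
    · simp [hUa, hUb]
    · intro x hx
      refine ((hUd x).mul (hd x hx)).congr_deriv ?_
      ring
  rw [intervalIntegral.integral_add hpi hu2] at h2
  have hU2 : IntervalIntegrable (fun x => k ^ 2 * U x ^ 2) volume a b :=
    ((hUc.pow 2).intervalIntegrable a b).const_mul _
  -- Integration by parts gave `∫ u² = -∫ U u'`. Young's inequality with weight `k` leaves `k² ∫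
  -- U²`, which `h1` absorbs into one of the two copies of `∫ u²`.
  have h3 : ∫ x in a..b, -(2 * (U x * u' x)) ≤
      ∫ x in a..b, (k⁻¹ ^ 2 * u' x ^ 2 + k ^ 2 * U x ^ 2) := by
    refine intervalIntegral.integral_mono_on hab.le (hpi.const_mul 2).neg
      ((hi2.const_mul _).add hU2) fun x _ => ?_
    have h4 : k⁻¹ * k = 1 := inv_mul_cancel₀ hkpos.ne'
    have h5 : (k⁻¹ * u' x + k * U x) ^ 2 = k⁻¹ ^ 2 * u' x ^ 2 + k ^ 2 * U x ^ 2
        + 2 * (U x * u' x) := by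
      linear_combination 2 * U x * u' x * h4
    nlinarith [sq_nonneg (k⁻¹ * u' x + k * U x)]
  rw [intervalIntegral.integral_neg, intervalIntegral.integral_const_mul,
    intervalIntegral.integral_add (hi2.const_mul _) hU2,
    intervalIntegral.integral_const_mul, intervalIntegral.integral_const_mul] at h3
  rw [hkinv]
  linarith

/-- The variance form of Poincaré's inequality, obtained by subtracting the mean. It needs no
condition on the mean and is therefore the form that tensorizes. -/
theorem integral_sq_sub_le (hab : a < b) (hS : S.Countable) (hu : Continuous u)
    (hd : ∀ x ∈ Set.Ioo a b \ S, HasDerivAt u (u' x) x)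
    (hi : IntervalIntegrable u' volume a b)
    (hi2 : IntervalIntegrable (fun x => u' x ^ 2) volume a b) :
    (∫ x in a..b, u x ^ 2) - (b - a)⁻¹ * (∫ x in a..b, u x) ^ 2 ≤
      ((b - a) / Real.pi) ^ 2 * ∫ x in a..b, u' x ^ 2 := by
  have hba : b - a ≠ 0 := (sub_pos.2 hab).ne'
  set I := ∫ x in a..b, u x with hI
  set w := I / (b - a) with hw
  have h := integral_sq_le_of_integral_eq_zero (u := fun x => u x - w) (u' := u') hab hS
    (by fun_prop) (fun x hx => (hd x hx).sub_const w) hi hi2 (by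
      rw [intervalIntegral.integral_sub (hu.intervalIntegrable a b) (by simp)]
      simp only [intervalIntegral.integral_const, smul_eq_mul, hw]
      rw [← hI]; field_simp; ring)
  refine le_trans (le_of_eq ?_) h
  have h2 : ∀ x, (u x - w) ^ 2 = u x ^ 2 - 2 * w * u x + w ^ 2 := fun x => by ring
  simp_rw [h2]
  rw [intervalIntegral.integral_add (by apply Continuous.intervalIntegrable; fun_prop) (by simp),
    intervalIntegral.integral_sub (by apply Continuous.intervalIntegrable; fun_prop)
      (by apply Continuous.intervalIntegrable; fun_prop), intervalIntegral.integral_const_mul,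
    intervalIntegral.integral_const, smul_eq_mul, ← hI, hw]
  field_simp
  ring

end Interval

/-! ### Tensorization of the variance -/

section Product

variable {X Y : Type*} [MeasurableSpace X] [MeasurableSpace Y] {μ : Measure X} {ν : Measure Y}
  [IsFiniteMeasure μ] [IsFiniteMeasure ν]

theorem integrable_of_measurable_of_bounded {f : X → ℝ} (hf : Measurable f) {C : ℝ}
    (hC : ∀ x, |f x| ≤ C) : Integrable f μ :=
  Integrable.of_bound hf.aestronglyMeasurable C (Filter.Eventually.of_forall hC)

theorem integral_sub_const_sq {f : X → ℝ} (hf : Integrable f μ)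
    (hf2 : Integrable (fun x => f x ^ 2) μ) (w : ℝ) :
    ∫ x, (f x - w) ^ 2 ∂μ =
      (∫ x, f x ^ 2 ∂μ) - 2 * w * (∫ x, f x ∂μ) + μ.real Set.univ * w ^ 2 := by
  have h2 : ∀ x, (f x - w) ^ 2 = f x ^ 2 - 2 * w * f x + w ^ 2 := fun x => by ring
  have h3 : Integrable (fun x => f x ^ 2 - 2 * w * f x) μ := hf2.sub (hf.const_mul _)
  simp_rw [h2]
  rw [integral_add h3 (integrable_const _), integral_sub hf2 (hf.const_mul _),
    integral_const_mul, integral_const, smul_eq_mul]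

/-- Cauchy–Schwarz against the constant one: expand the nonnegative integral of `(f - mean)²`. The
zero measure has no mean and is treated separately. -/
theorem sq_integral_le {f : X → ℝ} (hf : Measurable f) {C : ℝ} (hC : ∀ x, |f x| ≤ C) :
    (∫ x, f x ∂μ) ^ 2 ≤ μ.real Set.univ * ∫ x, f x ^ 2 ∂μ := by
  set b := μ.real Set.univ with hb
  set I := ∫ x, f x ∂μ with hI
  have hif : Integrable f μ := integrable_of_measurable_of_bounded hf hC
  have hif2 : Integrable (fun x => f x ^ 2) μ :=
    integrable_of_measurable_of_bounded (hf.pow_const 2) (C := C ^ 2) fun x => by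
      rw [abs_pow]; exact pow_le_pow_left₀ (abs_nonneg _) (hC x) 2
  have hb0 : 0 ≤ b := measureReal_nonneg
  rcases hb0.eq_or_lt with h | h
  · have : μ = 0 := by
      rw [← Measure.measure_univ_eq_zero]
      exact (measureReal_eq_zero_iff).1 (hb.symm.trans h.symm)
    simp [hI, ← h, this]
  · have h1 : 0 ≤ ∫ x, (f x - I / b) ^ 2 ∂μ := integral_nonneg fun x => sq_nonneg _
    rw [integral_sub_const_sq hif hif2, ← hI, ← hb] at h1
    have h3 : b * (∫ x, f x ^ 2 ∂μ) - I ^ 2 =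
        b * ((∫ x, f x ^ 2 ∂μ) - 2 * (I / b) * I + b * (I / b) ^ 2) := by
      field_simp; ring
    nlinarith [mul_nonneg hb0 h1]

theorem abs_integral_le_of_bounded {f : X → ℝ} {C : ℝ} (hC : ∀ x, |f x| ≤ C) :
    |∫ x, f x ∂μ| ≤ C * μ.real Set.univ :=
  norm_integral_le_of_norm_le_const (f := f) (Filter.Eventually.of_forall hC)

/-- Tensorization of the variance for a product of two finite measures. -/
theorem variance_prod_le {f : X × Y → ℝ} (hf : Measurable f) {C : ℝ} (hC : ∀ p, |f p| ≤ C)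
    (hμ : 0 < μ.real Set.univ) (hν : 0 < ν.real Set.univ) :
    (∫ p, f p ^ 2 ∂(μ.prod ν)) -
        (μ.real Set.univ * ν.real Set.univ)⁻¹ * (∫ p, f p ∂(μ.prod ν)) ^ 2 ≤
      (∫ x, ((∫ y, f (x, y) ^ 2 ∂ν) - (ν.real Set.univ)⁻¹ * (∫ y, f (x, y) ∂ν) ^ 2) ∂μ) +
      ∫ y, ((∫ x, f (x, y) ^ 2 ∂μ) - (μ.real Set.univ)⁻¹ * (∫ x, f (x, y) ∂μ) ^ 2) ∂ν := by
  set a := μ.real Set.univ with ha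
  set b := ν.real Set.univ with hb
  have hf2 : Measurable fun p => f p ^ 2 := hf.pow_const 2
  have hC2 : ∀ p, |f p ^ 2| ≤ C ^ 2 := fun p => by
    rw [abs_pow]; exact pow_le_pow_left₀ (abs_nonneg _) (hC p) 2
  have hif : Integrable f (μ.prod ν) := integrable_of_measurable_of_bounded hf hC
  have hif2 : Integrable (fun p => f p ^ 2) (μ.prod ν) :=
    integrable_of_measurable_of_bounded hf2 hC2
  set m : X → ℝ := fun x => ∫ y, f (x, y) ∂ν with hm
  set F : Y → ℝ := fun y => ∫ x, f (x, y) ∂μ with hF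
  have hmm : Measurable m := (hf.stronglyMeasurable.integral_prod_right' (ν := ν)).measurable
  have hFm : Measurable F := (hf.stronglyMeasurable.integral_prod_left' (μ := μ)).measurable
  have hmC : ∀ x, |m x| ≤ C * b := fun x => abs_integral_le_of_bounded fun y => hC (x, y)
  have hFC : ∀ y, |F y| ≤ C * a := fun y => abs_integral_le_of_bounded fun x => hC (x, y)
  have hm2 : Integrable (fun x => m x ^ 2) μ :=
    integrable_of_measurable_of_bounded (hmm.pow_const 2) (C := (C * b) ^ 2) fun x => by
      rw [abs_pow]; exact pow_le_pow_left₀ (abs_nonneg _) (hmC x) 2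
  have hF2 : Integrable (fun y => F y ^ 2) ν :=
    integrable_of_measurable_of_bounded (hFm.pow_const 2) (C := (C * a) ^ 2) fun x => by
      rw [abs_pow]; exact pow_le_pow_left₀ (abs_nonneg _) (hFC x) 2
  have hmi : Integrable m μ := integrable_of_measurable_of_bounded hmm hmC
  set I := ∫ p, f p ∂(μ.prod ν) with hI
  have hIm : I = ∫ x, m x ∂μ := integral_prod f hif
  -- the averaged function has smaller variance
  have h1 : ∀ x, (m x - I / a) ^ 2 ≤ b * ∫ y, (f (x, y) - F y / a) ^ 2 ∂ν := by
    intro x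
    have hs : Measurable fun y => f (x, y) := hf.comp measurable_prodMk_left
    have h2 : m x - I / a = ∫ y, (f (x, y) - F y / a) ∂ν := by
      rw [integral_sub (integrable_of_measurable_of_bounded hs fun y => hC (x, y))
        ((integrable_of_measurable_of_bounded hFm hFC).div_const a), integral_div]
      rw [hI, integral_prod_symm f hif]
    rw [h2]
    refine sq_integral_le (C := C + C * a / a) (hs.sub (hFm.div_const a)) fun y => ?_
    refine (abs_sub _ _).trans (add_le_add (hC _) ?_)
    rw [abs_div, abs_of_pos hμ]
    exact div_le_div_of_nonneg_right (hFC y) hμ.le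
  have hg : Measurable fun p : X × Y => (f p - F p.2 / a) := by fun_prop
  have hgC : ∀ p : X × Y, |f p - F p.2 / a| ≤ C + C * a / a := fun p => by
    refine (abs_sub _ _).trans (add_le_add (hC _) ?_)
    rw [abs_div, abs_of_pos hμ]
    exact div_le_div_of_nonneg_right (hFC _) hμ.le
  have hg2 : Integrable (fun p : X × Y => (f p - F p.2 / a) ^ 2) (μ.prod ν) :=
    integrable_of_measurable_of_bounded (hg.pow_const 2) (C := (C + C * a / a) ^ 2) fun p => by
      rw [abs_pow]; exact pow_le_pow_left₀ (abs_nonneg _) (hgC p) 2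
  have h3 : ∫ x, (m x - I / a) ^ 2 ∂μ ≤ b * ∫ p, (f p - F p.2 / a) ^ 2 ∂(μ.prod ν) := by
    rw [integral_prod _ hg2, ← integral_const_mul]
    refine integral_mono ?_ (hg2.integral_prod_left.const_mul b) h1
    refine integrable_of_measurable_of_bounded ((hmm.sub_const _).pow_const 2)
      (C := (C * b + |I / a|) ^ 2) fun x => ?_
    rw [abs_pow]
    exact pow_le_pow_left₀ (abs_nonneg _) ((abs_sub _ _).trans (add_le_add_left (hmC x) _)) 2
  have h4 : ∫ x, (m x - I / a) ^ 2 ∂μ = (∫ x, m x ^ 2 ∂μ) - a⁻¹ * I ^ 2 := by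
    rw [integral_sub_const_sq hmi hm2, ← hIm, ← ha]
    field_simp; ring
  have h5 : ∫ p, (f p - F p.2 / a) ^ 2 ∂(μ.prod ν) =
      (∫ p, f p ^ 2 ∂(μ.prod ν)) - a⁻¹ * ∫ y, F y ^ 2 ∂ν := by
    rw [integral_prod_symm _ hg2, integral_prod_symm _ hif2, ← integral_const_mul,
      ← integral_sub hif2.integral_prod_right (hF2.const_mul _)]
    refine integral_congr_ae (Filter.Eventually.of_forall fun y => ?_)
    have hs : Measurable fun x => f (x, y) := hf.comp measurable_prodMk_right
    have hs1 : Integrable (fun x => f (x, y)) μ :=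
      integrable_of_measurable_of_bounded hs fun x => hC (x, y)
    have hs2 : Integrable (fun x => f (x, y) ^ 2) μ :=
      integrable_of_measurable_of_bounded (hs.pow_const 2) fun x => hC2 (x, y)
    simp only []
    rw [integral_sub_const_sq hs1 hs2, ← ha]
    change _ - 2 * (F y / a) * F y + _ = _
    field_simp; ring
  -- The total variance is the integrated variance in `y` plus `b⁻¹` times the variance of `m`; `h3`
  -- to `h5` bound the latter by the integrated variance in `x`.
  rw [integral_sub hif2.integral_prod_left (hm2.const_mul _),
    integral_sub hif2.integral_prod_right (hF2.const_mul _), ← integral_prod _ hif2,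
    ← integral_prod_symm _ hif2, integral_const_mul, integral_const_mul]
  rw [h4, h5] at h3
  have h6 : (∫ x, m x ^ 2 ∂μ) * b⁻¹ - a⁻¹ * I ^ 2 * b⁻¹ ≤
      (∫ p, f p ^ 2 ∂(μ.prod ν)) - a⁻¹ * ∫ y, F y ^ 2 ∂ν := by
    have := mul_le_mul_of_nonneg_right h3 (inv_nonneg.2 hν.le)
    rw [mul_comm b, mul_assoc, mul_inv_cancel₀ hν.ne', mul_one, sub_mul] at this
    exact this
  rw [mul_inv]
  linarith

end Product

/-! ### Induction over the coordinates -/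

section Pi

theorem integral_pi_succ {n : ℕ} (μ : Fin (n + 1) → Measure ℝ) [∀ k, SigmaFinite (μ k)]
    (f : (Fin (n + 1) → ℝ) → ℝ) :
    ∫ x, f x ∂(Measure.pi μ) =
      ∫ p, f (Fin.cons p.1 p.2) ∂((μ 0).prod (Measure.pi fun j : Fin n => μ j.succ)) := by
  have h := (measurePreserving_piFinSuccAbove μ 0).symm
  rw [← h.integral_comp (MeasurableEquiv.measurableEmbedding _)]
  simp only [Fin.succAbove_zero]
  refine integral_congr_ae (Filter.Eventually.of_forall fun p => ?_)
  change f (Fin.insertNth 0 p.1 p.2) = _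
  rw [Fin.insertNth_zero']

theorem measurable_finCons {n : ℕ} :
    Measurable fun p : ℝ × (Fin n → ℝ) => (Fin.cons p.1 p.2 : Fin (n + 1) → ℝ) := by
  rw [measurable_pi_iff]
  intro k
  refine Fin.cases ?_ (fun j => ?_) k
  · simpa using measurable_fst
  · simp only [Fin.cons_succ]
    fun_prop

theorem integral_pi_fin_zero (μ : Fin 0 → Measure ℝ) (f : (Fin 0 → ℝ) → ℝ) :
    ∫ x, f x ∂(Measure.pi μ) = f 0 := by
  rw [Measure.pi_of_empty μ 0, integral_dirac]

theorem pi_real_univ {n : ℕ} (μ : Fin n → Measure ℝ) [∀ k, IsFiniteMeasure (μ k)] {H : ℝ}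
    (hH : ∀ k, (μ k).real Set.univ = H) : (Measure.pi μ).real Set.univ = H ^ n := by
  rw [measureReal_def, Measure.pi_univ, ENNReal.toReal_prod]
  simp_rw [← measureReal_def, hH]
  simp

/-- Inequalities between variance and derivative along almost all coordinate lines imply the
corresponding inequality on a product space. -/
theorem variance_pi_le {H c : ℝ} (hH0 : 0 < H) {S : Set ℝ} : ∀ {n : ℕ}
    (μ : Fin n → Measure ℝ) [∀ k, IsFiniteMeasure (μ k)] (_ : ∀ k, (μ k).real Set.univ = H)
    (_ : ∀ k, ∀ᵐ t ∂(μ k), t ∉ S)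
    {f : (Fin n → ℝ) → ℝ} {g : Fin n → (Fin n → ℝ) → ℝ} (_ : Measurable f)
    (_ : ∀ k, Measurable (g k)) {C : ℝ} (_ : ∀ x, |f x| ≤ C) (_ : ∀ k x, |g k x| ≤ C)
    (_ : ∀ k x, (∀ j, j ≠ k → x j ∉ S) →
      (∫ t, f (Function.update x k t) ^ 2 ∂(μ k)) -
          H⁻¹ * (∫ t, f (Function.update x k t) ∂(μ k)) ^ 2 ≤
        c * ∫ t, g k (Function.update x k t) ^ 2 ∂(μ k)),
    (∫ x, f x ^ 2 ∂(Measure.pi μ)) - (H ^ n)⁻¹ * (∫ x, f x ∂(Measure.pi μ)) ^ 2 ≤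
      c * ∑ k, ∫ x, g k x ^ 2 ∂(Measure.pi μ)
  | 0, μ, _, _, _, f, g, _, _, _, _, _, _ => by
    rw [integral_pi_fin_zero, integral_pi_fin_zero]
    simp
  | n + 1, μ, _, hH, hS, f, g, hf, hg, C, hfC, hgC, hline => by
    set ν : Fin n → Measure ℝ := fun j => μ j.succ with hν
    have ih := @variance_pi_le H c hH0 S n ν inferInstance (fun k => hH _) (fun k => hS _)
    have hprod := variance_prod_le (μ := μ 0) (ν := Measure.pi ν)
      (f := fun p => f (Fin.cons p.1 p.2)) (hf.comp measurable_finCons) (fun p => hfC _)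
      (by rw [hH]; exact hH0) (by rw [pi_real_univ ν fun k => hH _]; positivity)
    rw [pi_real_univ ν fun k => hH _, hH, ← pow_succ'] at hprod
    simp only [integral_pi_succ μ]
    refine hprod.trans ?_
    have hCsq : ∀ {r : ℝ}, |r| ≤ C → |r ^ 2| ≤ C ^ 2 := fun h => by
      rw [abs_pow]; exact pow_le_pow_left₀ (abs_nonneg _) h 2
    have hgi : ∀ k, Integrable (fun p : ℝ × (Fin n → ℝ) => g k (Fin.cons p.1 p.2) ^ 2)
        ((μ 0).prod (Measure.pi ν)) := fun k =>
      integrable_of_measurable_of_bounded (((hg k).comp measurable_finCons).pow_const 2)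
        fun p => hCsq (hgC k _)
    have hfi : Integrable (fun p : ℝ × (Fin n → ℝ) => f (Fin.cons p.1 p.2) ^ 2)
        ((μ 0).prod (Measure.pi ν)) :=
      integrable_of_measurable_of_bounded ((hf.comp measurable_finCons).pow_const 2)
        fun p => hCsq (hfC _)
    have hF : Measurable fun p : ℝ × (Fin n → ℝ) => f (Fin.cons p.1 p.2) :=
      hf.comp measurable_finCons
    -- Variance in the first coordinate: the line hypothesis applies for almost every `y`, namely
    -- when no coordinate of `y` lies in `S`.
    have h0 : ∫ y, ((∫ t, f (Fin.cons t y) ^ 2 ∂(μ 0)) -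
        H⁻¹ * (∫ t, f (Fin.cons t y) ∂(μ 0)) ^ 2) ∂(Measure.pi ν) ≤
        c * ∫ p, g 0 (Fin.cons p.1 p.2) ^ 2 ∂((μ 0).prod (Measure.pi ν)) := by
      rw [integral_prod_symm _ (hgi 0), ← integral_const_mul]
      refine integral_mono_ae ?_ ((hgi 0).integral_prod_right.const_mul c) ?_
      · refine hfi.integral_prod_right.sub (Integrable.const_mul ?_ _)
        exact integrable_of_measurable_of_bounded
          ((hF.stronglyMeasurable.integral_prod_left' (μ := μ 0)).measurable.pow_const 2)
          (C := (C * (μ 0).real Set.univ) ^ 2) fun y => by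
            rw [abs_pow]
            exact pow_le_pow_left₀ (abs_nonneg _)
              (abs_integral_le_of_bounded fun t => hfC _) 2
      · have hae : ∀ᵐ y ∂(Measure.pi ν), ∀ j, y j ∉ S := by
          rw [ae_all_iff]
          intro j
          exact (Measure.quasiMeasurePreserving_eval ν j).ae (hS j.succ)
        filter_upwards [hae] with y hy
        have := hline 0 (Fin.cons 0 y) fun j hj => by
          obtain ⟨i, rfl⟩ := Fin.exists_succ_eq.2 hj
          simpa using hy i
        simpa only [Fin.update_cons_zero] using this
    -- Variance in the remaining coordinates: the induction hypothesis on the slice at `t`, for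
    -- every `t` outside `S`.
    have h1 : ∫ t, ((∫ y, f (Fin.cons t y) ^ 2 ∂(Measure.pi ν)) -
        (H ^ n)⁻¹ * (∫ y, f (Fin.cons t y) ∂(Measure.pi ν)) ^ 2) ∂(μ 0) ≤
        c * ∑ k : Fin n, ∫ p, g k.succ (Fin.cons p.1 p.2) ^ 2 ∂((μ 0).prod (Measure.pi ν)) := by
      simp_rw [integral_prod _ (hgi _)]
      rw [← integral_finsetSum _ fun k _ => (hgi _).integral_prod_left, ← integral_const_mul]
      refine integral_mono_ae ?_ (Integrable.const_mul
        (integrable_finsetSum _ fun k _ => (hgi _).integral_prod_left) c) ?_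
      · refine hfi.integral_prod_left.sub (Integrable.const_mul ?_ _)
        exact integrable_of_measurable_of_bounded
          ((hF.stronglyMeasurable.integral_prod_right' (ν := Measure.pi ν)).measurable.pow_const 2)
          (C := (C * (Measure.pi ν).real Set.univ) ^ 2) fun y => by
            rw [abs_pow]
            exact pow_le_pow_left₀ (abs_nonneg _)
              (abs_integral_le_of_bounded fun t => hfC _) 2
      · filter_upwards [hS 0] with t ht
        have hm : Measurable fun y : Fin n → ℝ => (Fin.cons t y : Fin (n + 1) → ℝ) :=
          measurable_finCons.comp measurable_prodMk_left
        refine ih (f := fun y => f (Fin.cons t y)) (g := fun k y => g k.succ (Fin.cons t y))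
          (hf.comp hm) (fun k => (hg _).comp hm) (fun y => hfC _) (fun k y => hgC _ _) ?_
        intro k y hy
        have := hline k.succ (Fin.cons t y) fun j hj => by
          refine Fin.cases (fun _ => ?_) (fun i hi => ?_) j hj
          · simpa using ht
          · simpa using hy i fun h => hi (by rw [h])
        simpa only [← Fin.cons_update] using this
    rw [Fin.sum_univ_succ, mul_add, add_comm]
    exact add_le_add h0 h1

end Pi

/-! ### Geometry of the grids, the levels and the patches -/

namespace MeshHierarchy

variable {d : ℕ} (G : MeshHierarchy d)

section Grid

theorem continuous_coord (k : Fin d) : Continuous fun x : E d => x k := by fun_prop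

/-- The union of the hyperplanes that bound the cells of the grid of mesh size `H`. -/
def skel (H : ℝ) : Set (E d) := {x | ∃ k, ∃ z : ℤ, x k = G.origin k + H * z}

/-- The multi-index of the cell (of the grid of mesh size `H`) that contains `x`. -/
noncomputable def idx (H : ℝ) (x : E d) : Cell d := fun k => ⌊(x k - G.origin k) / H⌋

/-- The open cube with multi-index `z` in the grid of mesh size `H`. -/
def openCube (H : ℝ) (z : Cell d) : Set (E d) :=
  {x | ∀ k, G.origin k + H * z k < x k ∧ x k < G.origin k + H * (z k + 1)}

variable {H : ℝ}

theorem isOpen_openCube (z : Cell d) : IsOpen (G.openCube H z) := by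
  simp only [openCube, Set.ofPred_forall]
  refine isOpen_iInter_of_finite fun k => ?_
  exact (isOpen_lt continuous_const (continuous_coord k)).inter
    (isOpen_lt (continuous_coord k) continuous_const)

theorem isClosed_cube (z : Cell d) : IsClosed (G.cube H z) := by
  simp only [cube, Set.ofPred_forall]
  refine isClosed_iInter fun k => ?_
  exact (isClosed_le continuous_const (continuous_coord k)).inter
    (isClosed_le (continuous_coord k) continuous_const)

theorem openCube_subset_cube (z : Cell d) : G.openCube H z ⊆ G.cube H z :=
  fun _ hx k => ⟨(hx k).1.le, (hx k).2.le⟩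

theorem cube_eq_preimage (z : Cell d) : G.cube H z = (WithLp.ofLp : E d → Fin d → ℝ) ⁻¹'
    (Set.univ.pi fun k => Set.Icc (G.origin k + H * z k) (G.origin k + H * z k + H)) := by
  ext x
  simp only [cube, Set.mem_ofPred_eq, Set.mem_preimage, Set.mem_univ_pi, Set.mem_Icc]
  refine forall_congr' fun k => ?_
  rw [mul_add, mul_one, add_assoc]

theorem isCompact_cube (z : Cell d) : IsCompact (G.cube H z) := by
  rw [cube_eq_preimage]
  exact (PiLp.homeomorph 2 fun _ : Fin d => ℝ).isCompact_preimage.2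
    (isCompact_univ_pi fun k => isCompact_Icc)

theorem volume_cube_lt_top (z : Cell d) : volume (G.cube H z) < ⊤ :=
  (G.isCompact_cube z).measure_lt_top

theorem volume_real_cube (hH : 0 < H) (z : Cell d) : volume.real (G.cube H z) = H ^ d := by
  rw [measureReal_def, cube_eq_preimage,
    (PiLp.volume_preserving_ofLp (Fin d)).measure_preimage
      (MeasurableSet.univ_pi fun k => measurableSet_Icc).nullMeasurableSet, volume_pi_pi]
  simp [hH.le]

theorem idx_mem_cube (hH : 0 < H) (x : E d) : x ∈ G.cube H (G.idx H x) := by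
  intro k
  have h1 := Int.floor_le ((x k - G.origin k) / H)
  have h2 := (Int.lt_floor_add_one ((x k - G.origin k) / H)).le
  rw [le_div_iff₀ hH] at h1
  rw [div_le_iff₀ hH] at h2
  simp only [idx]
  constructor <;> linarith

theorem mem_openCube_idx (hH : 0 < H) {x : E d} (hx : x ∉ G.skel H) :
    x ∈ G.openCube H (G.idx H x) := by
  intro k
  have h := G.idx_mem_cube hH x k
  refine ⟨lt_of_le_of_ne h.1 fun h1 => hx ⟨k, _, h1.symm⟩,
    lt_of_le_of_ne h.2 fun h1 => hx ⟨k, G.idx H x k + 1, by rw [h1]; push_cast; ring⟩⟩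

theorem idx_eq_of_mem_openCube (hH : 0 < H) {x : E d} {z : Cell d} (hx : x ∈ G.openCube H z) :
    G.idx H x = z := by
  funext k
  rw [idx, Int.floor_eq_iff, le_div_iff₀ hH, div_lt_iff₀ hH]
  have := hx k
  constructor <;> linarith

theorem notMem_skel_of_mem_openCube (hH : 0 < H) {x : E d} {z : Cell d}
    (hx : x ∈ G.openCube H z) : x ∉ G.skel H := by
  rintro ⟨k, w, hw⟩
  have h := hx k
  rw [hw] at h
  have h1 : (z k : ℝ) < w := by nlinarith
  have h2 : (w : ℝ) < z k + 1 := by nlinarith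
  norm_cast at h1 h2
  omega

theorem mem_openCube_of_mem_cube {x : E d} {z : Cell d} (hx : x ∉ G.skel H)
    (h : x ∈ G.cube H z) : x ∈ G.openCube H z := by
  intro k
  refine ⟨lt_of_le_of_ne (h k).1 fun h1 => hx ⟨k, _, h1.symm⟩,
    lt_of_le_of_ne (h k).2 fun h1 => hx ⟨k, z k + 1, by rw [h1]; push_cast; ring⟩⟩

/-- Off the grid planes exactly one closed cell contains a point. Since the planes are null,
identities between unions of cells reduce, almost everywhere, to identities between finite sets of
indices. -/
theorem mem_cube_iff (hH : 0 < H) {x : E d} (hx : x ∉ G.skel H) (z : Cell d) :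
    x ∈ G.cube H z ↔ G.idx H x = z :=
  ⟨fun h => G.idx_eq_of_mem_openCube hH (G.mem_openCube_of_mem_cube hx h),
    fun h => h ▸ G.idx_mem_cube hH x⟩

theorem volume_skel (H : ℝ) : volume (G.skel H) = 0 := by
  have : G.skel H = ⋃ k, ⋃ z : ℤ, {x : E d | x k = G.origin k + H * z} := by
    ext x; simp [skel]
  rw [this, measure_iUnion_null_iff]
  intro k
  rw [measure_iUnion_null_iff]
  intro z
  have h := (PiLp.volume_preserving_ofLp (Fin d)).measure_preimage
    (s := {f : Fin d → ℝ | f k = G.origin k + H * z})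
    (measurableSet_eq_fun (measurable_pi_apply k) measurable_const).nullMeasurableSet
  rw [volume_pi, Measure.pi_hyperplane] at h
  exact h

theorem ae_notMem_skel (H : ℝ) : ∀ᵐ x : E d, x ∉ G.skel H :=
  measure_eq_zero_iff_ae_notMem.1 (G.volume_skel H)

theorem measurableSet_skel (H : ℝ) : MeasurableSet (G.skel H) := by
  have : G.skel H = ⋃ k, ⋃ z : ℤ, {x : E d | x k = G.origin k + H * z} := by
    ext x; simp [skel]
  rw [this]
  exact MeasurableSet.iUnion fun k => MeasurableSet.iUnion fun z =>
    (isClosed_eq (continuous_coord k) continuous_const).measurableSet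

theorem cube_subset_closure_openCube (hH : 0 < H) (z : Cell d) :
    G.cube H z ⊆ closure (G.openCube H z) := by
  intro x hx
  set c : E d := WithLp.toLp 2 fun k => G.origin k + H * (z k + 1 / 2) with hc
  have hck : ∀ k, c k = G.origin k + H * (z k + 1 / 2) := fun k => rfl
  -- Moving from `x` a little towards the centre of the cube enters the open cube.
  have ht : Filter.Tendsto (fun t : ℝ => x + t • (c - x)) (nhdsWithin 0 (Set.Ioi 0)) (nhds x) := by
    have : Continuous fun t : ℝ => x + t • (c - x) := by fun_prop
    simpa using (this.tendsto 0).mono_left nhdsWithin_le_nhds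
  refine mem_closure_of_tendsto ht ?_
  filter_upwards [Ioo_mem_nhdsGT (zero_lt_one' ℝ)] with t ht k
  have h := hx k
  have h1 : (x + t • (c - x)) k = x k + t * (c k - x k) := by simp
  rw [h1, hck]
  obtain ⟨ht0, ht1⟩ := ht
  constructor <;> nlinarith [mul_pos ht0 hH, mul_pos (sub_pos.2 ht1) hH]

theorem openCube_nonempty (hH : 0 < H) (z : Cell d) : (G.openCube H z).Nonempty := by
  refine ⟨WithLp.toLp 2 fun k => G.origin k + H * (z k + 1 / 2), fun k => ?_⟩
  change G.origin k + H * z k < G.origin k + H * (z k + 1 / 2) ∧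
    G.origin k + H * (z k + 1 / 2) < _
  constructor <;> nlinarith

theorem idx_natCast_mul (H : ℝ) (r : ℕ) (x : E d) :
    G.idx (r * H) x = fun k => G.idx H x k / (r : ℤ) := by
  funext k
  rw [idx, idx, ← Int.floor_div_natCast, div_div, mul_comm H]

theorem skel_natCast_mul_subset (H : ℝ) (r : ℕ) : G.skel (r * H) ⊆ G.skel H := by
  rintro x ⟨k, z, h⟩
  exact ⟨k, r * z, by rw [h]; push_cast; ring⟩

theorem cube_subset_cube_ediv (hH : 0 < H) {r : ℕ} (hr : 0 < r) (z : Cell d) :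
    G.cube H z ⊆ G.cube (r * H) fun k => z k / (r : ℤ) := by
  intro x hx k
  have hr' : (0 : ℤ) < r := by exact_mod_cast hr
  have h1 : (r : ℤ) * (z k / r) ≤ z k := Int.mul_ediv_self_le hr'.ne'
  have h2 : z k + 1 ≤ r * (z k / r + 1) := by
    have := Int.lt_mul_ediv_self_add (x := z k) hr'
    linarith
  have h3 : (r : ℝ) * ((z k / r : ℤ) : ℝ) ≤ z k := by exact_mod_cast h1
  have h4 : (z k : ℝ) + 1 ≤ r * (((z k / r : ℤ) : ℝ) + 1) := by exact_mod_cast h2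
  have h5 := hx k
  constructor
  · nlinarith
  · nlinarith

theorem abs_sub_le_one_of_inter_nonempty (hH : 0 < H) {z w : Cell d}
    (h : (G.cube H z ∩ G.cube H w).Nonempty) (k : Fin d) : |z k - w k| ≤ 1 := by
  obtain ⟨x, h1, h2⟩ := h
  have h1 := h1 k
  have h2 := h2 k
  have h3 : (z k : ℝ) ≤ w k + 1 := by nlinarith
  have h4 : (w k : ℝ) ≤ z k + 1 := by nlinarith
  norm_cast at h3 h4
  rw [abs_le]; constructor <;> omega

theorem aedisjoint_cube (hH : 0 < H) {z w : Cell d} (h : z ≠ w) :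
    AEDisjoint volume (G.cube H z) (G.cube H w) := by
  refine measure_mono_null (fun x hx => ?_) (G.volume_skel H)
  by_contra hs
  exact h (((G.mem_cube_iff hH hs z).1 hx.1).symm.trans ((G.mem_cube_iff hH hs w).1 hx.2))

theorem setIntegral_biUnion_cube (hH : 0 < H) (P : Finset (Cell d)) {f : E d → ℝ}
    (hf : ∀ z ∈ P, IntegrableOn f (G.cube H z)) :
    ∫ x in ⋃ z ∈ P, G.cube H z, f x = ∑ z ∈ P, ∫ x in G.cube H z, f x := by
  have h1 : (⋃ z ∈ P, G.cube H z) = ⋃ z : P, G.cube H z := by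
    rw [Set.iUnion_subtype]
  rw [h1, integral_iUnion_ae (fun z => (G.isClosed_cube _).measurableSet.nullMeasurableSet)
    (fun z w hzw => G.aedisjoint_cube hH fun h => hzw (Subtype.ext h)), tsum_fintype,
    Finset.sum_coe_sort P fun z => ∫ x in G.cube H z, f x]
  exact integrableOn_finite_iUnion.2 fun z => hf z z.2

end Grid

section Levels

theorem size_pos (ℓ : ℕ) : 0 < G.size ℓ := div_pos G.H₀_pos (by positivity)

theorem n_pos : 0 < G.n := by have := G.two_le_n; omega

theorem fineSize_pos : 0 < G.fineSize :=
  div_pos (G.size_pos _) (by exact_mod_cast G.n_pos)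

theorem size_eq_two_mul (ℓ : ℕ) : G.size ℓ = 2 * G.size (ℓ + 1) := by
  simp only [size, pow_succ]; field_simp

/-- Number of fine cells along an edge of an element of level `ℓ`. -/
def ratio (ℓ : ℕ) : ℕ := 2 ^ (G.L - ℓ) * G.n

theorem ratio_pos (ℓ : ℕ) : 0 < G.ratio ℓ := Nat.mul_pos (by positivity) G.n_pos

theorem two_le_ratio (ℓ : ℕ) : 2 ≤ G.ratio ℓ := by
  have h : 1 ≤ 2 ^ (G.L - ℓ) := Nat.one_le_two_pow
  have := G.two_le_n
  calc 2 = 1 * 2 := rfl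
    _ ≤ G.ratio ℓ := Nat.mul_le_mul h this

theorem size_eq_ratio_mul {ℓ : ℕ} (hℓ : ℓ ≤ G.L) : G.size ℓ = G.ratio ℓ * G.fineSize := by
  have h : (2 : ℝ) ^ G.L = 2 ^ (G.L - ℓ) * 2 ^ ℓ := by
    rw [← pow_add, Nat.sub_add_cancel hℓ]
  have hn : (G.n : ℝ) ≠ 0 := by exact_mod_cast G.n_pos.ne'
  simp only [size, ratio, fineSize, h]
  push_cast
  field_simp

/-- Refinement is floor division of the indices: the ancestor of cell `z` is `z / r`. All nestings
of meshes are handled through iterated integer division. -/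
theorem mem_refinedCells {r : ℕ} (hr : 0 < r) (z : Cell d) :
    z ∈ G.refinedCells r ↔ (fun k => z k / (r : ℤ)) ∈ G.cells₀ := by
  have hr' : (0 : ℤ) < r := by exact_mod_cast hr
  have key : ∀ (a b : ℤ), b ∈ Finset.Ico (r * a) (r * a + r) ↔ b / r = a := by
    intro a b
    rw [Finset.mem_Ico, Int.ediv_eq_iff_of_pos hr', mul_comm a]
  simp only [refinedCells, Finset.mem_biUnion, Fintype.mem_piFinset, key]
  constructor
  · rintro ⟨w, hw, h⟩
    rwa [show (fun k => z k / (r : ℤ)) = w from funext h]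
  · intro h
    exact ⟨_, h, fun k => rfl⟩

theorem mem_mesh {ℓ : ℕ} (z : Cell d) :
    z ∈ G.mesh ℓ ↔ (fun k => z k / (2 ^ ℓ : ℤ)) ∈ G.cells₀ := by
  rw [mesh, mem_refinedCells _ (by positivity)]
  push_cast
  rfl

theorem mesh_zero : G.mesh 0 = G.cells₀ := by
  ext z; simp [mem_mesh]

theorem mem_mesh_succ {ℓ : ℕ} (z : Cell d) :
    z ∈ G.mesh (ℓ + 1) ↔ (fun k => z k / 2) ∈ G.mesh ℓ := by
  rw [mem_mesh, mem_mesh]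
  simp only [Int.ediv_ediv_of_nonneg (show (0 : ℤ) ≤ 2 by norm_num), pow_succ']

theorem mem_fineMesh {ℓ : ℕ} (hℓ : ℓ ≤ G.L) (z : Cell d) :
    z ∈ G.fineMesh ↔ (fun k => z k / (G.ratio ℓ : ℤ)) ∈ G.mesh ℓ := by
  rw [fineMesh, mem_refinedCells _ (Nat.mul_pos (by positivity) G.n_pos), mem_mesh]
  have h : ((2 ^ G.L * G.n : ℕ) : ℤ) = (G.ratio ℓ : ℤ) * 2 ^ ℓ := by
    have h : (2 : ℤ) ^ G.L = 2 ^ (G.L - ℓ) * 2 ^ ℓ := by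
      rw [← pow_add, Nat.sub_add_cancel hℓ]
    rw [ratio]; push_cast; rw [h]; ring
  simp only [h, Int.ediv_ediv_of_nonneg (Int.natCast_nonneg (G.ratio ℓ))]

theorem mesh_nonempty (ℓ : ℕ) : (G.mesh ℓ).Nonempty := by
  obtain ⟨z, hz⟩ := G.cells₀_nonempty
  refine ⟨fun k => z k * 2 ^ ℓ, ?_⟩
  rw [mem_mesh]
  simpa using hz

theorem mem_region_iff {ℓ : ℕ} {x : E d} (hx : x ∉ G.skel (G.size ℓ)) (P : Finset (Cell d)) :
    x ∈ G.region ℓ P ↔ G.idx (G.size ℓ) x ∈ P := by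
  simp only [region, elem, Set.mem_iUnion, exists_prop, G.mem_cube_iff (G.size_pos ℓ) hx]
  exact ⟨fun ⟨z, hz, h⟩ => h ▸ hz, fun h => ⟨_, h, rfl⟩⟩

theorem isCompact_region (ℓ : ℕ) (P : Finset (Cell d)) : IsCompact (G.region ℓ P) :=
  P.isCompact_biUnion fun z _ => G.isCompact_cube z

theorem openCube_subset_interior_region {ℓ : ℕ} {P : Finset (Cell d)} {z : Cell d} (hz : z ∈ P) :
    G.openCube (G.size ℓ) z ⊆ interior (G.region ℓ P) :=
  interior_maximal ((G.openCube_subset_cube z).trans (Set.subset_biUnion_of_mem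
    (u := fun z => G.elem ℓ z) hz)) (G.isOpen_openCube z)

theorem mem_interior_region_iff {ℓ : ℕ} {x : E d} (hx : x ∉ G.skel (G.size ℓ))
    (P : Finset (Cell d)) :
    x ∈ interior (G.region ℓ P) ↔ G.idx (G.size ℓ) x ∈ P :=
  ⟨fun h => (G.mem_region_iff hx P).1 (interior_subset h),
    fun h => G.openCube_subset_interior_region h (G.mem_openCube_idx (G.size_pos ℓ) hx)⟩

theorem interior_region_ae_eq (ℓ : ℕ) (P : Finset (Cell d)) :
    (interior (G.region ℓ P) : Set (E d)) =ᵐ[volume] G.region ℓ P := by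
  filter_upwards [G.ae_notMem_skel (G.size ℓ)] with x hx
  exact propext ((G.mem_interior_region_iff hx P).trans (G.mem_region_iff hx P).symm)

theorem skel_size_subset {ℓ : ℕ} (hℓ : ℓ ≤ G.L) : G.skel (G.size ℓ) ⊆ G.skel G.fineSize := by
  rw [G.size_eq_ratio_mul hℓ]; exact G.skel_natCast_mul_subset _ _

theorem skel_size_zero_subset (ℓ : ℕ) : G.skel (G.size 0) ⊆ G.skel (G.size ℓ) := by
  have h : G.size 0 = (2 ^ ℓ : ℕ) * G.size ℓ := by
    simp only [size]; push_cast; field_simp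
  rw [h]; exact G.skel_natCast_mul_subset _ _

theorem idx_size_zero (ℓ : ℕ) (x : E d) :
    G.idx (G.size 0) x = fun k => G.idx (G.size ℓ) x k / (2 ^ ℓ : ℤ) := by
  have h : G.size 0 = (2 ^ ℓ : ℕ) * G.size ℓ := by
    simp only [size]; push_cast; field_simp
  rw [h, idx_natCast_mul]
  push_cast
  rfl

/-- Although `Ω` is defined through level `0`, it can be tested on any level, since the planes of
level `0` are among those of level `ℓ` and indices are compatible with division. -/
theorem mem_Ω_iff {ℓ : ℕ} {x : E d} (hx : x ∉ G.skel (G.size ℓ)) :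
    x ∈ G.Ω ↔ G.idx (G.size ℓ) x ∈ G.mesh ℓ := by
  rw [Ω, G.mem_interior_region_iff (fun h => hx (G.skel_size_zero_subset ℓ h)), mesh_zero, mem_mesh,
    G.idx_size_zero ℓ]

theorem region_mesh_ae_eq (ℓ : ℕ) : (G.region ℓ (G.mesh ℓ) : Set (E d)) =ᵐ[volume] G.Ω := by
  filter_upwards [G.ae_notMem_skel (G.size ℓ)] with x hx
  exact propext ((G.mem_region_iff hx _).trans (G.mem_Ω_iff hx).symm)

theorem elem_subset_region_zero {ℓ : ℕ} {z : Cell d} (hz : z ∈ G.mesh ℓ) :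
    G.elem ℓ z ⊆ G.region 0 (G.mesh 0) := by
  have h : G.size 0 = (2 ^ ℓ : ℕ) * G.size ℓ := by
    simp only [size]; push_cast; field_simp
  have h1 := G.cube_subset_cube_ediv (G.size_pos ℓ) (r := 2 ^ ℓ) (by positivity) z
  rw [← h] at h1
  refine h1.trans (Set.subset_biUnion_of_mem (u := fun z => G.elem 0 z) ?_)
  rw [mesh_zero]
  rw [mem_mesh] at hz
  push_cast
  exact hz

theorem region_subset_region_zero {ℓ : ℕ} {P : Finset (Cell d)} (hP : P ⊆ G.mesh ℓ) :
    G.region ℓ P ⊆ G.region 0 (G.mesh 0) :=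
  Set.iUnion₂_subset fun _ hz => G.elem_subset_region_zero (hP hz)

theorem interior_region_subset_Ω {ℓ : ℕ} {P : Finset (Cell d)} (hP : P ⊆ G.mesh ℓ) :
    interior (G.region ℓ P) ⊆ G.Ω := interior_mono (G.region_subset_region_zero hP)

theorem isOpen_Ω : IsOpen G.Ω := isOpen_interior

theorem isBounded_Ω : Bornology.IsBounded G.Ω :=
  (G.isCompact_region 0 _).isBounded.subset interior_subset

theorem volume_Ω_lt_top : volume G.Ω < ⊤ := G.isBounded_Ω.measure_lt_top

theorem elem_subset_region_iff {ℓ : ℕ} {P : Finset (Cell d)} {z : Cell d} :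
    G.elem ℓ z ⊆ G.region ℓ P ↔ z ∈ P := by
  refine ⟨fun h => ?_, fun h => Set.subset_biUnion_of_mem (u := fun z => G.elem ℓ z) h⟩
  obtain ⟨x, hx⟩ := G.openCube_nonempty (G.size_pos ℓ) z
  have := (G.mem_region_iff (G.notMem_skel_of_mem_openCube (G.size_pos ℓ) hx) P).1
    (h (G.openCube_subset_cube z hx))
  rwa [G.idx_eq_of_mem_openCube (G.size_pos ℓ) hx] at this

theorem idx_size_succ (ℓ : ℕ) (x : E d) :
    G.idx (G.size ℓ) x = fun k => G.idx (G.size (ℓ + 1)) x k / 2 := by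
  have h : G.size ℓ = (2 : ℕ) * G.size (ℓ + 1) := by rw [size_eq_two_mul]; push_cast; rfl
  rw [h, idx_natCast_mul]
  push_cast
  rfl

theorem skel_size_succ_subset (ℓ : ℕ) : G.skel (G.size ℓ) ⊆ G.skel (G.size (ℓ + 1)) := by
  have h : G.size ℓ = (2 : ℕ) * G.size (ℓ + 1) := by rw [size_eq_two_mul]; push_cast; rfl
  rw [h]; exact G.skel_natCast_mul_subset _ _

/-- An interior point of the smaller cube avoids the coarse grid planes, so its coarse index, which
is the halved index of the cube, decides the inclusion. -/
theorem elem_succ_subset_region_iff {ℓ : ℕ} {P : Finset (Cell d)} {z : Cell d} :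
    G.elem (ℓ + 1) z ⊆ G.region ℓ P ↔ (fun k => z k / 2) ∈ P := by
  constructor
  · intro h
    obtain ⟨x, hx⟩ := G.openCube_nonempty (G.size_pos (ℓ + 1)) z
    have hs := G.notMem_skel_of_mem_openCube (G.size_pos _) hx
    have := (G.mem_region_iff (fun h => hs (G.skel_size_succ_subset ℓ h)) P).1
      (h (G.openCube_subset_cube z hx))
    rwa [idx_size_succ, G.idx_eq_of_mem_openCube (G.size_pos _) hx] at this
  · intro h
    have h1 := G.cube_subset_cube_ediv (G.size_pos (ℓ + 1)) (r := 2) (by norm_num) z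
    have h2 : ((2 : ℕ) : ℝ) * G.size (ℓ + 1) = G.size ℓ := by
      rw [size_eq_two_mul G ℓ]; push_cast; rfl
    rw [h2] at h1
    exact h1.trans (Set.subset_biUnion_of_mem (u := fun z => G.elem ℓ z) h)

theorem mem_children {ℓ : ℕ} {T z : Cell d} (hT : T ∈ G.mesh ℓ) :
    z ∈ children G ℓ T ↔ (fun k => z k / 2) = T := by
  have h : G.elem ℓ T = G.region ℓ {T} := by simp [region]
  simp only [children, Finset.mem_filter]
  rw [h, elem_succ_subset_region_iff, Finset.mem_singleton,
    mem_mesh_succ]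
  exact ⟨fun h => h.2, fun h => ⟨h ▸ hT, h⟩⟩

theorem children_eq {ℓ : ℕ} {T : Cell d} (hT : T ∈ G.mesh ℓ) :
    children G ℓ T = Fintype.piFinset fun k => Finset.Ico (2 * T k) (2 * T k + 2) := by
  ext z
  rw [G.mem_children hT, Fintype.mem_piFinset, funext_iff]
  refine forall_congr' fun k => ?_
  rw [Finset.mem_Ico]
  omega

theorem card_children {ℓ : ℕ} {T : Cell d} (hT : T ∈ G.mesh ℓ) :
    (children G ℓ T).card = 2 ^ d := by
  rw [G.children_eq hT, Fintype.card_piFinset]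
  simp

theorem elem_ae_eq_children {ℓ : ℕ} {T : Cell d} (hT : T ∈ G.mesh ℓ) :
    (G.elem ℓ T : Set (E d)) =ᵐ[volume] G.region (ℓ + 1) (children G ℓ T) := by
  filter_upwards [G.ae_notMem_skel (G.size (ℓ + 1))] with x hx
  have hx' : x ∉ G.skel (G.size ℓ) := fun h => hx (G.skel_size_succ_subset ℓ h)
  refine propext ((G.mem_cube_iff (G.size_pos ℓ) hx' T).trans ?_)
  rw [idx_size_succ]
  exact (G.mem_children hT).symm.trans (G.mem_region_iff hx _).symm

end Levels

section Patches

theorem patch_subset_mesh {ℓ : ℕ} {T : Cell d} (hT : T ∈ G.mesh ℓ) (m : ℕ) :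
    G.patch ℓ T m ⊆ G.mesh ℓ := by
  cases m with
  | zero => simpa [patch] using hT
  | succ m => classical exact Finset.filter_subset _ _

/-- Touching cubes have indices that differ by at most one in each coordinate, so each layer adds at
most one. The counting bounds below use that a patch lies in such a box of indices. -/
theorem abs_sub_le_of_mem_patch {ℓ : ℕ} {T K : Cell d} {m : ℕ} (h : K ∈ G.patch ℓ T m)
    (k : Fin d) : |K k - T k| ≤ m := by
  induction m generalizing K with
  | zero =>
    rw [patch, Finset.mem_singleton] at h
    simp [h]
  | succ m ih =>
    simp only [patch, Finset.mem_filter] at h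
    obtain ⟨_, x, hx1, hx2⟩ := h
    simp only [region, Set.mem_iUnion, exists_prop] at hx2
    obtain ⟨K', hK', hx2⟩ := hx2
    have h1 := ih hK'
    have h2 := G.abs_sub_le_one_of_inter_nonempty (G.size_pos ℓ) ⟨x, hx1, hx2⟩ k
    push_cast
    have := abs_sub_le (K k) (K' k) (T k)
    linarith

theorem card_le_of_forall_mem_Icc {P : Finset (Cell d)} {a b : Cell d} {N : ℕ}
    (hN : ∀ k, (b k + 1 - a k).toNat ≤ N) (h : ∀ z ∈ P, ∀ k, a k ≤ z k ∧ z k ≤ b k) :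
    P.card ≤ N ^ d := by
  calc P.card ≤ (Fintype.piFinset fun k => Finset.Icc (a k) (b k)).card :=
        Finset.card_le_card fun z hz => by
          rw [Fintype.mem_piFinset]
          exact fun k => Finset.mem_Icc.2 (h z hz k)
    _ = ∏ k, (b k + 1 - a k).toNat := by simp [Fintype.card_piFinset]
    _ ≤ ∏ _k : Fin d, N := Finset.prod_le_prod' fun k _ => hN k
    _ = N ^ d := by simp

theorem card_le_of_abs_sub_le {P : Finset (Cell d)} {T : Cell d} {m : ℕ}
    (h : ∀ z ∈ P, ∀ k, |z k - T k| ≤ m) : P.card ≤ (2 * m + 1) ^ d :=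
  card_le_of_forall_mem_Icc (a := fun k => T k - m) (b := fun k => T k + m)
    (fun k => by omega) fun z hz k => by
      have := abs_le.1 (h z hz k)
      constructor <;> linarith

end Patches

end MeshHierarchy

/-! ### Multilinear polynomials and the finite element space -/

section Multilinear

variable {d : ℕ}

/-- The polynomial of degree at most one in each variable with coefficients `c`. -/
def q1Poly (c : Finset (Fin d) → ℝ) (x : E d) : ℝ := ∑ s, c s * ∏ k ∈ s, x k

theorem contDiff_q1Poly (c : Finset (Fin d) → ℝ) : ContDiff ℝ 1 (q1Poly c) := by
  unfold q1Poly
  refine ContDiff.sum fun s _ => contDiff_const.mul (contDiff_prod fun k _ => ?_)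
  exact contDiff_piLp_apply (p := 2)

theorem IsQ1On.add {K : Set (E d)} {u v : E d → ℝ} (hu : IsQ1On K u) (hv : IsQ1On K v) :
    IsQ1On K (u + v) := by
  obtain ⟨a, ha⟩ := hu
  obtain ⟨b, hb⟩ := hv
  refine ⟨a + b, fun x hx => ?_⟩
  simp only [Pi.add_apply, ha x hx, hb x hx, add_mul, Finset.sum_add_distrib]

theorem IsQ1On.smul {K : Set (E d)} {u : E d → ℝ} (r : ℝ) (hu : IsQ1On K u) :
    IsQ1On K (r • u) := by
  obtain ⟨a, ha⟩ := hu
  refine ⟨r • a, fun x hx => ?_⟩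
  simp only [Pi.smul_apply, ha x hx, smul_eq_mul, Finset.mul_sum, mul_assoc]

theorem IsQ1On.of_eq_zero {K : Set (E d)} {u : E d → ℝ} (hu : ∀ x ∈ K, u x = 0) :
    IsQ1On K u := ⟨0, fun x hx => by simp [hu x hx]⟩

end Multilinear

namespace MeshHierarchy

variable {d : ℕ} (G : MeshHierarchy d)

/-- The `Q₁` finite element space on the fine mesh of `Ω` with zero boundary values, described on
all the cells of the fine grid. -/
def FE : Submodule ℝ (E d → ℝ) where
  carrier := {v | Continuous v ∧ (∀ x, x ∉ G.Ω → v x = 0) ∧ ∀ τ, IsQ1On (G.fineElem τ) v}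
  add_mem' := fun {u v} hu hv => ⟨hu.1.add hv.1,
    fun x hx => by rw [Pi.add_apply, hu.2.1 x hx, hv.2.1 x hx, add_zero],
    fun τ => (hu.2.2 τ).add (hv.2.2 τ)⟩
  zero_mem' := ⟨continuous_const, fun _ _ => rfl, fun _ => .of_eq_zero fun _ _ => rfl⟩
  smul_mem' := fun r v hv => ⟨hv.1.const_smul r,
    fun x hx => by rw [Pi.smul_apply, hv.2.1 x hx, smul_zero], fun τ => (hv.2.2 τ).smul r⟩

/-- The finite element space on `ω` as a submodule. -/
def femSub (ω : Set (E d)) : Submodule ℝ (E d → ℝ) where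
  carrier := G.femSpace ω
  add_mem' := fun {u v} hu hv => ⟨hu.1.add hv.1,
    fun x hx => by rw [Pi.add_apply, hu.2.1 x hx, hv.2.1 x hx, add_zero],
    fun τ h1 h2 => (hu.2.2 τ h1 h2).add (hv.2.2 τ h1 h2)⟩
  zero_mem' := ⟨continuous_const, fun _ _ => rfl, fun _ _ _ => .of_eq_zero fun _ _ => rfl⟩
  smul_mem' := fun r v hv => ⟨hv.1.const_smul r,
    fun x hx => by rw [Pi.smul_apply, hv.2.1 x hx, smul_zero],
    fun τ h1 h2 => (hv.2.2 τ h1 h2).smul r⟩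

theorem idx_size_eq {ℓ : ℕ} (hℓ : ℓ ≤ G.L) (x : E d) :
    G.idx (G.size ℓ) x = fun k => G.idx G.fineSize x k / (G.ratio ℓ : ℤ) := by
  rw [G.size_eq_ratio_mul hℓ, idx_natCast_mul]

theorem mem_Ω_iff_fine {x : E d} (hx : x ∉ G.skel G.fineSize) :
    x ∈ G.Ω ↔ G.idx G.fineSize x ∈ G.fineMesh := by
  rw [G.mem_Ω_iff (ℓ := 0) fun h => hx (G.skel_size_subset (Nat.zero_le _) h),
    G.mem_fineMesh (Nat.zero_le _), G.idx_size_eq (Nat.zero_le _)]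

theorem eq_zero_on_fineElem {v : E d → ℝ} (hv : Continuous v) {τ : Cell d}
    (h : ∀ x ∈ G.openCube G.fineSize τ, v x = 0) : ∀ x ∈ G.fineElem τ, v x = 0 := by
  intro x hx
  have hc : IsClosed {x | v x = 0} := isClosed_eq hv continuous_const
  exact closure_minimal (fun y hy => h y hy) hc
    (G.cube_subset_closure_openCube G.fineSize_pos τ hx)

/-- On fine cells outside the region the function vanishes in the interior, hence on the closed cell
by continuity. All local spaces thus lie in one space, where one energy form serves every patch. -/
theorem mem_FE_of_mem_femSpace {ℓ : ℕ} (hℓ : ℓ ≤ G.L) {P : Finset (Cell d)} (hP : P ⊆ G.mesh ℓ)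
    {v : E d → ℝ} (hv : v ∈ G.femSpace (G.region ℓ P)) : v ∈ G.FE := by
  refine ⟨hv.1, fun x hx => hv.2.1 x fun h => hx (G.interior_region_subset_Ω hP h), fun τ => ?_⟩
  by_cases hτ : (fun k => τ k / (G.ratio ℓ : ℤ)) ∈ P
  · refine hv.2.2 τ ((G.mem_fineMesh hℓ τ).2 (hP hτ)) ?_
    have := G.cube_subset_cube_ediv G.fineSize_pos (G.ratio_pos ℓ) τ
    rw [← G.size_eq_ratio_mul hℓ] at this
    exact this.trans (Set.subset_biUnion_of_mem (u := fun z => G.elem ℓ z) hτ)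
  · refine .of_eq_zero (G.eq_zero_on_fineElem hv.1 fun x hx => hv.2.1 x fun h => hτ ?_)
    have hs := G.notMem_skel_of_mem_openCube G.fineSize_pos hx
    have := (G.mem_interior_region_iff (fun h => hs (G.skel_size_subset hℓ h)) P).1 h
    rwa [G.idx_size_eq hℓ, G.idx_eq_of_mem_openCube G.fineSize_pos hx] at this

/-! ### Regularity of finite element functions; Poincaré and Friedrichs inequalities -/

section Regularity

variable {G} {v : E d → ℝ}

theorem FE.continuous (hv : v ∈ G.FE) : Continuous v := hv.1

theorem FE.eq_zero (hv : v ∈ G.FE) {x : E d} (hx : x ∉ G.Ω) : v x = 0 := hv.2.1 x hx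

theorem FE.exists_bound (hv : v ∈ G.FE) : ∃ C, ∀ x, |v x| ≤ C := by
  obtain ⟨C, hC⟩ := (G.isCompact_region 0 (G.mesh 0)).exists_bound_of_continuousOn
    hv.1.continuousOn
  refine ⟨max C 0, fun x => ?_⟩
  by_cases hx : x ∈ G.Ω
  · exact (hC x (interior_subset hx)).trans (le_max_left _ _)
  · rw [FE.eq_zero hv hx, abs_zero]; exact le_max_right _ _

theorem eventuallyEq_q1Poly {x : E d} {τ : Cell d}
    (hx : x ∈ G.openCube G.fineSize τ) {c : Finset (Fin d) → ℝ}
    (hc : ∀ x ∈ G.fineElem τ, v x = ∑ s, c s * ∏ k ∈ s, x k) : v =ᶠ[nhds x] q1Poly c := by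
  filter_upwards [(G.isOpen_openCube τ).mem_nhds hx] with y hy
  exact hc y (G.openCube_subset_cube τ hy)

theorem FE.contDiffAt (hv : v ∈ G.FE) {x : E d} (hx : x ∉ G.skel G.fineSize) :
    ContDiffAt ℝ 1 v x := by
  obtain ⟨c, hc⟩ := hv.2.2 (G.idx G.fineSize x)
  exact (contDiff_q1Poly c).contDiffAt.congr_of_eventuallyEq
    (eventuallyEq_q1Poly (G.mem_openCube_idx G.fineSize_pos hx) hc)

theorem grad_eq_zero_of_eventuallyEq {x : E d} (h : v =ᶠ[nhds x] 0) : grad v x = 0 := by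
  funext k
  rw [grad, h.fderiv_eq]
  simp

theorem FE.grad_eq_zero (hv : v ∈ G.FE) {x : E d} (hx : x ∉ G.skel G.fineSize) (hΩ : x ∉ G.Ω) :
    grad v x = 0 := by
  have hx' := G.mem_openCube_idx G.fineSize_pos hx
  refine grad_eq_zero_of_eventuallyEq ?_
  filter_upwards [(G.isOpen_openCube _).mem_nhds hx'] with y hy
  refine FE.eq_zero hv fun h => hΩ ?_
  rw [G.mem_Ω_iff_fine hx]
  rw [G.mem_Ω_iff_fine (G.notMem_skel_of_mem_openCube G.fineSize_pos hy),
    G.idx_eq_of_mem_openCube G.fineSize_pos hy] at h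
  exact h

theorem FE.exists_grad_bound (hv : v ∈ G.FE) :
    ∃ C, 0 ≤ C ∧ ∀ x, x ∉ G.skel G.fineSize → ∀ k, |grad v x k| ≤ C := by
  have h : ∀ τ, ∃ C, 0 ≤ C ∧ ∀ x ∈ G.openCube G.fineSize τ, ∀ k, |grad v x k| ≤ C := by
    intro τ
    obtain ⟨c, hc⟩ := hv.2.2 τ
    obtain ⟨C, hC⟩ := (G.isCompact_cube (H := G.fineSize) τ).exists_bound_of_continuousOn
      ((contDiff_q1Poly c).continuous_fderiv one_ne_zero).continuousOn
    refine ⟨max C 0, le_max_right _ _, fun x hx k => ?_⟩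
    rw [grad, (eventuallyEq_q1Poly hx hc).fderiv_eq, ← Real.norm_eq_abs]
    refine (ContinuousLinearMap.le_opNorm _ _).trans ?_
    rw [PiLp.norm_single, norm_one, mul_one]
    exact (hC x (G.openCube_subset_cube τ hx)).trans (le_max_left _ _)
  choose C hC0 hC using h
  -- Only the finitely many cells of `Ω` matter, as the gradient vanishes on the others; the sum
  -- serves as a common bound for the nonnegative `C τ`.
  refine ⟨∑ τ ∈ G.fineMesh, C τ, Finset.sum_nonneg fun τ _ => hC0 τ, fun x hx k => ?_⟩
  by_cases hΩ : x ∈ G.Ω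
  · exact (hC _ x (G.mem_openCube_idx G.fineSize_pos hx) k).trans
      (Finset.single_le_sum (fun τ _ => hC0 τ) ((G.mem_Ω_iff_fine hx).1 hΩ))
  · rw [FE.grad_eq_zero hv hx hΩ]
    simpa using Finset.sum_nonneg fun τ _ => hC0 τ

theorem measurable_grad (v : E d → ℝ) (k : Fin d) : Measurable fun x => grad v x k :=
  measurable_fderiv_apply_const ℝ v _

variable (G) in
/-- The partial derivative, set to zero on the grid lines and outside `Ω`. -/
noncomputable def pderiv (v : E d → ℝ) (k : Fin d) : E d → ℝ :=
  (G.Ω \ G.skel G.fineSize).indicator fun x => grad v x k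

theorem FE.pderiv_eq (hv : v ∈ G.FE) {x : E d} (hx : x ∉ G.skel G.fineSize) (k : Fin d) :
    G.pderiv v k x = grad v x k := by
  rw [pderiv]
  by_cases hΩ : x ∈ G.Ω
  · exact Set.indicator_of_mem (show x ∈ G.Ω \ G.skel G.fineSize from ⟨hΩ, hx⟩) _
  · rw [Set.indicator_of_notMem fun h => hΩ h.1, FE.grad_eq_zero hv hx hΩ]
    rfl

theorem measurable_pderiv (v : E d → ℝ) (k : Fin d) : Measurable (G.pderiv v k) :=
  (measurable_grad v k).indicator (G.isOpen_Ω.measurableSet.diff (G.measurableSet_skel _))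

theorem FE.exists_pderiv_bound (hv : v ∈ G.FE) : ∃ C, 0 ≤ C ∧ ∀ k x, |G.pderiv v k x| ≤ C := by
  obtain ⟨C, hC0, hC⟩ := FE.exists_grad_bound hv
  refine ⟨C, hC0, fun k x => ?_⟩
  rw [pderiv]
  by_cases hx : x ∈ G.Ω \ G.skel G.fineSize
  · rw [Set.indicator_of_mem hx]; exact hC x hx.2 k
  · rw [Set.indicator_of_notMem hx, abs_zero]; exact hC0

theorem FE.hasDerivAt_line (hv : v ∈ G.FE) {x : Fin d → ℝ} {k : Fin d} {t : ℝ}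
    (hx : (WithLp.toLp 2 (Function.update x k t) : E d) ∉ G.skel G.fineSize) :
    HasDerivAt (fun s => v (WithLp.toLp 2 (Function.update x k s)))
      (G.pderiv v k (WithLp.toLp 2 (Function.update x k t))) t := by
  rw [FE.pderiv_eq hv hx]
  have h1 := ((FE.contDiffAt hv hx).differentiableAt one_ne_zero).hasFDerivAt
  have h2 : HasDerivAt (fun s => (WithLp.toLp 2 (Function.update x k s) : E d))
      (EuclideanSpace.single k 1) t := by
    have h3 := hasDerivAt_update x k t
    have h4 := (PiLp.continuousLinearEquiv 2 ℝ (fun _ : Fin d => ℝ)).symm.hasFDerivAt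
      (x := Function.update x k t) |>.comp_hasDerivAt t h3
    exact h4
  exact h1.comp_hasDerivAt t h2

variable (G) in
/-- Coordinates of the grid lines of the fine grid. -/
def gridCoords : Set ℝ := {s | ∃ (k : Fin d) (z : ℤ), s = G.origin k + G.fineSize * z}

theorem countable_gridCoords : (gridCoords G).Countable := by
  have : gridCoords G = ⋃ k : Fin d, Set.range fun z : ℤ => G.origin k + G.fineSize * z := by
    ext s; simp [gridCoords, eq_comm]
  rw [this]
  exact Set.countable_iUnion fun k => Set.countable_range _

theorem notMem_skel_of_notMem_gridCoords {x : E d} (h : ∀ k, x k ∉ gridCoords G) :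
    x ∉ G.skel G.fineSize := fun ⟨k, z, hz⟩ => h k ⟨k, z, hz⟩

/-- One countable set of exceptional coordinates serves all directions: a line whose fixed
coordinates avoid it meets the grid planes only at parameters in that set. -/
theorem update_notMem_skel {x : Fin d → ℝ} {k : Fin d} {t : ℝ}
    (h : ∀ j, j ≠ k → x j ∉ gridCoords G) (ht : t ∉ gridCoords G) :
    (WithLp.toLp 2 (Function.update x k t) : E d) ∉ G.skel G.fineSize := by
  refine notMem_skel_of_notMem_gridCoords fun j => ?_
  by_cases hj : j = k
  · subst hj; simpa using ht
  · simpa [hj] using h j hj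

theorem FE.intervalIntegrable_pderiv (hv : v ∈ G.FE) (x : Fin d → ℝ) (k : Fin d) (a b : ℝ) :
    IntervalIntegrable (fun t => G.pderiv v k (WithLp.toLp 2 (Function.update x k t)))
      volume a b ∧
    IntervalIntegrable (fun t => G.pderiv v k (WithLp.toLp 2 (Function.update x k t)) ^ 2)
      volume a b := by
  obtain ⟨C, hC0, hC⟩ := FE.exists_pderiv_bound hv
  have hm : Measurable fun t => G.pderiv v k (WithLp.toLp 2 (Function.update x k t)) :=
    (measurable_pderiv v k).comp
      ((PiLp.continuous_toLp 2 fun _ : Fin d => ℝ).measurable.comp (measurable_update x))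
  constructor
  · exact ⟨integrable_of_measurable_of_bounded hm fun t => hC k _,
      integrable_of_measurable_of_bounded hm fun t => hC k _⟩
  · have hC2 : ∀ t, |G.pderiv v k (WithLp.toLp 2 (Function.update x k t)) ^ 2| ≤ C ^ 2 :=
      fun t => by rw [abs_pow]; exact pow_le_pow_left₀ (abs_nonneg _) (hC k _) 2
    exact ⟨integrable_of_measurable_of_bounded (hm.pow_const 2) hC2,
      integrable_of_measurable_of_bounded (hm.pow_const 2) hC2⟩

theorem integral_cube_eq (f : E d → ℝ) {H : ℝ} (z : Cell d) :
    ∫ x in G.cube H z, f x = ∫ y, f (WithLp.toLp 2 y) ∂(Measure.pi fun k =>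
      volume.restrict (Set.Icc (G.origin k + H * z k) (G.origin k + H * z k + H))) := by
  rw [cube_eq_preimage, ← Measure.restrict_pi_pi, ← volume_pi]
  exact (PiLp.volume_preserving_ofLp (Fin d)).setIntegral_preimage_emb
    (MeasurableEquiv.toLp 2 (Fin d → ℝ)).symm.measurableEmbedding
    (fun y => f (WithLp.toLp 2 y)) _

/-- Poincaré's inequality on a cube, with the sharp constant. -/
theorem FE.poincare_cube (hv : v ∈ G.FE) {H : ℝ} (hH : 0 < H) (z : Cell d)
    (h0 : ∫ x in G.cube H z, v x = 0) :
    ∫ x in G.cube H z, v x ^ 2 ≤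
      (H / Real.pi) ^ 2 * ∑ k, ∫ x in G.cube H z, G.pderiv v k x ^ 2 := by
  obtain ⟨C₁, hC₁⟩ := FE.exists_bound hv
  obtain ⟨C₂, hC₂0, hC₂⟩ := FE.exists_pderiv_bound hv
  have htoLp := (PiLp.continuous_toLp 2 fun _ : Fin d => ℝ)
  -- The cube is a product of intervals of length `H` and need not be aligned with the fine grid;
  -- kinks of `v` along lines are absorbed by the exceptional set.
  have key := variance_pi_le (c := (H / Real.pi) ^ 2) hH (S := gridCoords G)
    (fun k : Fin d =>
      volume.restrict (Set.Icc (G.origin k + H * z k) (G.origin k + H * z k + H)))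
    (fun k => by simp [hH.le])
    (fun k => ae_restrict_of_ae (countable_gridCoords.ae_notMem _))
    (f := fun y => v (WithLp.toLp 2 y)) (g := fun k y => G.pderiv v k (WithLp.toLp 2 y))
    ((FE.continuous hv).comp htoLp).measurable
    (fun k => (measurable_pderiv v k).comp htoLp.measurable) (C := max C₁ C₂)
    (fun x => (hC₁ _).trans (le_max_left _ _)) (fun k x => (hC₂ k _).trans (le_max_right _ _)) ?_
  · rw [← integral_cube_eq v, h0] at key
    have hv2 := integral_cube_eq (G := G) (H := H) (fun x => v x ^ 2) z
    simp only [] at hv2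
    rw [← hv2] at key
    have hsum : ∀ k, ∫ y, G.pderiv v k (WithLp.toLp 2 y) ^ 2 ∂(Measure.pi fun k : Fin d =>
      volume.restrict (Set.Icc (G.origin k + H * z k) (G.origin k + H * z k + H))) =
      ∫ x in G.cube H z, G.pderiv v k x ^ 2 :=
      fun k => (integral_cube_eq (fun x => G.pderiv v k x ^ 2) z).symm
    simp only [hsum] at key
    simpa using key
  · intro k x hx
    set a := G.origin k + H * z k with ha
    have hab : a < a + H := by linarith
    have h := integral_sq_sub_le (u := fun t => v (WithLp.toLp 2 (Function.update x k t)))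
      (u' := fun t => G.pderiv v k (WithLp.toLp 2 (Function.update x k t))) (a := a)
      (b := a + H) hab (countable_gridCoords (G := G))
      ((FE.continuous hv).comp (htoLp.comp (continuous_const.update k continuous_id)))
      (fun t ht => FE.hasDerivAt_line hv (update_notMem_skel hx ht.2))
      (FE.intervalIntegrable_pderiv hv x k _ _).1 (FE.intervalIntegrable_pderiv hv x k _ _).2
    simpa only [intervalIntegral.integral_of_le hab.le, ← integral_Icc_eq_integral_Ioc,
      add_sub_cancel_left] using h

/-- The Lebesgue measure of Euclidean space in coordinates. -/
theorem integral_euclidean_eq (f : E d → ℝ) :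
    ∫ x, f x = ∫ y, f (WithLp.toLp 2 y) ∂(Measure.pi fun _ : Fin d => (volume : Measure ℝ)) := by
  rw [← volume_pi]
  exact (PiLp.volume_preserving_ofLp (Fin d)).integral_comp
    (MeasurableEquiv.toLp 2 (Fin d → ℝ)).symm.measurableEmbedding (fun y => f (WithLp.toLp 2 y))

theorem integrable_euclidean_iff (f : E d → ℝ) :
    Integrable (fun y => f (WithLp.toLp 2 y)) (Measure.pi fun _ : Fin d => (volume : Measure ℝ)) ↔
      Integrable f := by
  rw [← volume_pi]
  exact ((PiLp.volume_preserving_ofLp (Fin d)).integrable_comp_emb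
    (MeasurableEquiv.toLp 2 (Fin d → ℝ)).symm.measurableEmbedding
    (g := fun y => f (WithLp.toLp 2 y))).symm

theorem integrable_of_bounded_of_eq_zero {f : E d → ℝ} (hf : Measurable f) {C : ℝ}
    (hC : ∀ x, |f x| ≤ C) (h0 : ∀ x, x ∉ G.Ω → f x = 0) : Integrable f := by
  have h : IntegrableOn f G.Ω := by
    have : IsFiniteMeasure (volume.restrict G.Ω) := ⟨by
      rw [Measure.restrict_apply_univ]; exact G.volume_Ω_lt_top⟩
    exact integrable_of_measurable_of_bounded hf hC
  rwa [integrableOn_iff_integrable_of_support_subset] at h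
  intro x hx
  by_contra hn
  exact hx (h0 x hn)

theorem FE.integrable_sq (hv : v ∈ G.FE) : Integrable fun x => v x ^ 2 := by
  obtain ⟨C, hC⟩ := FE.exists_bound hv
  refine integrable_of_bounded_of_eq_zero (G := G) ((FE.continuous hv).measurable.pow_const 2)
    (C := C ^ 2) (fun x => ?_) fun x hx => ?_
  · rw [abs_pow]; exact pow_le_pow_left₀ (abs_nonneg _) (hC x) 2
  · rw [FE.eq_zero hv hx]; norm_num

theorem FE.integrable_pderiv_sq (hv : v ∈ G.FE) (k : Fin d) :
    Integrable fun x => G.pderiv v k x ^ 2 := by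
  obtain ⟨C, hC0, hC⟩ := FE.exists_pderiv_bound hv
  refine integrable_of_bounded_of_eq_zero (G := G) ((measurable_pderiv v k).pow_const 2)
    (C := C ^ 2) (fun x => ?_) fun x hx => ?_
  · rw [abs_pow]; exact pow_le_pow_left₀ (abs_nonneg _) (hC k x) 2
  · rw [pderiv, Set.indicator_of_notMem fun h => hx h.1]; norm_num

theorem diam_Ω_pos (hd : 1 ≤ d) : 0 < Metric.diam G.Ω := by
  have : NeZero d := ⟨by omega⟩
  obtain ⟨x, hx⟩ : G.Ω.Nonempty := by
    obtain ⟨z, hz⟩ := G.mesh_nonempty 0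
    exact (G.openCube_nonempty (G.size_pos 0) z).mono (G.openCube_subset_interior_region hz)
  obtain ⟨ε, hε, hb⟩ := Metric.isOpen_iff.1 G.isOpen_Ω x hx
  set y : E d := x + EuclideanSpace.single 0 (ε / 2) with hy
  have hxy : dist y x = ε / 2 := by
    rw [hy, dist_eq_norm, add_sub_cancel_left, PiLp.norm_single, Real.norm_eq_abs,
      abs_of_pos (by linarith)]
  have hyΩ : y ∈ G.Ω := hb (by rw [Metric.mem_ball, hxy]; linarith)
  have := Metric.dist_le_diam_of_mem G.isBounded_Ω hyΩ hx
  linarith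

/-- The first coordinate varies by at most `diam Ω` on `Ω`. On almost every line in this direction
`v` vanishes at the ends of the corresponding interval, and the sharp one-dimensional inequality is
integrated over the lines. -/
theorem FE.friedrichs_one {n : ℕ} {G : MeshHierarchy (n + 1)} {v : E (n + 1) → ℝ}
    (hv : v ∈ G.FE) : ∫ x, v x ^ 2 ≤ (Metric.diam G.Ω / Real.pi) ^ 2 *
      ∫ x, G.pderiv v 0 x ^ 2 := by
  have hD := G.diam_Ω_pos (Nat.le_add_left 1 n)
  set D := Metric.diam G.Ω with hDdef
  obtain ⟨x₀, hx₀⟩ : G.Ω.Nonempty := by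
    by_contra h
    rw [Set.not_nonempty_iff_eq_empty] at h
    rw [hDdef, h, Metric.diam_empty] at hD
    exact lt_irrefl _ hD
  -- the domain lies in a strip of width `D`
  obtain ⟨a, ha⟩ : ∃ a : ℝ, ∀ x ∈ G.Ω, a ≤ x 0 ∧ x 0 ≤ a + D := by
    have hdist : ∀ x ∈ G.Ω, ∀ y ∈ G.Ω, x 0 - D ≤ y 0 := by
      intro x hx y hy
      have h1 := Metric.dist_le_diam_of_mem G.isBounded_Ω hx hy
      have h2 : |x 0 - y 0| ≤ dist x y := by
        rw [dist_eq_norm]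
        exact PiLp.norm_apply_le (x - y) 0
      linarith [le_abs_self (x 0 - y 0)]
    refine ⟨sInf ((fun x : E (n + 1) => x 0) '' G.Ω), fun x hx => ⟨csInf_le ?_ ⟨x, hx, rfl⟩, ?_⟩⟩
    · exact ⟨x₀ 0 - D, by rintro _ ⟨y, hy, rfl⟩; exact hdist x₀ hx₀ y hy⟩
    · have : x 0 - D ≤ sInf ((fun x : E (n + 1) => x 0) '' G.Ω) :=
        le_csInf ⟨_, x₀, hx₀, rfl⟩ (by rintro _ ⟨y, hy, rfl⟩; exact hdist x hx y hy)
      linarith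
  have hab : a < a + D := by linarith
  rw [integral_euclidean_eq, integral_euclidean_eq, integral_pi_succ, integral_pi_succ]
  have hi1 := (integrable_euclidean_iff _).2 (FE.integrable_sq hv)
  have hi2 := (integrable_euclidean_iff _).2 (FE.integrable_pderiv_sq hv 0)
  have hmp := (measurePreserving_piFinSuccAbove
    (fun _ : Fin (n + 1) => (volume : Measure ℝ)) 0).symm
  have htr : ∀ {f : (Fin (n + 1) → ℝ) → ℝ},
      Integrable f (Measure.pi fun _ : Fin (n + 1) => (volume : Measure ℝ)) →
      Integrable (fun p : ℝ × (Fin n → ℝ) => f (Fin.cons p.1 p.2))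
        ((volume : Measure ℝ).prod (Measure.pi fun _ : Fin n => (volume : Measure ℝ))) := by
    intro f hf
    have := (hmp.integrable_comp_emb (MeasurableEquiv.measurableEmbedding _)).2 hf
    refine this.congr (Filter.Eventually.of_forall fun p => ?_)
    change f (Fin.insertNth 0 p.1 p.2) = _
    rw [Fin.insertNth_zero']
  have hj1 := htr hi1
  have hj2 := htr hi2
  rw [integral_prod_symm _ hj1, integral_prod_symm _ hj2, ← integral_const_mul]
  refine integral_mono_ae hj1.integral_prod_right (hj2.integral_prod_right.const_mul _) ?_
  have hae : ∀ᵐ y ∂(Measure.pi fun _ : Fin n => (volume : Measure ℝ)),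
      ∀ j, y j ∉ gridCoords G := by
    rw [ae_all_iff]
    intro j
    exact (Measure.quasiMeasurePreserving_eval (fun _ : Fin n => (volume : Measure ℝ)) j).ae
      ((countable_gridCoords (G := G)).ae_notMem volume)
  filter_upwards [hae, hj2.prod_left_ae] with y hy hyi
  obtain ⟨x, hx⟩ : ∃ x : Fin (n + 1) → ℝ, x = Fin.cons 0 y := ⟨_, rfl⟩
  have hcons : ∀ t : ℝ, (Fin.cons t y : Fin (n + 1) → ℝ) = Function.update x 0 t := fun t => by
    rw [hx, Fin.update_cons_zero]
  simp only [hcons] at hyi ⊢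
  have hx' : ∀ j, j ≠ 0 → x j ∉ gridCoords G := fun j hj => by
    obtain ⟨i, rfl⟩ := Fin.exists_succ_eq.2 hj
    simpa [hx] using hy i
  set u : ℝ → ℝ := fun t => v (WithLp.toLp 2 (Function.update x 0 t)) with hu
  set u' : ℝ → ℝ := fun t => G.pderiv v 0 (WithLp.toLp 2 (Function.update x 0 t)) with hu'
  have huc : Continuous u := (FE.continuous hv).comp
    ((PiLp.continuous_toLp 2 _).comp (continuous_const.update 0 continuous_id))
  have hout : ∀ t, (t < a ∨ a + D < t) → u t = 0 := by
    intro t ht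
    refine FE.eq_zero hv fun h => ?_
    have := ha _ h
    simp only [Function.update_self] at this
    rcases ht with ht | ht <;> linarith
  -- The function vanishes strictly outside `[a, a + D]`; continuity gives zero boundary values at
  -- the two endpoints.
  have hcl : IsClosed {t | u t = 0} := isClosed_eq huc continuous_const
  have hua : u a = 0 := by
    have : closure (Set.Iio a) ⊆ {t | u t = 0} :=
      closure_minimal (fun t ht => hout t (Or.inl ht)) hcl
    exact this (by rw [closure_Iio]; exact Set.self_mem_Iic)
  have hub : u (a + D) = 0 := by
    have : closure (Set.Ioi (a + D)) ⊆ {t | u t = 0} :=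
      closure_minimal (fun t ht => hout t (Or.inr ht)) hcl
    exact this (by rw [closure_Ioi]; exact Set.self_mem_Ici)
  have key := integral_sq_le_of_zero_boundary hab (countable_gridCoords (G := G)) huc.continuousOn
    (fun t ht => FE.hasDerivAt_line hv (update_notMem_skel hx' ht.2))
    (FE.intervalIntegrable_pderiv hv x 0 _ _).1 (FE.intervalIntegrable_pderiv hv x 0 _ _).2 hua hub
  rw [add_sub_cancel_left, intervalIntegral.integral_of_le hab.le,
    intervalIntegral.integral_of_le hab.le] at key
  have h1 : ∫ t, u t ^ 2 = ∫ t in Set.Ioc a (a + D), u t ^ 2 := by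
    refine (setIntegral_eq_integral_of_forall_compl_eq_zero fun t ht => ?_).symm
    have : u t = 0 := by
      rw [Set.mem_Ioc, not_and_or, not_lt, not_le] at ht
      rcases ht with ht | ht
      · rcases ht.lt_or_eq with h | h
        · exact hout t (Or.inl h)
        · rw [h, hua]
      · exact hout t (Or.inr ht)
    rw [this]; norm_num
  have h2 : ∫ t in Set.Ioc a (a + D), u' t ^ 2 ≤ ∫ t, u' t ^ 2 :=
    setIntegral_le_integral hyi (Filter.Eventually.of_forall fun t => sq_nonneg _)
  change ∫ t, u t ^ 2 ≤ (D / Real.pi) ^ 2 * ∫ t, u' t ^ 2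
  rw [h1]
  have h3 : (D / Real.pi) ^ 2 * (Real.pi / D) ^ 2 = 1 := by
    have := Real.pi_pos
    field_simp
  calc ∫ t in Set.Ioc a (a + D), u t ^ 2
      = (D / Real.pi) ^ 2 * ((Real.pi / D) ^ 2 * ∫ t in Set.Ioc a (a + D), u t ^ 2) := by
        rw [← mul_assoc, h3, one_mul]
    _ ≤ (D / Real.pi) ^ 2 * ∫ t, u' t ^ 2 :=
        mul_le_mul_of_nonneg_left (key.trans h2) (sq_nonneg _)

/-- Friedrichs' inequality, with the diameter of the domain. -/
theorem FE.friedrichs (hd : 1 ≤ d) (hv : v ∈ G.FE) :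
    ∫ x, v x ^ 2 ≤ (Metric.diam G.Ω / Real.pi) ^ 2 * ∑ k, ∫ x, G.pderiv v k x ^ 2 := by
  obtain ⟨n, rfl⟩ : ∃ n, d = n + 1 := ⟨d - 1, by omega⟩
  refine (FE.friedrichs_one hv).trans (mul_le_mul_of_nonneg_left ?_ (sq_nonneg _))
  exact Finset.single_le_sum (f := fun k => ∫ x, G.pderiv v k x ^ 2)
    (fun k _ => integral_nonneg fun x => sq_nonneg _) (Finset.mem_univ 0)

end Regularity

end MeshHierarchy

/-! ### Pointwise quadratic forms and the energy form -/

section Quadratic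

variable {d : ℕ} {M : Matrix (Fin d) (Fin d) ℝ}

theorem mulVec_dotProduct_comm (hM : M.IsSymm) (η ξ : Fin d → ℝ) :
    (M *ᵥ η) ⬝ᵥ ξ = (M *ᵥ ξ) ⬝ᵥ η := by
  rw [dotProduct_comm (M *ᵥ η), Matrix.dotProduct_mulVec, ← Matrix.mulVec_transpose, hM.eq]

/-- Polarization: expand the nonnegative value of the form at `η - ξ`. -/
theorem mulVec_dotProduct_le (hM : M.IsSymm) (h0 : ∀ η, 0 ≤ (M *ᵥ η) ⬝ᵥ η) (η ξ : Fin d → ℝ) :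
    (M *ᵥ η) ⬝ᵥ ξ ≤ ((M *ᵥ η) ⬝ᵥ η + (M *ᵥ ξ) ⬝ᵥ ξ) / 2 := by
  have h1 := h0 (η - ξ)
  have h2 := mulVec_dotProduct_comm hM η ξ
  simp only [Matrix.mulVec_sub, sub_dotProduct, dotProduct_sub] at h1
  linarith

theorem abs_mulVec_dotProduct_le (hM : M.IsSymm) (h0 : ∀ η, 0 ≤ (M *ᵥ η) ⬝ᵥ η)
    (η ξ : Fin d → ℝ) :
    |(M *ᵥ η) ⬝ᵥ ξ| ≤ ((M *ᵥ η) ⬝ᵥ η + (M *ᵥ ξ) ⬝ᵥ ξ) / 2 := by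
  refine abs_le.2 ⟨?_, mulVec_dotProduct_le hM h0 η ξ⟩
  have := mulVec_dotProduct_le hM h0 η (-ξ)
  simp only [Matrix.mulVec_neg, neg_dotProduct, dotProduct_neg, neg_neg] at this
  linarith

/-- The quadratic form of a sum of `N` vectors is at most `N` times the sum of the values. -/
theorem mulVec_sum_dotProduct_le {ι : Type*} (hM : M.IsSymm) (h0 : ∀ η, 0 ≤ (M *ᵥ η) ⬝ᵥ η)
    (s : Finset ι) (η : ι → Fin d → ℝ) :
    (M *ᵥ ∑ i ∈ s, η i) ⬝ᵥ (∑ i ∈ s, η i) ≤ s.card * ∑ i ∈ s, (M *ᵥ η i) ⬝ᵥ η i := by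
  have h1 : (M *ᵥ ∑ i ∈ s, η i) ⬝ᵥ (∑ i ∈ s, η i) =
      ∑ i ∈ s, ∑ j ∈ s, (M *ᵥ η i) ⬝ᵥ η j := by
    rw [Matrix.mulVec_sum, sum_dotProduct]
    exact Finset.sum_congr rfl fun i _ => dotProduct_sum _ _ _
  rw [h1]
  refine (Finset.sum_le_sum fun i _ => Finset.sum_le_sum fun j _ =>
    mulVec_dotProduct_le hM h0 (η i) (η j)).trans (le_of_eq ?_)
  simp only [← Finset.sum_div, Finset.sum_add_distrib, Finset.sum_const, nsmul_eq_mul,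
    ← Finset.mul_sum]
  ring

end Quadratic

namespace MeshHierarchy

variable {d : ℕ} {G : MeshHierarchy d} {A : E d → Matrix (Fin d) (Fin d) ℝ} {α β : ℝ}
  {u v w : E d → ℝ}

theorem FE.grad_add (hu : u ∈ G.FE) (hv : v ∈ G.FE) {x : E d} (hx : x ∉ G.skel G.fineSize) :
    grad (u + v) x = grad u x + grad v x := by
  funext k
  rw [grad, fderiv_add ((FE.contDiffAt hu hx).differentiableAt one_ne_zero)
    ((FE.contDiffAt hv hx).differentiableAt one_ne_zero)]
  rfl

theorem FE.grad_smul (hu : u ∈ G.FE) (r : ℝ) {x : E d} (hx : x ∉ G.skel G.fineSize) :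
    grad (r • u) x = r • grad u x := by
  funext k
  rw [grad, fderiv_const_smul ((FE.contDiffAt hu hx).differentiableAt one_ne_zero)]
  rfl

theorem FE.grad_sum {ι : Type*} (s : Finset ι) {f : ι → E d → ℝ} (hf : ∀ i ∈ s, f i ∈ G.FE)
    {x : E d} (hx : x ∉ G.skel G.fineSize) : grad (∑ i ∈ s, f i) x = ∑ i ∈ s, grad (f i) x := by
  classical
  induction s using Finset.induction_on with
  | empty => exact grad_eq_zero_of_eventuallyEq (by simp)
  | insert a s ha ih =>
    rw [Finset.sum_insert ha, Finset.sum_insert ha, FE.grad_add (hf a (by simp))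
      (G.FE.sum_mem fun i hi => hf i (by simp [hi])) hx, ih fun i hi => hf i (by simp [hi])]

/-- The coefficient is symmetric and satisfies the bounds at almost every point of `Ω`. -/
theorem ae_coefficient (hα : 0 < α) (hA : IsCoefficient G.Ω α β A) :
    ∀ᵐ x ∂(volume.restrict G.Ω), x ∉ G.skel G.fineSize ∧ (A x).IsSymm ∧
      (∀ η : Fin d → ℝ, 0 ≤ (A x *ᵥ η) ⬝ᵥ η) ∧
      ∀ η : Fin d → ℝ, α * (η ⬝ᵥ η) ≤ (A x *ᵥ η) ⬝ᵥ η ∧ (A x *ᵥ η) ⬝ᵥ η ≤ β * (η ⬝ᵥ η) := by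
  filter_upwards [ae_restrict_of_ae (G.ae_notMem_skel G.fineSize), hA.symm, hA.bounds]
    with x h1 h2 h3
  refine ⟨h1, h2, fun η => le_trans ?_ (h3 η).1, h3⟩
  exact mul_nonneg hα.le (Finset.sum_nonneg fun i _ => mul_self_nonneg _)

theorem isFiniteMeasure_restrict_Ω : IsFiniteMeasure (volume.restrict G.Ω) :=
  ⟨by rw [Measure.restrict_apply_univ]; exact G.volume_Ω_lt_top⟩

theorem FE.dotProduct_grad_le (hv : v ∈ G.FE) :
    ∃ C, ∀ x, x ∉ G.skel G.fineSize → grad v x ⬝ᵥ grad v x ≤ C := by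
  obtain ⟨C, hC0, hC⟩ := FE.exists_grad_bound hv
  refine ⟨∑ _k : Fin d, C ^ 2, fun x hx => Finset.sum_le_sum fun k _ => ?_⟩
  rw [← sq]
  exact sq_le_sq' (abs_le.1 (hC x hx k)).1 (abs_le.1 (hC x hx k)).2

/-- The entries of `A` are only known to be measurable. The bound on the bilinear integrand comes
from polarization and the upper bound of the quadratic form, together with bounded gradients. -/
theorem FE.integrableOn_energy (hα : 0 < α) (hαβ : α ≤ β) (hA : IsCoefficient G.Ω α β A)
    (hu : u ∈ G.FE) (hv : v ∈ G.FE) :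
    IntegrableOn (fun x => (A x *ᵥ grad u x) ⬝ᵥ grad v x) G.Ω := by
  have := isFiniteMeasure_restrict_Ω (G := G)
  obtain ⟨C₁, hC₁⟩ := FE.dotProduct_grad_le hu
  obtain ⟨C₂, hC₂⟩ := FE.dotProduct_grad_le hv
  refine Integrable.of_bound (C := (β * C₁ + β * C₂) / 2) ?_ ?_
  · simp only [dotProduct, Matrix.mulVec]
    refine AEMeasurable.aestronglyMeasurable ?_
    refine Finset.aemeasurable_fun_sum _ fun i _ => AEMeasurable.mul ?_
      (measurable_grad v i).aemeasurable
    exact Finset.aemeasurable_fun_sum _ fun j _ => (hA.meas i j).mul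
      (measurable_grad u j).aemeasurable
  · filter_upwards [ae_coefficient hα hA] with x ⟨hx, hs, h0, hb⟩
    have hβ : 0 ≤ β := hα.le.trans hαβ
    refine (abs_mulVec_dotProduct_le hs h0 _ _).trans ?_
    have h1 := (hb (grad u x)).2.trans (mul_le_mul_of_nonneg_left (hC₁ x hx) hβ)
    have h2 := (hb (grad v x)).2.trans (mul_le_mul_of_nonneg_left (hC₂ x hx) hβ)
    linarith

theorem aForm_comm (hα : 0 < α) (hA : IsCoefficient G.Ω α β A) (u v : E d → ℝ) :
    aForm A G.Ω u v = aForm A G.Ω v u := by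
  refine integral_congr_ae ?_
  filter_upwards [ae_coefficient hα hA] with x ⟨_, hs, _, _⟩
  exact mulVec_dotProduct_comm hs _ _

/-- The energy form as a bilinear form on the finite element space. -/
noncomputable def energy (hα : 0 < α) (hαβ : α ≤ β) (hA : IsCoefficient G.Ω α β A) :
    G.FE →ₗ[ℝ] G.FE →ₗ[ℝ] ℝ :=
  have hadd : ∀ u₁ u₂ v : G.FE, aForm A G.Ω (u₁ + u₂ : G.FE) v =
      aForm A G.Ω u₁ v + aForm A G.Ω u₂ v := fun u₁ u₂ v => by
    rw [aForm, aForm, aForm, ← integral_add (FE.integrableOn_energy hα hαβ hA u₁.2 v.2)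
      (FE.integrableOn_energy hα hαβ hA u₂.2 v.2)]
    refine integral_congr_ae ?_
    filter_upwards [ae_coefficient hα hA] with x ⟨hx, _⟩
    rw [Submodule.coe_add, FE.grad_add u₁.2 u₂.2 hx, Matrix.mulVec_add, add_dotProduct]
  have hsmul : ∀ (c : ℝ) (u v : G.FE), aForm A G.Ω (c • u : G.FE) v = c • aForm A G.Ω u v :=
    fun c u v => by
      rw [aForm, aForm, ← integral_smul]
      refine integral_congr_ae ?_
      filter_upwards [ae_coefficient hα hA] with x ⟨hx, _⟩
      rw [Submodule.coe_smul, FE.grad_smul u.2 c hx, Matrix.mulVec_smul, smul_dotProduct]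
  LinearMap.mk₂ ℝ (fun u v => aForm A G.Ω u v) hadd hsmul
    (fun u v₁ v₂ => by
      simp only [aForm_comm hα hA (u : E d → ℝ)]
      exact hadd v₁ v₂ u)
    fun c u v => by
      simp only [aForm_comm hα hA (u : E d → ℝ)]
      exact hsmul c v u

theorem energy_apply (hα : 0 < α) (hαβ : α ≤ β) (hA : IsCoefficient G.Ω α β A) (u v : G.FE) :
    energy hα hαβ hA u v = aForm A G.Ω u v := rfl

theorem energy_comm (hα : 0 < α) (hαβ : α ≤ β) (hA : IsCoefficient G.Ω α β A) (u v : G.FE) :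
    energy hα hαβ hA u v = energy hα hαβ hA v u := aForm_comm hα hA _ _

theorem aForm_self_nonneg (hα : 0 < α) (hA : IsCoefficient G.Ω α β A) (u : E d → ℝ) :
    0 ≤ aForm A G.Ω u u := by
  refine integral_nonneg_of_ae ?_
  filter_upwards [ae_coefficient hα hA] with x ⟨_, _, h0, _⟩
  exact h0 _

theorem energy_self_nonneg (hα : 0 < α) (hαβ : α ≤ β) (hA : IsCoefficient G.Ω α β A) (u : G.FE) :
    0 ≤ energy hα hαβ hA u u := aForm_self_nonneg hα hA _

theorem energy_le_half (hα : 0 < α) (hαβ : α ≤ β) (hA : IsCoefficient G.Ω α β A) (u v : G.FE) :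
    energy hα hαβ hA u v ≤ (energy hα hαβ hA u u + energy hα hαβ hA v v) / 2 := by
  have h := energy_self_nonneg hα hαβ hA (u - v)
  have h2 := energy_comm hα hαβ hA u v
  simp only [map_sub, LinearMap.sub_apply] at h
  linarith

theorem energy_sum_le (hα : 0 < α) (hαβ : α ≤ β) (hA : IsCoefficient G.Ω α β A) {ι : Type*}
    (s : Finset ι) (f : ι → G.FE) :
    energy hα hαβ hA (∑ i ∈ s, f i) (∑ i ∈ s, f i) ≤
      s.card * ∑ i ∈ s, energy hα hαβ hA (f i) (f i) := by
  simp only [map_sum, LinearMap.sum_apply]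
  refine (Finset.sum_le_sum fun i _ => Finset.sum_le_sum fun j _ =>
    energy_le_half hα hαβ hA (f j) (f i)).trans (le_of_eq ?_)
  simp only [← Finset.sum_div, Finset.sum_add_distrib, Finset.sum_const, nsmul_eq_mul,
    ← Finset.mul_sum]
  ring

theorem FE.integral_sq_pderiv_le (hα : 0 < α) (hαβ : α ≤ β) (hA : IsCoefficient G.Ω α β A)
    (hv : v ∈ G.FE) : α * ∑ k, ∫ x, G.pderiv v k x ^ 2 ≤ aForm A G.Ω v v := by
  have h1 : ∀ k, ∫ x, G.pderiv v k x ^ 2 = ∫ x in G.Ω, G.pderiv v k x ^ 2 := fun k => by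
    refine (setIntegral_eq_integral_of_forall_compl_eq_zero fun x hx => ?_).symm
    rw [pderiv, Set.indicator_of_notMem fun h => hx h.1]; norm_num
  simp only [h1]
  rw [← integral_finsetSum _ fun k _ => (FE.integrable_pderiv_sq hv k).integrableOn,
    ← integral_const_mul]
  refine integral_mono_ae ((integrable_finsetSum _ fun k _ =>
    (FE.integrable_pderiv_sq hv k).integrableOn).const_mul α)
    (FE.integrableOn_energy hα hαβ hA hv hv) ?_
  filter_upwards [ae_coefficient hα hA] with x ⟨hx, _, _, hb⟩
  refine le_trans (le_of_eq ?_) (hb (grad v x)).1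
  congr 1
  exact Finset.sum_congr rfl fun k _ => by rw [FE.pderiv_eq hv hx, sq]

/-- Positive definiteness: zero energy gives zero gradient by ellipticity, Friedrichs' inequality
gives `v = 0` almost everywhere, and continuity gives it everywhere. -/
theorem FE.eq_zero_of_aForm_eq_zero (hd : 1 ≤ d) (hα : 0 < α) (hαβ : α ≤ β)
    (hA : IsCoefficient G.Ω α β A) (hv : v ∈ G.FE) (h : aForm A G.Ω v v = 0) : v = 0 := by
  have h1 := FE.integral_sq_pderiv_le hα hαβ hA hv
  have h2 := FE.friedrichs hd hv
  have h3 : ∑ k, ∫ x, G.pderiv v k x ^ 2 ≤ 0 := by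
    rw [h] at h1
    exact nonpos_of_mul_nonpos_right h1 hα
  have h4 : ∫ x, v x ^ 2 = 0 := le_antisymm
    (h2.trans (mul_nonpos_of_nonneg_of_nonpos (sq_nonneg _) h3))
    (integral_nonneg fun x => sq_nonneg _)
  rw [integral_eq_zero_iff_of_nonneg (fun x => sq_nonneg _) (FE.integrable_sq hv)] at h4
  have h5 : v =ᵐ[volume] 0 := by
    filter_upwards [h4] with x hx
    exact pow_eq_zero_iff two_ne_zero |>.1 hx
  exact (Continuous.ae_eq_iff_eq volume (FE.continuous hv) continuous_const).1 h5

/-- Off the closed region `u` is locally zero, so the integrand vanishes, and passing to the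
interior of the region changes a null set. Only the first argument has to be supported in the
region. -/
theorem aForm_region_eq {ℓ : ℕ} (hℓ : ℓ ≤ G.L) {P : Finset (Cell d)} (hP : P ⊆ G.mesh ℓ)
    (hu : ∀ x ∉ interior (G.region ℓ P), u x = 0) (v : E d → ℝ) :
    aForm A (G.region ℓ P) u v = aForm A G.Ω u v := by
  rw [aForm, aForm, ← setIntegral_congr_set (G.interior_region_ae_eq ℓ P)]
  refine (setIntegral_eq_of_subset_of_ae_sdiff_eq_zero
    G.isOpen_Ω.measurableSet.nullMeasurableSet (G.interior_region_subset_Ω hP) ?_).symm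
  filter_upwards [G.ae_notMem_skel G.fineSize] with x hx hxd
  have hx' : x ∉ G.region ℓ P := fun h => hxd.2 <| by
    have hs : x ∉ G.skel (G.size ℓ) := fun h => hx (G.skel_size_subset hℓ h)
    rw [G.mem_interior_region_iff hs, ← G.mem_region_iff hs]
    exact h
  have h0 : grad u x = 0 := by
    refine grad_eq_zero_of_eventuallyEq ?_
    filter_upwards [(G.isCompact_region ℓ P).isClosed.isOpen_compl.mem_nhds hx'] with y hy
    exact hu y fun h => hy (interior_subset h)
  rw [h0]
  simp

section FiniteDimensional

variable (G) in
/-- The function with given coefficients on every cell of the fine mesh. -/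
noncomputable def assemble : (G.fineMesh → Finset (Fin d) → ℝ) →ₗ[ℝ] (E d → ℝ) where
  toFun c x := if h : G.idx G.fineSize x ∈ G.fineMesh then
    q1Poly (c ⟨G.idx G.fineSize x, h⟩) x else 0
  map_add' c c' := by
    funext x
    by_cases h : G.idx G.fineSize x ∈ G.fineMesh
    · simp [h, q1Poly, add_mul, Finset.sum_add_distrib]
    · simp [h]
  map_smul' r c := by
    funext x
    by_cases h : G.idx G.fineSize x ∈ G.fineMesh
    · simp [h, q1Poly, Finset.mul_sum, mul_assoc]
    · simp [h]

/-- A finite element function is determined by its polynomial coefficients on the finitely many fine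
cells of `Ω`; this is what makes `G.FE` finite-dimensional. -/
theorem FE_le_range_assemble : G.FE ≤ LinearMap.range (assemble G) := by
  intro v hv
  choose c hc using hv.2.2
  refine ⟨fun τ => c τ, funext fun x => ?_⟩
  have hx := G.idx_mem_cube G.fineSize_pos x
  by_cases h : G.idx G.fineSize x ∈ G.fineMesh
  · simp only [assemble, LinearMap.coe_mk, AddHom.coe_mk, h, dite_true]
    exact (hc _ x hx).symm
  · simp only [assemble, LinearMap.coe_mk, AddHom.coe_mk, h, dite_false]
    refine (G.eq_zero_on_fineElem hv.1 (fun y hy => FE.eq_zero hv fun hΩ => h ?_) x hx).symm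
    rwa [G.mem_Ω_iff_fine (G.notMem_skel_of_mem_openCube G.fineSize_pos hy),
      G.idx_eq_of_mem_openCube G.fineSize_pos hy] at hΩ

instance : FiniteDimensional ℝ G.FE := Submodule.finiteDimensional_of_le FE_le_range_assemble

end FiniteDimensional

/-! ### Discrete solution operator -/

section Solve

variable {ℓ : ℕ} {P : Finset (Cell d)} {g : E d → ℝ}

theorem FE.integrable_mul (hg : Measurable g) {C : ℝ} (hC : ∀ x, |g x| ≤ C) (hw : w ∈ G.FE) :
    Integrable fun x => g x * w x := by
  obtain ⟨C', hC'⟩ := FE.exists_bound hw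
  refine integrable_of_bounded_of_eq_zero (G := G) (hg.mul (FE.continuous hw).measurable)
    (C := C * C') (fun x => ?_) fun x hx => by rw [FE.eq_zero hw hx, mul_zero]
  rw [abs_mul]
  exact mul_le_mul (hC x) (hC' x) (abs_nonneg _) ((abs_nonneg _).trans (hC x))

/-- The map from the local space to its dual defined by the energy is injective by definiteness,
hence surjective in finite dimension. Existence is what gives content to the choice operator in
`solve`. -/
theorem exists_solve (hd : 1 ≤ d) (hα : 0 < α) (hαβ : α ≤ β) (hA : IsCoefficient G.Ω α β A)
    (hℓ : ℓ ≤ G.L) (hP : P ⊆ G.mesh ℓ) (hg : Measurable g) {C : ℝ} (hC : ∀ x, |g x| ≤ C) :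
    ∃ u, u ∈ G.femSpace (G.region ℓ P) ∧ ∀ w ∈ G.femSpace (G.region ℓ P),
      aForm A (G.region ℓ P) u w = ∫ x in G.region ℓ P, g x * w x := by
  set V := G.femSub (G.region ℓ P) with hV
  have hle : V ≤ G.FE := fun v hv => G.mem_FE_of_mem_femSpace hℓ hP hv
  have : FiniteDimensional ℝ V := Submodule.finiteDimensional_of_le hle
  let B : V →ₗ[ℝ] Module.Dual ℝ V :=
    (energy hα hαβ hA).compl₁₂ (Submodule.inclusion hle) (Submodule.inclusion hle)
  have hB : ∀ u w : V, B u w = aForm A G.Ω u w := fun u w => rfl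
  have hinj : Function.Injective B := by
    rw [← LinearMap.ker_eq_bot, LinearMap.ker_eq_bot']
    intro u hu
    have h1 : B u u = 0 := by rw [hu]; rfl
    rw [hB] at h1
    exact Subtype.ext (FE.eq_zero_of_aForm_eq_zero hd hα hαβ hA (hle u.2) h1)
  have hsurj : Function.Surjective B :=
    (LinearMap.injective_iff_surjective_of_finrank_eq_finrank
      Subspace.dual_finrank_eq.symm).1 hinj
  let φ : Module.Dual ℝ V :=
    { toFun := fun w => ∫ x in G.region ℓ P, g x * (w : E d → ℝ) x
      map_add' := fun w₁ w₂ => by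
        rw [← integral_add (FE.integrable_mul hg hC (hle w₁.2)).integrableOn
          (FE.integrable_mul hg hC (hle w₂.2)).integrableOn]
        exact integral_congr_ae (Filter.Eventually.of_forall fun x => mul_add _ _ _)
      map_smul' := fun r w => by
        rw [RingHom.id_apply, ← integral_smul]
        exact integral_congr_ae (Filter.Eventually.of_forall fun x => mul_left_comm _ _ _) }
  obtain ⟨u, hu⟩ := hsurj φ
  refine ⟨u, u.2, fun w hw => ?_⟩
  rw [aForm_region_eq hℓ hP u.2.2.1]
  exact (hB u ⟨w, hw⟩).symm.trans (by rw [hu]; rfl)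

theorem solve_spec (hd : 1 ≤ d) (hα : 0 < α) (hαβ : α ≤ β) (hA : IsCoefficient G.Ω α β A)
    (hℓ : ℓ ≤ G.L) (hP : P ⊆ G.mesh ℓ) (hg : Measurable g) {C : ℝ} (hC : ∀ x, |g x| ≤ C) :
    G.solve A (G.region ℓ P) g ∈ G.femSpace (G.region ℓ P) ∧
      ∀ w ∈ G.femSpace (G.region ℓ P),
        aForm A G.Ω (G.solve A (G.region ℓ P) g) w = ∫ x in G.region ℓ P, g x * w x := by
  have h : G.solve A (G.region ℓ P) g ∈ G.femSpace (G.region ℓ P) ∧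
      ∀ w ∈ G.femSpace (G.region ℓ P), aForm A (G.region ℓ P) (G.solve A (G.region ℓ P) g) w =
        ∫ x in G.region ℓ P, g x * w x :=
    Classical.epsilon_spec (exists_solve hd hα hαβ hA hℓ hP hg hC)
  refine ⟨h.1, fun w hw => ?_⟩
  rw [← aForm_region_eq hℓ hP h.1.2.1]
  exact h.2 w hw

end Solve

end MeshHierarchy

namespace MeshHierarchy

variable {d : ℕ} {G : MeshHierarchy d} {A : E d → Matrix (Fin d) (Fin d) ℝ} {α β : ℝ}
  {v w : E d → ℝ} {ℓ : ℕ} {P : Finset (Cell d)}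

/-! ### Element means -/

section Means

theorem mean_eq (K : Cell d) (v : E d → ℝ) :
    G.mean ℓ K v = (G.size ℓ ^ d)⁻¹ * ∫ x in G.elem ℓ K, v x := by
  rw [mean, setAverage_eq, elem, G.volume_real_cube (G.size_pos ℓ), smul_eq_mul]

theorem size_pow_mul_mean (K : Cell d) (v : E d → ℝ) :
    G.size ℓ ^ d * G.mean ℓ K v = ∫ x in G.elem ℓ K, v x := by
  rw [mean_eq, ← mul_assoc, mul_inv_cancel₀ (pow_pos (G.size_pos ℓ) d).ne', one_mul]

theorem FE.integrable (hv : v ∈ G.FE) : Integrable v := by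
  obtain ⟨C, hC⟩ := FE.exists_bound hv
  exact integrable_of_bounded_of_eq_zero (FE.continuous hv).measurable hC fun x hx =>
    FE.eq_zero hv hx

variable (G ℓ) in
/-- The mean value on an element, as a linear functional on the finite element space. -/
noncomputable def meanL (K : Cell d) : G.FE →ₗ[ℝ] ℝ where
  toFun v := G.mean ℓ K v
  map_add' u v := by
    rw [mean_eq, mean_eq, mean_eq, ← mul_add, ← integral_add (FE.integrable u.2).integrableOn
      (FE.integrable v.2).integrableOn]
    rfl
  map_smul' r v := by
    rw [mean_eq, mean_eq, RingHom.id_apply, smul_eq_mul, mul_left_comm]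
    congr 1
    exact integral_const_mul r _

theorem mean_eq_zero_of_notMem {K : Cell d} (hK : K ∉ P)
    (hv : ∀ x ∉ interior (G.region ℓ P), v x = 0) : G.mean ℓ K v = 0 := by
  rw [mean_eq, setIntegral_eq_zero_of_ae_eq_zero, mul_zero]
  filter_upwards [G.ae_notMem_skel (G.size ℓ)] with x hx hxK
  refine hv x fun h => hK ?_
  rw [G.mem_interior_region_iff hx] at h
  rwa [(G.mem_cube_iff (G.size_pos ℓ) hx K).1 hxK] at h

theorem integral_eq_sum_mesh {f : E d → ℝ} (hf : Integrable f) (h0 : ∀ x, x ∉ G.Ω → f x = 0)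
    (ℓ : ℕ) : ∫ x, f x = ∑ K ∈ G.mesh ℓ, ∫ x in G.elem ℓ K, f x := by
  rw [← setIntegral_eq_integral_of_forall_compl_eq_zero h0,
    ← setIntegral_congr_set (G.region_mesh_ae_eq ℓ)]
  exact G.setIntegral_biUnion_cube (G.size_pos ℓ) _ fun z _ => hf.integrableOn

theorem isFiniteMeasure_restrict_elem (K : Cell d) :
    IsFiniteMeasure (volume.restrict (G.elem ℓ K)) :=
  ⟨by rw [Measure.restrict_apply_univ]; exact G.volume_cube_lt_top K⟩

theorem FE.size_pow_mul_mean_sq_le (hv : v ∈ G.FE) (K : Cell d) :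
    G.size ℓ ^ d * G.mean ℓ K v ^ 2 ≤ ∫ x in G.elem ℓ K, v x ^ 2 := by
  obtain ⟨C, hC⟩ := FE.exists_bound hv
  have := isFiniteMeasure_restrict_elem (G := G) (ℓ := ℓ) K
  have h := sq_integral_le (μ := volume.restrict (G.elem ℓ K)) (FE.continuous hv).measurable hC
  have hs := pow_pos (G.size_pos ℓ) d
  rw [measureReal_restrict_apply_univ, elem, G.volume_real_cube (G.size_pos ℓ)] at h
  change (∫ x in G.elem ℓ K, v x) ^ 2 ≤ G.size ℓ ^ d * ∫ x in G.elem ℓ K, v x ^ 2 at h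
  rw [← size_pow_mul_mean] at h
  refine le_of_mul_le_mul_left ?_ hs
  calc _ = (G.size ℓ ^ d * G.mean ℓ K v) ^ 2 := by ring
    _ ≤ _ := h

/-- The `L²`-projection onto piecewise constants is a contraction. -/
theorem FE.sum_mean_sq_le (hv : v ∈ G.FE) (ℓ : ℕ) :
    G.size ℓ ^ d * ∑ K ∈ G.mesh ℓ, G.mean ℓ K v ^ 2 ≤ ∫ x, v x ^ 2 := by
  rw [integral_eq_sum_mesh (FE.integrable_sq hv)
    (fun x hx => by rw [FE.eq_zero hv hx]; norm_num) ℓ, Finset.mul_sum]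
  exact Finset.sum_le_sum fun K _ => FE.size_pow_mul_mean_sq_le hv K

/-- Poincaré's inequality for functions with vanishing means on the elements of level `ℓ`. -/
theorem FE.poincare (hv : v ∈ G.FE) (h0 : ∀ T ∈ G.mesh ℓ, G.mean ℓ T v = 0) :
    ∫ x, v x ^ 2 ≤ (G.size ℓ / Real.pi) ^ 2 * ∑ k, ∫ x, G.pderiv v k x ^ 2 := by
  have h1 : ∀ k, ∫ x, G.pderiv v k x ^ 2 =
      ∑ K ∈ G.mesh ℓ, ∫ x in G.elem ℓ K, G.pderiv v k x ^ 2 := fun k =>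
    integral_eq_sum_mesh (FE.integrable_pderiv_sq hv k) (fun x hx => by
      rw [pderiv, Set.indicator_of_notMem fun h => hx h.1]; norm_num) ℓ
  rw [integral_eq_sum_mesh (FE.integrable_sq hv)
    (fun x hx => by rw [FE.eq_zero hv hx]; norm_num) ℓ]
  simp only [h1]
  rw [Finset.sum_comm, Finset.mul_sum]
  refine Finset.sum_le_sum fun K hK => FE.poincare_cube hv (G.size_pos ℓ) K ?_
  have := size_pow_mul_mean (G := G) (ℓ := ℓ) K v
  rw [h0 K hK, mul_zero] at this
  exact this.symm

theorem measurable_chi (K : Cell d) : Measurable (G.chi ℓ K) :=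
  measurable_const.indicator (G.isClosed_cube K).measurableSet

theorem abs_chi_le (K : Cell d) (x : E d) : |G.chi ℓ K x| ≤ 1 := by
  rw [chi]
  by_cases hx : x ∈ G.elem ℓ K
  · rw [Set.indicator_of_mem hx, abs_one]
  · rw [Set.indicator_of_notMem hx, abs_zero]; exact zero_le_one

theorem setIntegral_chi_mul {K : Cell d} (hK : K ∈ P) (w : E d → ℝ) :
    ∫ x in G.region ℓ P, G.chi ℓ K x * w x = G.size ℓ ^ d * G.mean ℓ K w := by
  rw [size_pow_mul_mean]
  have h1 : ∀ x, G.chi ℓ K x * w x = (G.elem ℓ K).indicator w x := fun x => by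
    rw [chi]
    by_cases hx : x ∈ G.elem ℓ K
    · rw [Set.indicator_of_mem hx, Set.indicator_of_mem hx, one_mul]
    · rw [Set.indicator_of_notMem hx, Set.indicator_of_notMem hx, zero_mul]
  simp only [h1]
  rw [setIntegral_indicator (show MeasurableSet (G.elem ℓ K) from (G.isClosed_cube K).measurableSet),
    Set.inter_eq_self_of_subset_right (G.elem_subset_region_iff.2 hK)]

end Means

/-! ### LOD functions: duality with the means and orthogonality -/

section LOD

theorem solve_chi_spec (hd : 1 ≤ d) (hα : 0 < α) (hαβ : α ≤ β) (hA : IsCoefficient G.Ω α β A)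
    (hℓ : ℓ ≤ G.L) (hP : P ⊆ G.mesh ℓ) {K : Cell d} (hK : K ∈ P) :
    G.solve A (G.region ℓ P) (G.chi ℓ K) ∈ G.femSpace (G.region ℓ P) ∧
      ∀ w ∈ G.femSpace (G.region ℓ P),
        aForm A G.Ω (G.solve A (G.region ℓ P) (G.chi ℓ K)) w = G.size ℓ ^ d * G.mean ℓ K w := by
  have h := solve_spec hd hα hαβ hA hℓ hP (measurable_chi (G := G) (ℓ := ℓ) K) (abs_chi_le K)
  exact ⟨h.1, fun w hw => (h.2 w hw).trans (setIntegral_chi_mul hK w)⟩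

theorem mem_of_mem_meshIn {K : Cell d} (hK : K ∈ G.meshIn ℓ (G.region ℓ P)) : K ∈ P := by
  simp only [meshIn, Finset.mem_filter, elem_subset_region_iff] at hK
  exact hK.2

/-- Up to the factor `H_ℓ^d`, both entries are the energy product of the solutions for `χ_K` and
`χ_K'`. -/
theorem dMat_symm (hd : 1 ≤ d) (hα : 0 < α) (hαβ : α ≤ β) (hA : IsCoefficient G.Ω α β A)
    (hℓ : ℓ ≤ G.L) (hP : P ⊆ G.mesh ℓ) (K K' : G.meshIn ℓ (G.region ℓ P)) :
    G.dMat A ℓ (G.region ℓ P) K K' = G.dMat A ℓ (G.region ℓ P) K' K := by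
  have h1 := solve_chi_spec hd hα hαβ hA hℓ hP (mem_of_mem_meshIn K.2)
  have h2 := solve_chi_spec hd hα hαβ hA hℓ hP (mem_of_mem_meshIn K'.2)
  have h3 := h1.2 _ h2.1
  have h4 := h2.2 _ h1.1
  rw [aForm_comm hα hA, h4] at h3
  exact (mul_left_cancel₀ (pow_pos (G.size_pos ℓ) d).ne' h3).symm

/-- The right-hand side is piecewise constant, so the test function enters only through its means.
This is the source of the orthogonality used below. -/
theorem psiLOD_spec (hd : 1 ≤ d) (hα : 0 < α) (hαβ : α ≤ β) (hA : IsCoefficient G.Ω α β A)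
    (hℓ : ℓ ≤ G.L) (hP : P ⊆ G.mesh ℓ) (K : G.meshIn ℓ (G.region ℓ P)) :
    G.psiLOD A ℓ (G.region ℓ P) K ∈ G.femSpace (G.region ℓ P) ∧
      ∀ w ∈ G.femSpace (G.region ℓ P), aForm A G.Ω (G.psiLOD A ℓ (G.region ℓ P) K) w =
        G.size ℓ ^ d * ∑ τ, (G.dMat A ℓ (G.region ℓ P))⁻¹ τ K * G.mean ℓ τ w := by
  have hm : Measurable (G.gLOD A ℓ (G.region ℓ P) K) :=
    Finset.measurable_fun_sum _ fun τ _ => (measurable_chi _).const_mul _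
  have hb : ∀ x, |G.gLOD A ℓ (G.region ℓ P) K x| ≤
      ∑ τ, |(G.dMat A ℓ (G.region ℓ P))⁻¹ τ K| := fun x => by
    refine (Finset.abs_sum_le_sum_abs _ _).trans (Finset.sum_le_sum fun τ _ => ?_)
    rw [abs_mul]
    exact mul_le_of_le_one_right (abs_nonneg _) (abs_chi_le _ _)
  have h := solve_spec hd hα hαβ hA hℓ hP hm hb
  refine ⟨h.1, fun w hw => (h.2 w hw).trans ?_⟩
  have hwF := G.mem_FE_of_mem_femSpace hℓ hP hw
  simp only [gLOD, Finset.sum_mul, mul_assoc]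
  rw [integral_finsetSum _ fun τ _ => Integrable.const_mul
    (FE.integrable_mul (measurable_chi _) (abs_chi_le _) hwF).integrableOn _, Finset.mul_sum]
  refine Finset.sum_congr rfl fun τ _ => ?_
  rw [integral_const_mul, setIntegral_chi_mul (mem_of_mem_meshIn τ.2)]
  ring

/-- Evaluate the energy product of `𝒜⁻¹ χ_K'` with `ψ_K` in two ways: one gives the mean sought, the
other the `(K', K)` entry of `𝒟 𝒟⁻¹`, by symmetry of `𝒟`. -/
theorem mean_psiLOD (hd : 1 ≤ d) (hα : 0 < α) (hαβ : α ≤ β) (hA : IsCoefficient G.Ω α β A)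
    (hℓ : ℓ ≤ G.L) (hP : P ⊆ G.mesh ℓ) (hdet : IsUnit (G.dMat A ℓ (G.region ℓ P)).det)
    (K K' : G.meshIn ℓ (G.region ℓ P)) :
    G.mean ℓ K' (G.psiLOD A ℓ (G.region ℓ P) K) = if K' = K then 1 else 0 := by
  have h1 := solve_chi_spec hd hα hαβ hA hℓ hP (mem_of_mem_meshIn K'.2)
  have h2 := psiLOD_spec hd hα hαβ hA hℓ hP K
  have h3 := h1.2 _ h2.1
  rw [aForm_comm hα hA, h2.2 _ h1.1] at h3
  rw [← mul_left_cancel₀ (pow_pos (G.size_pos ℓ) d).ne' h3]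
  have h4 := congrFun (congrFun (Matrix.mul_nonsing_inv _ hdet) K') K
  rw [Matrix.mul_apply, Matrix.one_apply] at h4
  rw [← h4]
  refine Finset.sum_congr rfl fun τ _ => ?_
  rw [mul_comm, dMat_symm hd hα hαβ hA hℓ hP K' τ]
  rfl

/-- The energy form vanishes on `ψ_K` if the matrix of `𝒟` is singular. -/
theorem psiLOD_eq_zero_of_not_isUnit (hd : 1 ≤ d) (hα : 0 < α) (hαβ : α ≤ β)
    (hA : IsCoefficient G.Ω α β A) (hℓ : ℓ ≤ G.L) (hP : P ⊆ G.mesh ℓ)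
    (hdet : ¬ IsUnit (G.dMat A ℓ (G.region ℓ P)).det) (K : G.meshIn ℓ (G.region ℓ P)) :
    G.psiLOD A ℓ (G.region ℓ P) K = 0 := by
  have h := psiLOD_spec hd hα hαβ hA hℓ hP K
  refine FE.eq_zero_of_aForm_eq_zero hd hα hαβ hA (G.mem_FE_of_mem_femSpace hℓ hP h.1) ?_
  -- The inverse of a singular matrix is zero by convention, so the right-hand side vanishes.
  rw [h.2 _ h.1, Matrix.nonsing_inv_apply_not_isUnit _ hdet]
  simp

theorem thetaRaw_eq_sum {ω : Set (E d)} (T : G.meshIn ℓ ω)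
    (c : {K : G.meshIn ℓ ω // K ≠ T} → ℝ) :
    G.thetaRaw A ℓ ω T c = G.psiLOD A ℓ ω T + ∑ K, c K • G.psiLOD A ℓ ω K.1 := by
  funext x
  simp [thetaRaw]

theorem thetaRaw_mem (hd : 1 ≤ d) (hα : 0 < α) (hαβ : α ≤ β)
    (hA : IsCoefficient G.Ω α β A) (hℓ : ℓ ≤ G.L) (hP : P ⊆ G.mesh ℓ)
    (T : G.meshIn ℓ (G.region ℓ P)) (c : {K : G.meshIn ℓ (G.region ℓ P) // K ≠ T} → ℝ) :
    G.thetaRaw A ℓ (G.region ℓ P) T c ∈ G.femSpace (G.region ℓ P) := by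
  rw [thetaRaw_eq_sum]
  exact (G.femSub _).add_mem (psiLOD_spec hd hα hαβ hA hℓ hP T).1 ((G.femSub _).sum_mem
    fun K _ => (G.femSub _).smul_mem _ (psiLOD_spec hd hα hαβ hA hℓ hP K.1).1)

/-- `𝜓_K` is orthogonal to the finite element functions with vanishing means. -/
theorem aForm_thetaRaw_eq_zero (hd : 1 ≤ d) (hα : 0 < α) (hαβ : α ≤ β)
    (hA : IsCoefficient G.Ω α β A) (hℓ : ℓ ≤ G.L) (hP : P ⊆ G.mesh ℓ)
    (T : G.meshIn ℓ (G.region ℓ P)) (c : {K : G.meshIn ℓ (G.region ℓ P) // K ≠ T} → ℝ)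
    (hw : w ∈ G.femSpace (G.region ℓ P)) (h0 : ∀ K ∈ P, G.mean ℓ K w = 0) :
    aForm A G.Ω (G.thetaRaw A ℓ (G.region ℓ P) T c) w = 0 := by
  have hF : ∀ {u}, u ∈ G.femSpace (G.region ℓ P) → u ∈ G.FE :=
    fun hu => G.mem_FE_of_mem_femSpace hℓ hP hu
  have h1 : ∀ K, aForm A G.Ω (G.psiLOD A ℓ (G.region ℓ P) K) w = 0 := fun K => by
    rw [(psiLOD_spec hd hα hαβ hA hℓ hP K).2 w hw]
    simp [fun τ : G.meshIn ℓ (G.region ℓ P) => h0 τ (mem_of_mem_meshIn τ.2)]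
  have h2 : ∀ K, energy hα hαβ hA ⟨_, hF (psiLOD_spec hd hα hαβ hA hℓ hP K).1⟩ ⟨w, hF hw⟩ = 0 :=
    h1
  have h3 : (⟨_, hF (thetaRaw_mem hd hα hαβ hA hℓ hP T c)⟩ : G.FE) =
      ⟨_, hF (psiLOD_spec hd hα hαβ hA hℓ hP T).1⟩ +
        ∑ K, c K • ⟨_, hF (psiLOD_spec hd hα hαβ hA hℓ hP K.1).1⟩ := by
    apply Subtype.ext
    push_cast
    exact thetaRaw_eq_sum T c
  change energy hα hαβ hA ⟨_, hF (thetaRaw_mem hd hα hαβ hA hℓ hP T c)⟩ ⟨w, hF hw⟩ = 0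
  rw [h3]
  simp only [map_add, map_sum, map_smul, LinearMap.add_apply, LinearMap.sum_apply,
    LinearMap.smul_apply, h2, smul_zero, Finset.sum_const_zero, add_zero]

/-- The functions `ψ_K` with `K ≠ T` have mean zero on `T`; hence the value does not depend on the
correction coefficients. -/
theorem mean_thetaRaw (hd : 1 ≤ d) (hα : 0 < α) (hαβ : α ≤ β)
    (hA : IsCoefficient G.Ω α β A) (hℓ : ℓ ≤ G.L) (hP : P ⊆ G.mesh ℓ)
    (hdet : IsUnit (G.dMat A ℓ (G.region ℓ P)).det)
    (T : G.meshIn ℓ (G.region ℓ P)) (c : {K : G.meshIn ℓ (G.region ℓ P) // K ≠ T} → ℝ) :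
    G.mean ℓ T (G.thetaRaw A ℓ (G.region ℓ P) T c) = 1 := by
  have hF : ∀ K, G.psiLOD A ℓ (G.region ℓ P) K ∈ G.FE :=
    fun K => G.mem_FE_of_mem_femSpace hℓ hP (psiLOD_spec hd hα hαβ hA hℓ hP K).1
  have hm : ∀ K K' : G.meshIn ℓ (G.region ℓ P), meanL G ℓ K' ⟨_, hF K⟩ = if K' = K then 1 else 0 := fun K K' =>
    mean_psiLOD hd hα hαβ hA hℓ hP hdet K K'
  have h3 : (⟨_, G.mem_FE_of_mem_femSpace hℓ hP (thetaRaw_mem hd hα hαβ hA hℓ hP T c)⟩ : G.FE) =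
      ⟨_, hF T⟩ + ∑ K, c K • ⟨_, hF K.1⟩ := by
    apply Subtype.ext
    push_cast
    exact thetaRaw_eq_sum T c
  change meanL G ℓ T ⟨_, G.mem_FE_of_mem_femSpace hℓ hP (thetaRaw_mem hd hα hαβ hA hℓ hP T c)⟩ = 1
  rw [h3]
  simp only [map_add, map_sum, map_smul, hm, if_true]
  rw [Finset.sum_eq_zero fun K _ => by rw [if_neg (Ne.symm K.2), smul_zero], add_zero]

end LOD

end MeshHierarchy

/-! ### Bubble functions with controlled energy -/

section Trapezoid

/-- Trapezoidal bump on `[a, a + H]` with slopes `±1` and plateau of height `m`. -/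
def trapezoid (a H m t : ℝ) : ℝ := max 0 (min (min (t - a) (a + H - t)) m)

variable {a H m : ℝ}

theorem continuous_trapezoid : Continuous (trapezoid a H m) := by
  unfold trapezoid; fun_prop

theorem trapezoid_nonneg (t : ℝ) : 0 ≤ trapezoid a H m t := le_max_left _ _

theorem trapezoid_le (hm : 0 ≤ m) (t : ℝ) : trapezoid a H m t ≤ m :=
  max_le hm (min_le_right _ _)

theorem trapezoid_eq_zero {t : ℝ} (h : t ≤ a ∨ a + H ≤ t) : trapezoid a H m t = 0 := by
  refine max_eq_left ?_
  rcases h with h | h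
  · exact (min_le_left _ _).trans ((min_le_left _ _).trans (by linarith))
  · exact (min_le_left _ _).trans ((min_le_right _ _).trans (by linarith))

theorem le_trapezoid {t r : ℝ} (h1 : r ≤ t - a) (h2 : r ≤ a + H - t) (h3 : r ≤ m) :
    r ≤ trapezoid a H m t :=
  (le_min (le_min h1 h2) h3).trans (le_max_right _ _)

theorem abs_trapezoid_sub_le (s t : ℝ) :
    |trapezoid a H m s - trapezoid a H m t| ≤ |s - t| := by
  refine (abs_max_sub_max_le_max _ _ _ _).trans (max_le (by simp) ?_)
  refine (abs_min_sub_min_le_max _ _ _ _).trans (max_le ?_ (by simp))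
  refine (abs_min_sub_min_le_max _ _ _ _).trans (max_le (le_of_eq ?_) (le_of_eq ?_))
  · congr 1; ring
  · rw [← abs_neg]; congr 1; ring

/-- If the breakpoints are grid points, the bump is affine on the cells of the grid. -/
theorem exists_trapezoid_eq_affine {h : ℝ} (hh : 0 < h) {N M : ℕ} (hNM : 2 * M ≤ N) (j : ℤ) :
    ∃ p q : ℝ, ∀ t, a + h * j ≤ t → t ≤ a + h * (j + 1) →
      trapezoid a (N * h) (M * h) t = p + q * t := by
  have hM : (2 * M : ℝ) ≤ N := by exact_mod_cast hNM
  have hM0 : (0 : ℝ) ≤ M := Nat.cast_nonneg M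
  -- Five positions of the grid cell: before the bump, on the rising edge, on the plateau, on the
  -- falling edge, and after it, separated by `0`, `M`, `N - M`, `N`.
  rcases lt_or_ge j 0 with h0 | h0
  · refine ⟨0, 0, fun t h1 h2 => ?_⟩
    have h3 : (j : ℝ) + 1 ≤ 0 := by exact_mod_cast h0
    rw [trapezoid_eq_zero (Or.inl (by nlinarith))]; ring
  have h0' : (0 : ℝ) ≤ j := by exact_mod_cast h0
  rcases lt_or_ge j M with h4 | h4
  · refine ⟨-a, 1, fun t h1 h2 => ?_⟩
    have h3 : (j : ℝ) + 1 ≤ M := by exact_mod_cast h4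
    have h5 : t - a ≤ M * h := by nlinarith
    have h6 : t - a ≤ a + N * h - t := by nlinarith
    rw [trapezoid, min_eq_left h6, min_eq_left h5, max_eq_right (by nlinarith)]; ring
  have h4' : (M : ℝ) ≤ j := by exact_mod_cast h4
  rcases lt_or_ge j (N - M) with h7 | h7
  · refine ⟨M * h, 0, fun t h1 h2 => ?_⟩
    have h3 : (j : ℝ) + 1 ≤ N - M := by exact_mod_cast h7
    rw [trapezoid, min_eq_right (le_min (by nlinarith) (by nlinarith)),
      max_eq_right (by positivity)]
    ring
  have h7' : (N : ℝ) - M ≤ j := by exact_mod_cast h7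
  rcases lt_or_ge j N with h8 | h8
  · refine ⟨a + N * h, -1, fun t h1 h2 => ?_⟩
    have h3 : (j : ℝ) + 1 ≤ N := by exact_mod_cast h8
    have h5 : a + N * h - t ≤ M * h := by nlinarith
    have h6 : a + N * h - t ≤ t - a := by nlinarith
    rw [trapezoid, min_eq_right h6, min_eq_left h5, max_eq_right (by nlinarith)]; ring
  · refine ⟨0, 0, fun t h1 h2 => ?_⟩
    have h3 : (N : ℝ) ≤ j := by exact_mod_cast h8
    rw [trapezoid_eq_zero (Or.inr (by nlinarith))]; ring

end Trapezoid

/-- Expanding the product over the subsets of coordinates in which the linear term is taken yields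
the coefficients. -/
theorem isQ1On_prod_affine {d : ℕ} {K : Set (E d)} (p q : Fin d → ℝ) :
    IsQ1On K fun x => ∏ k, (p k + q k * x k) := by
  classical
  refine ⟨fun s => (∏ k ∈ s, q k) * ∏ k ∈ sᶜ, p k, fun x _ => ?_⟩
  have h := Finset.prod_add (fun k => q k * x k) p Finset.univ
  simp only [add_comm (p _)]
  rw [h, Finset.powerset_univ]
  refine Finset.sum_congr rfl fun s _ => ?_
  rw [Finset.prod_mul_distrib, Finset.compl_eq_univ_sdiff]
  ring

namespace MeshHierarchy

variable {d : ℕ} {G : MeshHierarchy d} {A : E d → Matrix (Fin d) (Fin d) ℝ} {α β : ℝ}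
  {ℓ : ℕ} {P : Finset (Cell d)}

variable (G) in
/-- Tensor product bump function supported in the element `K` of level `ℓ`. -/
noncomputable def bump (ℓ : ℕ) (K : Cell d) (x : E d) : ℝ :=
  ∏ k, trapezoid (G.origin k + G.size ℓ * K k) (G.size ℓ)
    ((G.ratio ℓ / 2 : ℕ) * G.fineSize) (x k)

theorem half_ratio_mul_le (hℓ : ℓ ≤ G.L) :
    ((G.ratio ℓ / 2 : ℕ) : ℝ) * G.fineSize ≤ G.size ℓ := by
  rw [G.size_eq_ratio_mul hℓ]
  have : (G.ratio ℓ / 2 : ℕ) ≤ G.ratio ℓ := Nat.div_le_self _ _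
  exact mul_le_mul_of_nonneg_right (by exact_mod_cast this) G.fineSize_pos.le

/-- This is where `n ≥ 2` matters: `⌊r/2⌋ ≥ r/3` holds for integers `r ≥ 2`, whereas for `r = 1` the
bump would be zero. -/
theorem third_size_le (hℓ : ℓ ≤ G.L) :
    G.size ℓ / 3 ≤ ((G.ratio ℓ / 2 : ℕ) : ℝ) * G.fineSize := by
  have h1 : G.ratio ℓ ≤ 3 * (G.ratio ℓ / 2) := by have := G.two_le_ratio ℓ; omega
  have h2 : (G.ratio ℓ : ℝ) ≤ 3 * (G.ratio ℓ / 2 : ℕ) := by exact_mod_cast h1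
  have := G.fineSize_pos
  rw [G.size_eq_ratio_mul hℓ]
  nlinarith

theorem continuous_bump (K : Cell d) : Continuous (G.bump ℓ K) :=
  continuous_finsetProd _ fun k _ => continuous_trapezoid.comp (continuous_coord k)

theorem bump_nonneg (K : Cell d) (x : E d) : 0 ≤ G.bump ℓ K x :=
  Finset.prod_nonneg fun _ _ => trapezoid_nonneg _

theorem bump_mem (hℓ : ℓ ≤ G.L) {K : Cell d} (hK : K ∈ P) :
    G.bump ℓ K ∈ G.femSpace (G.region ℓ P) := by
  refine ⟨continuous_bump K, fun x hx => ?_, fun τ _ _ => ?_⟩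
  · have hx' : x ∉ G.openCube (G.size ℓ) K :=
      fun h => hx (G.openCube_subset_interior_region hK h)
    simp only [openCube, Set.mem_ofPred_eq, not_forall] at hx'
    obtain ⟨k, hk⟩ := hx'
    refine Finset.prod_eq_zero (Finset.mem_univ k) (trapezoid_eq_zero ?_)
    rw [not_and_or, not_lt, not_lt, mul_add, mul_one, ← add_assoc] at hk
    exact hk
  · have h : ∀ k, ∃ p q : ℝ, ∀ t, G.origin k + G.fineSize * τ k ≤ t →
        t ≤ G.origin k + G.fineSize * (τ k + 1) →
        trapezoid (G.origin k + G.size ℓ * K k) (G.size ℓ)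
          ((G.ratio ℓ / 2 : ℕ) * G.fineSize) t = p + q * t := by
      intro k
      -- The last argument is the position of the fine cell counted from the left end of the element
      -- `K`.
      obtain ⟨p, q, h⟩ := exists_trapezoid_eq_affine (a := G.origin k + G.size ℓ * K k)
        G.fineSize_pos (N := G.ratio ℓ) (M := G.ratio ℓ / 2) (by omega)
        (τ k - G.ratio ℓ * K k)
      refine ⟨p, q, fun t h1 h2 => ?_⟩
      rw [← h t, ← G.size_eq_ratio_mul hℓ]
      · rw [G.size_eq_ratio_mul hℓ]; push_cast; linarith
      · rw [G.size_eq_ratio_mul hℓ]; push_cast; linarith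
    choose p q hpq using h
    obtain ⟨c, hc⟩ := isQ1On_prod_affine (K := G.fineElem τ) p q
    refine ⟨c, fun x hx => ?_⟩
    rw [← hc x hx]
    exact Finset.prod_congr rfl fun k _ => hpq k _ (hx k).1 (hx k).2

/-- Along a coordinate line one factor is 1-Lipschitz and each of the other `d - 1` factors is at
most `H_ℓ`. -/
theorem abs_grad_bump_le (hℓ : ℓ ≤ G.L) {K : Cell d} (hK : K ∈ G.mesh ℓ) {x : E d}
    (hx : x ∉ G.skel G.fineSize) (k : Fin d) :
    |grad (G.bump ℓ K) x k| ≤ G.size ℓ ^ (d - 1) := by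
  have hF : G.bump ℓ K ∈ G.FE := G.mem_FE_of_mem_femSpace hℓ (Finset.singleton_subset_iff.2 hK)
    (bump_mem hℓ (Finset.mem_singleton_self K))
  have hxx : (WithLp.toLp 2 (Function.update x.ofLp k (x k)) : E d) = x := by
    rw [Function.update_eq_self]
  have hd := FE.hasDerivAt_line hF (x := x.ofLp) (k := k) (t := x k) (by rwa [hxx])
  rw [hxx, FE.pderiv_eq hF hx] at hd
  refine hd.hasFDerivAt.le_of_lip' (C := G.size ℓ ^ (d - 1)) (pow_nonneg (G.size_pos ℓ).le _)
    (Filter.Eventually.of_forall fun s => ?_) |>.trans_eq' ?_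
  · have hprod : ∀ s, G.bump ℓ K (WithLp.toLp 2 (Function.update x.ofLp k s)) =
        trapezoid (G.origin k + G.size ℓ * K k) (G.size ℓ)
          ((G.ratio ℓ / 2 : ℕ) * G.fineSize) s *
        ∏ j ∈ Finset.univ.erase k, trapezoid (G.origin j + G.size ℓ * K j) (G.size ℓ)
          ((G.ratio ℓ / 2 : ℕ) * G.fineSize) (x j) := by
      intro s
      rw [bump, ← Finset.mul_prod_erase _ _ (Finset.mem_univ k)]
      congr 1
      · simp
      · refine Finset.prod_congr rfl fun j hj => ?_
        simp [Finset.ne_of_mem_erase hj]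
    rw [hprod, hprod, ← sub_mul, norm_mul, mul_comm]
    refine mul_le_mul ?_ (abs_trapezoid_sub_le _ _) (abs_nonneg _)
      (pow_nonneg (G.size_pos ℓ).le _)
    rw [Real.norm_eq_abs, abs_of_nonneg (Finset.prod_nonneg fun _ _ => trapezoid_nonneg _)]
    refine (Finset.prod_le_prod (fun _ _ => trapezoid_nonneg _) fun j _ =>
      (trapezoid_le (mul_nonneg (Nat.cast_nonneg _) G.fineSize_pos.le) _).trans
        (half_ratio_mul_le hℓ)).trans ?_
    rw [Finset.prod_const, Finset.card_erase_of_mem (Finset.mem_univ k), Finset.card_univ,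
      Fintype.card_fin]
  · rw [← Real.norm_eq_abs]; simp

/-- On the central cube of side `H/3`, which has index `3K + 1` in the grid of that size, every
factor is at least `H/3`. Its integral there, divided by `H^d`, gives `(H/9)^d`. -/
theorem le_mean_bump (hℓ : ℓ ≤ G.L) (K : Cell d) : (G.size ℓ / 9) ^ d ≤ G.mean ℓ K (G.bump ℓ K) := by
  have hH := G.size_pos ℓ
  have hsub : G.cube (G.size ℓ / 3) (fun k => 3 * K k + 1) ⊆ G.elem ℓ K := fun x hx k => by
    have := hx k
    push_cast at this
    constructor <;> linarith [this.1, this.2]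
  have hi : IntegrableOn (G.bump ℓ K) (G.elem ℓ K) :=
    (continuous_bump K).continuousOn.integrableOn_compact (G.isCompact_cube K)
  have h1 : (G.size ℓ / 3) ^ d * (G.size ℓ / 3) ^ d ≤ ∫ x in G.elem ℓ K, G.bump ℓ K x := by
    calc (G.size ℓ / 3) ^ d * (G.size ℓ / 3) ^ d
        = ∫ _x in G.cube (G.size ℓ / 3) (fun k => 3 * K k + 1), (G.size ℓ / 3) ^ d := by
          rw [setIntegral_const, G.volume_real_cube (by positivity), smul_eq_mul]
      _ ≤ ∫ x in G.cube (G.size ℓ / 3) (fun k => 3 * K k + 1), G.bump ℓ K x := by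
          refine setIntegral_mono_on (integrableOn_const (G.volume_cube_lt_top _).ne)
            (hi.mono_set hsub) (G.isClosed_cube _).measurableSet fun x hx => ?_
          calc (G.size ℓ / 3) ^ d = ∏ _k : Fin d, G.size ℓ / 3 := by
                rw [Finset.prod_const, Finset.card_univ, Fintype.card_fin]
            _ ≤ _ := Finset.prod_le_prod (fun _ _ => by positivity) fun k _ => by
                have := hx k
                push_cast at this
                exact le_trapezoid (by linarith [this.1]) (by linarith [this.2])
                  (third_size_le hℓ)
      _ ≤ _ := setIntegral_mono_set hi (Filter.Eventually.of_forall fun x => bump_nonneg K x)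
          hsub.eventuallyLE
  rw [← size_pow_mul_mean, ← mul_pow] at h1
  refine le_of_mul_le_mul_left (le_trans (le_of_eq ?_) h1) (pow_pos hH d)
  rw [← mul_pow]
  congr 1
  ring

theorem aForm_bump_le (hα : 0 < α) (hαβ : α ≤ β) (hA : IsCoefficient G.Ω α β A)
    (hℓ : ℓ ≤ G.L) {K : Cell d} (hK : K ∈ G.mesh ℓ) :
    aForm A G.Ω (G.bump ℓ K) (G.bump ℓ K) ≤
      β * (d * (G.size ℓ ^ (d - 1)) ^ 2) * G.size ℓ ^ d := by
  have hP : ({K} : Finset (Cell d)) ⊆ G.mesh ℓ := Finset.singleton_subset_iff.2 hK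
  have hb := bump_mem (G := G) hℓ (Finset.mem_singleton_self K)
  have hF := G.mem_FE_of_mem_femSpace hℓ hP hb
  have hβ : 0 ≤ β := hα.le.trans hαβ
  have hsub := G.interior_region_subset_Ω hP
  have hreg : G.region ℓ {K} = G.elem ℓ K := by simp [region]
  have hvol : volume (interior (G.region ℓ {K})) ≠ ⊤ :=
    ((measure_mono hsub).trans_lt G.volume_Ω_lt_top).ne
  rw [← aForm_region_eq hℓ hP hb.2.1, aForm, ← setIntegral_congr_set (G.interior_region_ae_eq ℓ _)]
  calc _ ≤ ∫ _x in interior (G.region ℓ {K}), β * (d * (G.size ℓ ^ (d - 1)) ^ 2) := by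
        refine integral_mono_ae ((FE.integrableOn_energy hα hαβ hA hF hF).mono_set hsub)
          (integrableOn_const hvol) ?_
        filter_upwards [ae_restrict_of_ae_restrict_of_subset hsub (ae_coefficient hα hA)]
          with x ⟨hx, _, _, hb⟩
        refine (hb _).2.trans (mul_le_mul_of_nonneg_left ?_ hβ)
        calc _ ≤ ∑ _k : Fin d, (G.size ℓ ^ (d - 1)) ^ 2 := Finset.sum_le_sum fun k _ => by
              rw [← sq]
              have := abs_le.1 (abs_grad_bump_le hℓ hK hx k)
              exact sq_le_sq' this.1 this.2
          _ = _ := by simp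
    _ ≤ _ := by
        rw [setIntegral_const, smul_eq_mul, mul_comm]
        refine mul_le_mul_of_nonneg_left ?_ (by positivity)
        rw [← G.volume_real_cube (G.size_pos ℓ) K]
        refine measureReal_mono (interior_subset.trans hreg.subset) (G.volume_cube_lt_top K).ne

/-- A finite element function supported in one element, with mean one and controlled energy. -/
theorem exists_bubble (hd : 1 ≤ d) (hα : 0 < α) (hαβ : α ≤ β) (hA : IsCoefficient G.Ω α β A)
    (hℓ : ℓ ≤ G.L) (hP : P ⊆ G.mesh ℓ) {K : Cell d} (hK : K ∈ P) :
    ∃ b ∈ G.femSpace (G.region ℓ P), (∀ K', G.mean ℓ K' b = if K' = K then 1 else 0) ∧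
      aForm A G.Ω b b ≤ d * 81 ^ d * β * (G.size ℓ ^ d / G.size ℓ ^ 2) := by
  have hH := G.size_pos ℓ
  have hm := le_mean_bump hℓ K
  set μ := G.mean ℓ K (G.bump ℓ K) with hμ
  have hμ0 : 0 < μ := lt_of_lt_of_le (by positivity) hm
  have hb := bump_mem hℓ hK
  have hbK := bump_mem (G := G) hℓ (Finset.mem_singleton_self K)
  have hF := G.mem_FE_of_mem_femSpace hℓ hP hb
  refine ⟨μ⁻¹ • G.bump ℓ K, (G.femSub _).smul_mem _ hb, fun K' => ?_, ?_⟩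
  · have h1 : G.mean ℓ K' (μ⁻¹ • G.bump ℓ K) = μ⁻¹ * G.mean ℓ K' (G.bump ℓ K) :=
      (meanL G ℓ K').map_smul μ⁻¹ ⟨_, hF⟩
    rw [h1]
    split_ifs with h
    · rw [h, ← hμ, inv_mul_cancel₀ hμ0.ne']
    · rw [mean_eq_zero_of_notMem (P := {K}) (by simpa using h) hbK.2.1, mul_zero]
  · have h1 : aForm A G.Ω (μ⁻¹ • G.bump ℓ K) (μ⁻¹ • G.bump ℓ K) =
        μ⁻¹ * (μ⁻¹ * aForm A G.Ω (G.bump ℓ K) (G.bump ℓ K)) := by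
      change energy hα hαβ hA (μ⁻¹ • ⟨_, hF⟩) (μ⁻¹ • ⟨_, hF⟩) = _
      rw [map_smul, map_smul, LinearMap.smul_apply, smul_eq_mul, smul_eq_mul]
      rfl
    have h2 := aForm_bump_le hα hαβ hA hℓ (hP hK)
    have hβ : 0 ≤ β := hα.le.trans hαβ
    have h3 : μ⁻¹ ≤ ((G.size ℓ / 9) ^ d)⁻¹ := inv_anti₀ (by positivity) hm
    have h4 : μ⁻¹ * μ⁻¹ ≤ ((G.size ℓ / 9) ^ d)⁻¹ * ((G.size ℓ / 9) ^ d)⁻¹ :=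
      mul_le_mul h3 h3 (by positivity) (by positivity)
    rw [h1, ← mul_assoc]
    refine (mul_le_mul h4 h2 (aForm_self_nonneg hα hA _) (by positivity)).trans (le_of_eq ?_)
    -- It remains to check `H^(2(d-1)) H^d / (H/9)^(2d) = 81^d H^(d-2)`; writing `d = n + 1` removes
    -- the truncated subtraction.
    obtain ⟨n, rfl⟩ : ∃ n, d = n + 1 := ⟨d - 1, by omega⟩
    rw [Nat.add_sub_cancel, div_pow, show (81 : ℝ) ^ (n + 1) = 9 ^ (n + 1) * 9 ^ (n + 1) by
      rw [← mul_pow]; norm_num]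
    field_simp
    ring

end MeshHierarchy

/-! ### Stable SLOD functions and their energy -/

namespace SLODFamily

variable {d : ℕ} {G : MeshHierarchy d} {A : E d → Matrix (Fin d) (Fin d) ℝ} {α β δs : ℝ}
  (F : SLODFamily G A δs) {ℓ : ℕ}

open MeshHierarchy

theorem slod_eq_smul (T : G.mesh ℓ) : F.slod ℓ T =
    (aNorm A (G.patchSet ℓ (F.m ℓ) T) (G.thetaRaw A ℓ (G.patchSet ℓ (F.m ℓ) T)
      (G.center ℓ (F.m ℓ) T) (F.corr ℓ T)))⁻¹ • G.thetaRaw A ℓ (G.patchSet ℓ (F.m ℓ) T)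
      (G.center ℓ (F.m ℓ) T) (F.corr ℓ T) := by
  funext x
  rw [slod, theta, Pi.smul_apply, smul_eq_mul, div_eq_inv_mul]

theorem slod_mem (hd : 1 ≤ d) (hα : 0 < α) (hαβ : α ≤ β) (hA : IsCoefficient G.Ω α β A)
    (hℓ : ℓ ≤ G.L) (T : G.mesh ℓ) :
    F.slod ℓ T ∈ G.femSpace (G.region ℓ (G.patch ℓ T (F.m ℓ))) := by
  rw [slod_eq_smul]
  exact (G.femSub _).smul_mem _
    (thetaRaw_mem hd hα hαβ hA hℓ (G.patch_subset_mesh T.2 _) (G.center ℓ (F.m ℓ) T) _)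

theorem slod_mem_FE (hd : 1 ≤ d) (hα : 0 < α) (hαβ : α ≤ β) (hA : IsCoefficient G.Ω α β A)
    (hℓ : ℓ ≤ G.L) (T : G.mesh ℓ) : F.slod ℓ T ∈ G.FE :=
  G.mem_FE_of_mem_femSpace hℓ (G.patch_subset_mesh T.2 _) (F.slod_mem hd hα hαβ hA hℓ T)

theorem combo_eq_sum (T : G.mesh ℓ) (c : G.mesh (ℓ + 1) → ℝ) :
    F.combo ℓ T c = ∑ K ∈ F.sSet ℓ T, c K • F.slod (ℓ + 1) K := by
  funext x
  simp [combo]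

theorem combo_mem_FE (hd : 1 ≤ d) (hα : 0 < α) (hαβ : α ≤ β) (hA : IsCoefficient G.Ω α β A)
    (hℓ : ℓ + 1 ≤ G.L) (T : G.mesh ℓ) (c : G.mesh (ℓ + 1) → ℝ) : F.combo ℓ T c ∈ G.FE := by
  rw [combo_eq_sum]
  exact G.FE.sum_mem fun K _ => G.FE.smul_mem _ (F.slod_mem_FE hd hα hαβ hA hℓ K)

end SLODFamily

namespace MeshHierarchy

variable {d : ℕ} {G : MeshHierarchy d} {A : E d → Matrix (Fin d) (Fin d) ℝ} {α β : ℝ} {ℓ : ℕ}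

/-- A function that is orthogonal to the functions with vanishing means has minimal energy among
the functions with the same means. -/
theorem aForm_le_of_orthogonal (hd : 1 ≤ d) (hα : 0 < α) (hαβ : α ≤ β)
    (hA : IsCoefficient G.Ω α β A) (hℓ : ℓ ≤ G.L) {P : Finset (Cell d)} (hP : P ⊆ G.mesh ℓ)
    {t : E d → ℝ} (ht : t ∈ G.femSpace (G.region ℓ P))
    (horth : ∀ w ∈ G.femSpace (G.region ℓ P), (∀ K ∈ P, G.mean ℓ K w = 0) → aForm A G.Ω t w = 0)
    (hmean : ∀ K ∈ P, |G.mean ℓ K t| ≤ 1) {N : ℕ} (hN : P.card ≤ N) :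
    aForm A G.Ω t t ≤ N ^ 2 * (d * 81 ^ d * β) * (G.size ℓ ^ d / G.size ℓ ^ 2) := by
  have hF : ∀ {u}, u ∈ G.femSpace (G.region ℓ P) → u ∈ G.FE :=
    fun hu => G.mem_FE_of_mem_femSpace hℓ hP hu
  have hβ : 0 ≤ β := hα.le.trans hαβ
  choose b hb hbm hbe using fun K : P => exists_bubble hd hα hαβ hA hℓ hP K.2
  set a := energy hα hαβ hA with ha
  let t' : G.FE := ⟨t, hF ht⟩
  let f : P → G.FE := fun K => G.mean ℓ K t • ⟨b K, hF (hb K)⟩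
  -- The competitor: the sum of bubbles that has the same means as `t`. Then `B - t` has no means,
  -- so it is orthogonal to `t`, and Pythagoras gives `a(t, t) ≤ a(B, B)`.
  set B : G.FE := ∑ K, f K with hB
  have hBmem : (B : E d → ℝ) ∈ G.femSpace (G.region ℓ P) := by
    have : (B : E d → ℝ) = ∑ K : P, G.mean ℓ K t • b K := by
      rw [hB]; push_cast; rfl
    rw [this]
    exact (G.femSub _).sum_mem fun K _ => (G.femSub _).smul_mem _ (hb K)
  have horth' : a t' (B - t') = 0 := by
    refine horth _ ((G.femSub _).sub_mem hBmem ht) fun K hK => ?_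
    have hm : ∀ K' : P, meanL G ℓ K ⟨b K', hF (hb K')⟩ = if K = K' then 1 else 0 :=
      fun K' => hbm K' K
    have h1 : meanL G ℓ K B = G.mean ℓ K t := by
      simp only [hB, f, map_sum, map_smul, hm, smul_eq_mul, mul_ite, mul_one, mul_zero]
      rw [Finset.sum_coe_sort P fun K' => if K = K' then G.mean ℓ K' t else 0]
      simp [hK]
    change meanL G ℓ K (B - t') = 0
    rw [map_sub, h1, sub_eq_zero]
    rfl
  have h1 : a t' t' ≤ a B B := by
    have h2 := energy_self_nonneg hα hαβ hA (B - t')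
    have h3 : a B B = a t' t' + a t' (B - t') + a t' (B - t') + a (B - t') (B - t') := by
      have := energy_comm hα hαβ hA t' B
      simp only [map_sub, LinearMap.sub_apply, ← ha] at this ⊢
      linarith
    rw [h3, horth']
    linarith
  have hscale : 0 ≤ d * 81 ^ d * β * (G.size ℓ ^ d / G.size ℓ ^ 2) := by
    have := G.size_pos ℓ
    positivity
  have h2 : ∀ K : P, a (f K) (f K) ≤ d * 81 ^ d * β * (G.size ℓ ^ d / G.size ℓ ^ 2) := by
    intro K
    have h3 : a (f K) (f K) = G.mean ℓ K t ^ 2 * aForm A G.Ω (b K) (b K) := by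
      simp only [f, map_smul, LinearMap.smul_apply, smul_eq_mul, ha, energy_apply]
      ring
    rw [h3]
    refine (mul_le_of_le_one_left (aForm_self_nonneg hα hA _) ?_).trans (hbe K)
    rw [sq_le_one_iff_abs_le_one]
    exact hmean K K.2
  have hN' : (P.card : ℝ) ≤ N := by exact_mod_cast hN
  calc aForm A G.Ω t t ≤ a B B := h1
    _ ≤ (Finset.univ : Finset P).card * ∑ K : P, a (f K) (f K) := energy_sum_le hα hαβ hA _ _
    _ ≤ P.card * ∑ _K : P, d * 81 ^ d * β * (G.size ℓ ^ d / G.size ℓ ^ 2) := by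
        rw [Finset.card_univ, Fintype.card_coe]
        exact mul_le_mul_of_nonneg_left (Finset.sum_le_sum fun K _ => h2 K) (Nat.cast_nonneg _)
    _ = (P.card : ℝ) ^ 2 * (d * 81 ^ d * β * (G.size ℓ ^ d / G.size ℓ ^ 2)) := by
        rw [Finset.sum_const, Finset.card_univ, Fintype.card_coe, nsmul_eq_mul]; ring
    _ ≤ (N : ℝ) ^ 2 * (d * 81 ^ d * β * (G.size ℓ ^ d / G.size ℓ ^ 2)) := by
        gcongr
    _ = _ := by ring

end MeshHierarchy

namespace SLODFamily

variable {d : ℕ} {G : MeshHierarchy d} {A : E d → Matrix (Fin d) (Fin d) ℝ} {α β δs : ℝ}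
  (F : SLODFamily G A δs) {ℓ : ℕ}

open MeshHierarchy

/-- A stable SLOD function is a multiple of a function with mean one on its central element, small
means on the other elements, and controlled energy. -/
theorem exists_slod_eq_smul (hd : 1 ≤ d) (hα : 0 < α) (hαβ : α ≤ β)
    (hA : IsCoefficient G.Ω α β A) (hℓ : ℓ ≤ G.L) (hδ : δs < 1) {m₀ : ℕ} (hm : F.m ℓ ≤ m₀)
    (T : G.mesh ℓ) :
    ∃ t ∈ G.FE, ∃ z : ℝ, 0 < z ∧ F.slod ℓ T = z • t ∧ G.mean ℓ T t = 1 ∧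
      (∀ K ∈ G.mesh ℓ, K ≠ T → |G.mean ℓ K t| ≤ δs) ∧
      (∀ K ∉ G.patch ℓ T (F.m ℓ), G.mean ℓ K t = 0) ∧
      aForm A G.Ω t t ≤ (((2 * m₀ + 1) ^ d : ℕ) : ℝ) ^ 2 * (d * 81 ^ d * β) *
        (G.size ℓ ^ d / G.size ℓ ^ 2) ∧
      z ^ 2 * aForm A G.Ω t t = 1 := by
  set P := G.patch ℓ T (F.m ℓ) with hPdef
  have hP : P ⊆ G.mesh ℓ := G.patch_subset_mesh T.2 _
  set t := G.thetaRaw A ℓ (G.patchSet ℓ (F.m ℓ) T) (G.center ℓ (F.m ℓ) T) (F.corr ℓ T) with ht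
  set N := aNorm A (G.patchSet ℓ (F.m ℓ) T) t with hN
  have htm : t ∈ G.femSpace (G.region ℓ P) :=
    thetaRaw_mem hd hα hαβ hA hℓ hP (G.center ℓ (F.m ℓ) T) _
  have htF := G.mem_FE_of_mem_femSpace hℓ hP htm
  have hslod : F.slod ℓ T = N⁻¹ • t := F.slod_eq_smul T
  have hstab : ∀ K ∈ G.mesh ℓ, |G.mean ℓ K (F.slod ℓ T) / G.mean ℓ T (F.slod ℓ T) -
      (if K = T.1 then 1 else 0)| ≤ δs := F.stable ℓ hℓ T
  -- For the zero function the quotient in the stability condition at `T` is `0 / 0 = 0`, and the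
  -- condition would read `1 ≤ δs`.
  have hne : F.slod ℓ T ≠ 0 := by
    intro h
    have h1 := hstab T T.2
    have h2 : G.mean ℓ T (0 : E d → ℝ) = 0 := (meanL G ℓ T).map_zero
    rw [h, h2, if_pos rfl] at h1
    norm_num at h1
    linarith
  have hN0 : N ≠ 0 := fun h => hne (by rw [hslod, h, inv_zero, zero_smul])
  -- Invertibility of `𝒟` is also a consequence of stability: otherwise all `ψ_K`, and with them the
  -- SLOD function, would be zero.
  have hdet : IsUnit (G.dMat A ℓ (G.patchSet ℓ (F.m ℓ) T)).det := by
    by_contra hdet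
    refine hne ?_
    have h0 : ∀ K, G.psiLOD A ℓ (G.patchSet ℓ (F.m ℓ) T) K = 0 :=
      psiLOD_eq_zero_of_not_isUnit hd hα hαβ hA hℓ hP hdet
    rw [hslod, ht, thetaRaw_eq_sum]
    simp [h0]
  have hmT : G.mean ℓ T t = 1 :=
    mean_thetaRaw hd hα hαβ hA hℓ hP hdet (G.center ℓ (F.m ℓ) T) _
  have hmean : ∀ K, G.mean ℓ K (F.slod ℓ T) = N⁻¹ * G.mean ℓ K t := fun K => by
    rw [hslod]; exact (meanL G ℓ K).map_smul N⁻¹ ⟨t, htF⟩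
  have hoff : ∀ K ∈ G.mesh ℓ, K ≠ T → |G.mean ℓ K t| ≤ δs := fun K hK hKT => by
    have := hstab K hK
    rwa [if_neg hKT, hmean, hmean, hmT, mul_one, mul_div_cancel_left₀ _ (inv_ne_zero hN0),
      sub_zero] at this
  have henergy : aForm A (G.patchSet ℓ (F.m ℓ) T) t t = aForm A G.Ω t t :=
    aForm_region_eq hℓ hP htm.2.1 t
  have hNsq : N ^ 2 = aForm A G.Ω t t := by
    rw [hN, aNorm, henergy, Real.sq_sqrt (aForm_self_nonneg hα hA t)]
  refine ⟨t, htF, N⁻¹, inv_pos.2 (lt_of_le_of_ne (Real.sqrt_nonneg _) hN0.symm), hslod, hmT, hoff,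
    fun K hK => mean_eq_zero_of_notMem hK htm.2.1, ?_, ?_⟩
  · refine aForm_le_of_orthogonal hd hα hαβ hA hℓ hP htm (fun w hw h0 => ?_) (fun K hK => ?_) ?_
    · exact aForm_thetaRaw_eq_zero hd hα hαβ hA hℓ hP (G.center ℓ (F.m ℓ) T) _ hw h0
    · by_cases h : K = T
      · rw [h, hmT, abs_one]
      · exact (hoff K (hP hK) h).trans hδ.le
    · refine card_le_of_abs_sub_le (T := T) fun K hK k => ?_
      exact (G.abs_sub_le_of_mem_patch hK k).trans (by exact_mod_cast hm)
  · rw [← hNsq, ← mul_pow, inv_mul_cancel₀ hN0, one_pow]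

end SLODFamily

/-! ### Eigenvalue bounds for the diagonal blocks -/

namespace HSLODFamily

variable {d : ℕ} {G : MeshHierarchy d} {A : E d → Matrix (Fin d) (Fin d) ℝ} {α β δs : ℝ}
  (F : HSLODFamily G A δs)

open MeshHierarchy

theorem hslod_mem_FE (hd : 1 ≤ d) (hα : 0 < α) (hαβ : α ≤ β) (hA : IsCoefficient G.Ω α β A) :
    ∀ {ℓ : ℕ} (_ : ℓ ≤ G.L) (i : F.Idx ℓ), F.hslod ℓ i ∈ G.FE
  | 0, hℓ, T => F.slod_mem_FE hd hα hαβ hA hℓ T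
  | _ + 1, hℓ, ⟨T, _⟩ => F.combo_mem_FE hd hα hαβ hA hℓ T _

theorem basisFun_eq_smul {ℓ : ℕ} (i : F.Idx ℓ) :
    F.basisFun ℓ i = (aNorm A G.Ω (F.hslod ℓ i))⁻¹ • F.hslod ℓ i := by
  funext x
  rw [basisFun, Pi.smul_apply, smul_eq_mul, div_eq_inv_mul]

theorem basisFun_mem_FE (hd : 1 ≤ d) (hα : 0 < α) (hαβ : α ≤ β) (hA : IsCoefficient G.Ω α β A)
    {ℓ : ℕ} (hℓ : ℓ ≤ G.L) (i : F.Idx ℓ) : F.basisFun ℓ i ∈ G.FE := by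
  rw [basisFun_eq_smul]
  exact G.FE.smul_mem _ (F.hslod_mem_FE hd hα hαβ hA hℓ i)

/-- Only an inequality, because a function of zero energy norm is normalized to zero. -/
theorem aForm_basisFun_le_one (hd : 1 ≤ d) (hα : 0 < α) (hαβ : α ≤ β)
    (hA : IsCoefficient G.Ω α β A) {ℓ : ℕ} (hℓ : ℓ ≤ G.L) (i : F.Idx ℓ) :
    aForm A G.Ω (F.basisFun ℓ i) (F.basisFun ℓ i) ≤ 1 := by
  set N := aNorm A G.Ω (F.hslod ℓ i) with hN
  have h1 : aForm A G.Ω (F.basisFun ℓ i) (F.basisFun ℓ i) = N⁻¹ * (N⁻¹ * N ^ 2) := by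
    rw [hN, aNorm, Real.sq_sqrt (aForm_self_nonneg hα hA _), ← aNorm, ← hN, basisFun_eq_smul]
    change energy hα hαβ hA (N⁻¹ • ⟨_, F.hslod_mem_FE hd hα hαβ hA hℓ i⟩)
      (N⁻¹ • ⟨_, F.hslod_mem_FE hd hα hαβ hA hℓ i⟩) = _
    rw [map_smul, map_smul, LinearMap.smul_apply, smul_eq_mul, smul_eq_mul]
    rfl
  rw [h1]
  by_cases h : N = 0
  · simp [h]
  · exact le_of_eq (by field_simp)

/-- The combination of the basis functions of level `ℓ` with coefficients `x`. -/
noncomputable def lincomb {ℓ : ℕ} (x : F.Idx ℓ → ℝ) : E d → ℝ := ∑ i, x i • F.basisFun ℓ i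

theorem lincomb_mem_FE (hd : 1 ≤ d) (hα : 0 < α) (hαβ : α ≤ β) (hA : IsCoefficient G.Ω α β A)
    {ℓ : ℕ} (hℓ : ℓ ≤ G.L) (x : F.Idx ℓ → ℝ) : F.lincomb x ∈ G.FE :=
  G.FE.sum_mem fun i _ => G.FE.smul_mem _ (F.basisFun_mem_FE hd hα hαβ hA hℓ i)

theorem lincomb_coe (hd : 1 ≤ d) (hα : 0 < α) (hαβ : α ≤ β) (hA : IsCoefficient G.Ω α β A)
    {ℓ : ℕ} (hℓ : ℓ ≤ G.L) (x : F.Idx ℓ → ℝ) :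
    (⟨F.lincomb x, F.lincomb_mem_FE hd hα hαβ hA hℓ x⟩ : G.FE) =
      ∑ i, x i • ⟨_, F.basisFun_mem_FE hd hα hαβ hA hℓ i⟩ := by
  apply Subtype.ext
  push_cast
  rfl

theorem block_isHermitian (hα : 0 < α) (hA : IsCoefficient G.Ω α β A) (ℓ : Fin (G.L + 1)) :
    (F.block ℓ).IsHermitian := by
  ext i j
  simp only [Matrix.conjTranspose_apply, star_trivial]
  exact aForm_comm hα hA _ _

theorem dotProduct_block (hd : 1 ≤ d) (hα : 0 < α) (hαβ : α ≤ β) (hA : IsCoefficient G.Ω α β A)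
    (ℓ : Fin (G.L + 1)) (x : F.Idx ℓ → ℝ) :
    x ⬝ᵥ (F.block ℓ *ᵥ x) = aForm A G.Ω (F.lincomb x) (F.lincomb x) := by
  have hℓ : ℓ.val ≤ G.L := Nat.lt_succ_iff.1 ℓ.2
  change _ = energy hα hαβ hA ⟨_, F.lincomb_mem_FE hd hα hαβ hA hℓ x⟩
    ⟨_, F.lincomb_mem_FE hd hα hαβ hA hℓ x⟩
  rw [F.lincomb_coe hd hα hαβ hA hℓ x]
  simp only [map_sum, LinearMap.sum_apply, map_smul, LinearMap.smul_apply, smul_eq_mul,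
    dotProduct, Matrix.mulVec, Finset.mul_sum]
  rw [Finset.sum_comm]
  refine Finset.sum_congr rfl fun i _ => Finset.sum_congr rfl fun j _ => ?_
  change x j * (aForm A G.Ω (F.basisFun ℓ j) (F.basisFun ℓ i) * x i) =
    x i * (x j * aForm A G.Ω (F.basisFun ℓ j) (F.basisFun ℓ i))
  ring

theorem size_rpow_sq {ℓ : ℕ} :
    (G.size ℓ ^ ((d : ℝ) / 2 - 1)) ^ 2 = G.size ℓ ^ d / G.size ℓ ^ 2 := by
  have h := G.size_pos ℓ
  rw [← Real.rpow_natCast, ← Real.rpow_mul h.le, ← Real.rpow_natCast, ← Real.rpow_natCast,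
    ← Real.rpow_sub h]
  congr 1
  push_cast
  ring

theorem pMat_mulVec (hd : 1 ≤ d) (hα : 0 < α) (hαβ : α ≤ β) (hA : IsCoefficient G.Ω α β A)
    {ℓ : ℕ} (hℓ : ℓ ≤ G.L) (x : F.Idx ℓ → ℝ) (K : G.mesh ℓ) :
    (F.pMat ℓ *ᵥ x) K = G.mean ℓ K (F.lincomb x) := by
  change _ = meanL G ℓ K ⟨_, F.lincomb_mem_FE hd hα hαβ hA hℓ x⟩
  rw [F.lincomb_coe hd hα hαβ hA hℓ x, map_sum]
  refine Finset.sum_congr rfl fun i _ => ?_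
  rw [map_smul, smul_eq_mul, mul_comm]
  rfl

theorem sum_pHat_mulVec_sq {ℓ : ℕ} (x : F.Idx ℓ → ℝ) :
    ∑ K, (F.pHat ℓ *ᵥ x) K ^ 2 =
      G.size ℓ ^ d / G.size ℓ ^ 2 * ∑ K, (F.pMat ℓ *ᵥ x) K ^ 2 := by
  rw [← size_rpow_sq, Finset.mul_sum]
  refine Finset.sum_congr rfl fun K _ => ?_
  rw [pHat, Matrix.smul_mulVec, Pi.smul_apply, smul_eq_mul, mul_pow]

/-- The scaling of `P̂` is chosen so that `H² · H^(d-2) = H^d` is the volume of an element; the rest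
is contractivity of the projection. -/
theorem size_sq_mul_sum_pHat_le (hd : 1 ≤ d) (hα : 0 < α) (hαβ : α ≤ β)
    (hA : IsCoefficient G.Ω α β A) {ℓ : ℕ} (hℓ : ℓ ≤ G.L) (x : F.Idx ℓ → ℝ) :
    G.size ℓ ^ 2 * ∑ K, (F.pHat ℓ *ᵥ x) K ^ 2 ≤ ∫ y, F.lincomb x y ^ 2 := by
  have h := FE.sum_mean_sq_le (F.lincomb_mem_FE hd hα hαβ hA hℓ x) ℓ
  rw [sum_pHat_mulVec_sq]
  simp only [F.pMat_mulVec hd hα hαβ hA hℓ]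
  rw [Finset.sum_coe_sort (G.mesh ℓ) fun K => G.mean ℓ K (F.lincomb x) ^ 2, ← mul_assoc,
    mul_div_cancel₀ _ (pow_pos (G.size_pos ℓ) 2).ne']
  exact h

theorem mean_lincomb_eq_zero (hd : 1 ≤ d) (hα : 0 < α) (hαβ : α ≤ β)
    (hA : IsCoefficient G.Ω α β A) {ℓ : ℕ} (hℓ : ℓ + 1 ≤ G.L) (x : F.Idx (ℓ + 1) → ℝ)
    {T : Cell d} (hT : T ∈ G.mesh ℓ) : G.mean ℓ T (F.lincomb x) = 0 := by
  change meanL G ℓ T ⟨_, F.lincomb_mem_FE hd hα hαβ hA hℓ x⟩ = 0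
  rw [F.lincomb_coe hd hα hαβ hA hℓ x, map_sum]
  refine Finset.sum_eq_zero fun i _ => ?_
  have h1 : (⟨_, F.basisFun_mem_FE hd hα hαβ hA hℓ i⟩ : G.FE) =
      (aNorm A G.Ω (F.hslod (ℓ + 1) i))⁻¹ • ⟨_, F.hslod_mem_FE hd hα hαβ hA hℓ i⟩ :=
    Subtype.ext (F.basisFun_eq_smul i)
  have h2 : meanL G ℓ T ⟨_, F.hslod_mem_FE hd hα hαβ hA hℓ i⟩ = 0 := by
    obtain ⟨T', τ⟩ := i
    exact F.meanFree ℓ hℓ T' τ T hT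
  rw [h1, map_smul, map_smul, h2, smul_zero, smul_zero]

instance (ℓ : ℕ) : Nonempty (G.mesh ℓ) := (G.mesh_nonempty ℓ).to_subtype

theorem nonempty_idx (hd : 1 ≤ d) : ∀ {ℓ : ℕ} (_ : ℓ ≤ G.L), Nonempty (F.Idx ℓ)
  | 0, _ => inferInstanceAs (Nonempty (G.mesh 0))
  | ℓ + 1, hℓ => by
    obtain ⟨T⟩ := (inferInstance : Nonempty (G.mesh ℓ))
    have h1 : (F.keep ℓ T).Nonempty := by
      rw [← Finset.card_pos, F.keep_card ℓ hℓ T]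
      have : 2 ^ 1 ≤ 2 ^ d := Nat.pow_le_pow_right (by norm_num) hd
      omega
    obtain ⟨τ, hτ⟩ := h1
    exact ⟨⟨T, ⟨τ, hτ⟩⟩⟩

/-- The means vanish on level `ℓ - 1`, so Poincaré's inequality is used with side `2 H_ℓ`; this is
the origin of the factor `4`, and the powers of `H_ℓ` cancel. -/
theorem lamMin_block_ge_of_pos (hd : 1 ≤ d) (hα : 0 < α) (hαβ : α ≤ β)
    (hA : IsCoefficient G.Ω α β A) (ℓ : Fin (G.L + 1)) (h0 : 0 < ℓ.val) :
    Real.pi ^ 2 * α / 4 * lamMin ((F.pHat ℓ)ᵀ * F.pHat ℓ) ≤ lamMin (F.block ℓ) := by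
  obtain ⟨ℓ, hℓ'⟩ := ℓ
  obtain ⟨k, rfl⟩ : ∃ k, ℓ = k + 1 := ⟨ℓ - 1, by simp at h0; omega⟩
  have hℓ : k + 1 ≤ G.L := Nat.lt_succ_iff.1 hℓ'
  have := F.nonempty_idx hd hℓ
  refine le_lamMin (F.block_isHermitian hα hA _) fun x => ?_
  rw [F.dotProduct_block hd hα hαβ hA]
  have h1 := lamMin_mul_le (isHermitian_gram (F.pHat (k + 1))) x
  rw [dotProduct_gram] at h1
  have hv := F.lincomb_mem_FE hd hα hαβ hA hℓ x
  have h2 := F.size_sq_mul_sum_pHat_le hd hα hαβ hA hℓ x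
  have h3 := FE.poincare (ℓ := k) hv fun T hT => F.mean_lincomb_eq_zero hd hα hαβ hA hℓ x hT
  have h4 := FE.integral_sq_pderiv_le hα hαβ hA hv
  set D := ∑ k, ∫ y, G.pderiv (F.lincomb x) k y ^ 2
  set S := ∑ K, (F.pHat (k + 1) *ᵥ x) K ^ 2
  have hH := G.size_pos (k + 1)
  have h5 : S ≤ 4 / Real.pi ^ 2 * D := by
    have h6 := h2.trans h3
    rw [G.size_eq_two_mul k] at h6
    refine le_of_mul_le_mul_left (h6.trans (le_of_eq ?_)) (pow_pos hH 2)
    ring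
  have hpi := Real.pi_pos
  calc Real.pi ^ 2 * α / 4 * lamMin ((F.pHat (k + 1))ᵀ * F.pHat (k + 1)) * (x ⬝ᵥ x)
      = Real.pi ^ 2 * α / 4 * (lamMin ((F.pHat (k + 1))ᵀ * F.pHat (k + 1)) * (x ⬝ᵥ x)) := by ring
    _ ≤ Real.pi ^ 2 * α / 4 * (4 / Real.pi ^ 2 * D) := 
        mul_le_mul_of_nonneg_left (h1.trans h5) (by positivity)
    _ = α * D := by field_simp
    _ ≤ _ := h4

/-- Friedrichs' inequality replaces Poincaré's. No means are involved, so the estimate holds on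
every level, and `lamMin_block_pos` uses it in that generality. -/
theorem lamMin_block_ge_of_eq_zero (hd : 1 ≤ d) (hα : 0 < α) (hαβ : α ≤ β)
    (hA : IsCoefficient G.Ω α β A) (ℓ : Fin (G.L + 1)) :
    Real.pi ^ 2 * α / Metric.diam G.Ω ^ 2 * G.size ℓ ^ 2 * lamMin ((F.pHat ℓ)ᵀ * F.pHat ℓ) ≤
      lamMin (F.block ℓ) := by
  have hℓ : ℓ.val ≤ G.L := Nat.lt_succ_iff.1 ℓ.2
  have := F.nonempty_idx hd hℓ
  refine le_lamMin (F.block_isHermitian hα hA _) fun x => ?_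
  rw [F.dotProduct_block hd hα hαβ hA]
  have h1 := lamMin_mul_le (isHermitian_gram (F.pHat ℓ)) x
  rw [dotProduct_gram] at h1
  have hv := F.lincomb_mem_FE hd hα hαβ hA hℓ x
  have h2 := F.size_sq_mul_sum_pHat_le hd hα hαβ hA hℓ x
  have h3 := FE.friedrichs hd hv
  have h4 := FE.integral_sq_pderiv_le hα hαβ hA hv
  set D := ∑ k, ∫ y, G.pderiv (F.lincomb x) k y ^ 2
  set S := ∑ K, (F.pHat ℓ *ᵥ x) K ^ 2
  have hpi := Real.pi_pos
  have hdiam := G.diam_Ω_pos hd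
  calc Real.pi ^ 2 * α / Metric.diam G.Ω ^ 2 * G.size ℓ ^ 2 *
        lamMin ((F.pHat ℓ)ᵀ * F.pHat ℓ) * (x ⬝ᵥ x)
      = Real.pi ^ 2 * α / Metric.diam G.Ω ^ 2 * (G.size ℓ ^ 2 *
        (lamMin ((F.pHat ℓ)ᵀ * F.pHat ℓ) * (x ⬝ᵥ x))) := by ring
    _ ≤ Real.pi ^ 2 * α / Metric.diam G.Ω ^ 2 * ((Metric.diam G.Ω / Real.pi) ^ 2 * D) := by
        refine mul_le_mul_of_nonneg_left (le_trans ?_ (h2.trans h3)) (by positivity)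
        exact mul_le_mul_of_nonneg_left h1 (sq_nonneg _)
    _ = α * D := by field_simp
    _ ≤ _ := h4

theorem card_le_overlap {ℓ : ℕ} (I : Finset (F.Idx ℓ)) {U : Set (E d)} (hU : IsOpen U)
    (hne : U.Nonempty) (hUΩ : U ⊆ G.Ω) (h : ∀ i ∈ I, U ⊆ tsupport (F.basisFun ℓ i)) :
    I.card ≤ F.overlap ℓ := by
  classical
  exact Finset.le_sup (f := Finset.card)
    (Finset.mem_filter.2 ⟨Finset.mem_univ _, U, hU, hne, hUΩ, h⟩)

theorem _root_.HSLOD.MeshHierarchy.mem_tsupport_of_grad_ne_zero {v : E d → ℝ} {x : E d}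
    (h : grad v x ≠ 0) : x ∈ tsupport v := by
  by_contra hx
  exact h (grad_eq_zero_of_eventuallyEq (notMem_tsupport_iff_eventuallyEq.1 hx))

/-- Off the grid planes the gradient is continuous. A point where several gradients are nonzero
therefore has a neighbourhood contained in all the supports, as the definition of `overlap`
requires. -/
theorem _root_.HSLOD.MeshHierarchy.FE.eventually_grad_ne_zero {v : E d → ℝ} (hv : v ∈ G.FE)
    {x : E d} (hx : x ∉ G.skel G.fineSize) (h : grad v x ≠ 0) :
    ∀ᶠ y in nhds x, grad v y ≠ 0 := by
  have h1 : ContinuousAt (fderiv ℝ v) x :=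
    ((FE.contDiffAt hv hx).fderiv_right (m := 0) (by norm_num)).continuousAt
  have h2 : ContinuousAt (grad v) x :=
    continuousAt_pi.2 fun k => h1.clm_apply continuousAt_const
  exact h2.eventually_ne h

/-- At almost every point at most `overlap` gradients are nonzero, and the quadratic form of a sum
of `N` vectors is at most `N` times the sum of the forms. Integration and the normalization finish
the estimate. -/
theorem lamMax_block_le (hd : 1 ≤ d) (hα : 0 < α) (hαβ : α ≤ β)
    (hA : IsCoefficient G.Ω α β A) (ℓ : Fin (G.L + 1)) : lamMax (F.block ℓ) ≤ F.overlap ℓ := by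
  have hℓ : ℓ.val ≤ G.L := Nat.lt_succ_iff.1 ℓ.2
  have := F.nonempty_idx hd hℓ
  have hb := fun i => F.basisFun_mem_FE hd hα hαβ hA hℓ i
  refine lamMax_le (F.block_isHermitian hα hA _) fun x => ?_
  rw [F.dotProduct_block hd hα hαβ hA]
  have hbx : ∀ i, x i • F.basisFun ℓ i ∈ G.FE := fun i => G.FE.smul_mem _ (hb i)
  have h1 : aForm A G.Ω (F.lincomb x) (F.lincomb x) ≤
      F.overlap ℓ * ∑ i, aForm A G.Ω (x i • F.basisFun ℓ i) (x i • F.basisFun ℓ i) := by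
    simp only [aForm]
    rw [← integral_finsetSum _ fun i _ => FE.integrableOn_energy hα hαβ hA (hbx i) (hbx i),
      ← integral_const_mul]
    refine integral_mono_ae (FE.integrableOn_energy hα hαβ hA
      (F.lincomb_mem_FE hd hα hαβ hA hℓ x) (F.lincomb_mem_FE hd hα hαβ hA hℓ x))
      ((integrable_finsetSum _ fun i _ =>
        FE.integrableOn_energy hα hαβ hA (hbx i) (hbx i)).const_mul _) ?_
    filter_upwards [ae_coefficient hα hA, ae_restrict_mem G.isOpen_Ω.measurableSet]
      with y ⟨hy, hs, h0, _⟩ hyΩ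
    classical
    set I : Finset (F.Idx ℓ) := Finset.univ.filter fun i => grad (F.basisFun ℓ i) y ≠ 0 with hI
    have hcard : I.card ≤ F.overlap ℓ := by
      have hev : ∀ᶠ z in nhds y, z ∈ G.Ω ∧ ∀ i ∈ I, grad (F.basisFun ℓ i) z ≠ 0 := by
        refine Filter.Eventually.and (show ∀ᶠ z in nhds y, z ∈ G.Ω from G.isOpen_Ω.mem_nhds hyΩ)
          ((Finset.eventually_all I).2 fun i hi => ?_)
        exact FE.eventually_grad_ne_zero (hb i) hy (Finset.mem_filter.1 hi).2
      obtain ⟨U, hUsub, hU, hyU⟩ := eventually_nhds_iff.1 hev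
      exact F.card_le_overlap I hU ⟨y, hyU⟩ (fun z hz => (hUsub z hz).1)
        fun i hi z hz => mem_tsupport_of_grad_ne_zero ((hUsub z hz).2 i hi)
    have hgrad : grad (F.lincomb x) y = ∑ i ∈ I, grad (x i • F.basisFun ℓ i) y := by
      rw [lincomb, FE.grad_sum _ (fun i _ => hbx i) hy]
      refine (Finset.sum_subset (Finset.subset_univ I) fun i _ hi => ?_).symm
      have : grad (F.basisFun ℓ i) y = 0 := by
        by_contra h; exact hi (Finset.mem_filter.2 ⟨Finset.mem_univ i, h⟩)
      rw [FE.grad_smul (hb i) _ hy, this, smul_zero]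
    rw [hgrad]
    refine (mulVec_sum_dotProduct_le hs h0 I _).trans ?_
    refine mul_le_mul (by exact_mod_cast hcard)
      (Finset.sum_le_sum_of_subset_of_nonneg (Finset.subset_univ I) fun i _ _ => h0 _)
      (Finset.sum_nonneg fun i _ => h0 _) (Nat.cast_nonneg _)
  refine h1.trans (mul_le_mul_of_nonneg_left (Finset.sum_le_sum fun i _ => ?_) (Nat.cast_nonneg _))
  have h2 : aForm A G.Ω (x i • F.basisFun ℓ i) (x i • F.basisFun ℓ i) =
      x i * (x i * aForm A G.Ω (F.basisFun ℓ i) (F.basisFun ℓ i)) := by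
    change energy hα hαβ hA (x i • ⟨_, hb i⟩) (x i • ⟨_, hb i⟩) = _
    rw [map_smul, map_smul, LinearMap.smul_apply, smul_eq_mul, smul_eq_mul]
    rfl
  rw [h2, ← mul_assoc]
  exact mul_le_of_le_one_right (mul_self_nonneg _) (F.aForm_basisFun_le_one hd hα hαβ hA hℓ i)

theorem condNum_block_le (hd : 1 ≤ d) (hα : 0 < α) (hαβ : α ≤ β)
    (hA : IsCoefficient G.Ω α β A) (ℓ : Fin (G.L + 1)) {c : ℝ} (hc : 0 < c)
    (h : c ≤ lamMin (F.block ℓ)) : condNum (F.block ℓ) ≤ F.overlap ℓ / c :=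
  (div_le_div_of_nonneg_right (F.lamMax_block_le hd hα hαβ hA ℓ) (hc.le.trans h)).trans
    (div_le_div_of_nonneg_left (Nat.cast_nonneg _) hc h)

theorem condNum_block_le_of_pos (hd : 1 ≤ d) (hα : 0 < α) (hαβ : α ≤ β)
    (hA : IsCoefficient G.Ω α β A) (ℓ : Fin (G.L + 1)) (h0 : 0 < ℓ.val)
    (h : 0 < lamMin ((F.pHat ℓ)ᵀ * F.pHat ℓ)) :
    condNum (F.block ℓ) ≤
      4 * F.overlap ℓ / (Real.pi ^ 2 * α * lamMin ((F.pHat ℓ)ᵀ * F.pHat ℓ)) := by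
  have hpi := Real.pi_pos
  refine (F.condNum_block_le hd hα hαβ hA ℓ (by positivity)
    (F.lamMin_block_ge_of_pos hd hα hαβ hA ℓ h0)).trans (le_of_eq ?_)
  field_simp

theorem condNum_block_le_diam (hd : 1 ≤ d) (hα : 0 < α) (hαβ : α ≤ β)
    (hA : IsCoefficient G.Ω α β A) (ℓ : Fin (G.L + 1))
    (h : 0 < lamMin ((F.pHat ℓ)ᵀ * F.pHat ℓ)) :
    condNum (F.block ℓ) ≤ Metric.diam G.Ω ^ 2 * F.overlap ℓ /
      (Real.pi ^ 2 * α * lamMin ((F.pHat ℓ)ᵀ * F.pHat ℓ)) * (G.size ℓ ^ 2)⁻¹ := by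
  have hpi := Real.pi_pos
  have hdiam := G.diam_Ω_pos hd
  have hH := G.size_pos ℓ
  refine (F.condNum_block_le hd hα hαβ hA ℓ (by positivity)
    (F.lamMin_block_ge_of_eq_zero hd hα hαβ hA ℓ)).trans (le_of_eq ?_)
  field_simp

theorem lamMin_block_pos (hd : 1 ≤ d) (hα : 0 < α) (hαβ : α ≤ β)
    (hA : IsCoefficient G.Ω α β A) (ℓ : Fin (G.L + 1))
    (h : 0 < lamMin ((F.pHat ℓ)ᵀ * F.pHat ℓ)) : 0 < lamMin (F.block ℓ) := by
  have hpi := Real.pi_pos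
  have hdiam := G.diam_Ω_pos hd
  have hH := G.size_pos ℓ
  exact lt_of_lt_of_le (by positivity) (F.lamMin_block_ge_of_eq_zero hd hα hαβ hA ℓ)

end HSLODFamily

/-! ### Sparse perturbations of the identity; counting and supports -/

section Perturbation

variable {ι : Type*} [Fintype ι] [DecidableEq ι]

/-- A sparse small perturbation of the identity is bounded below. -/
theorem half_sum_sq_le (M : ι → ι → ℝ) (R : ι → ι → Prop) {δ N : ℝ}
    (hR : ∀ i j, ¬ R i j → M i j = if i = j then 1 else 0)
    (hδ : ∀ i j, |M i j - if i = j then 1 else 0| ≤ δ)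
    (hrow : ∀ i, ∀ J : Finset ι, (∀ j ∈ J, R i j) → (J.card : ℝ) ≤ N)
    (hcol : ∀ j, ∀ I : Finset ι, (∀ i ∈ I, R i j) → (I.card : ℝ) ≤ N)
    (hNδ : N * δ ≤ 1 / 4) (hN : 0 ≤ N) (x : ι → ℝ) :
    1 / 2 * ∑ i, x i ^ 2 ≤ ∑ i, (∑ j, M i j * x j) ^ 2 := by
  classical
  rcases isEmpty_or_nonempty ι with h | ⟨⟨i₀⟩⟩
  · simp
  have hδ0 : 0 ≤ δ := (abs_nonneg _).trans (hδ i₀ i₀)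
  set e : ι → ι → ℝ := fun i j => M i j - if i = j then 1 else 0 with he
  have h1 := sum_sq_sparse_le e R (fun i j h => by rw [he]; simp [hR i j h]) hδ
    (fun i => hrow i _ fun j hj => (Finset.mem_filter.1 hj).2)
    (fun j => hcol j _ fun i hi => (Finset.mem_filter.1 hi).2) hN x
  have h2 := sum_sq_add_ge x fun i => ∑ j, e i j * x j
  have h3 : ∀ i, ∑ j, M i j * x j = x i + ∑ j, e i j * x j := fun i => by
    simp [he, sub_mul, Finset.sum_sub_distrib]
  -- With `h1` and `h2` the factor becomes `3/4 - 3/16 = 9/16`, which exceeds `1/2`.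
  have h4 : (N * δ) ^ 2 ≤ (1 / 4) ^ 2 := pow_le_pow_left₀ (mul_nonneg hN hδ0) hNδ 2
  have h5 : 0 ≤ ∑ i, x i ^ 2 := Finset.sum_nonneg fun i _ => sq_nonneg _
  simp only [h3]
  nlinarith [mul_le_mul_of_nonneg_right h4 h5]

theorem card_le_of_injective_of_abs_sub_le {ι : Type*} {d : ℕ} (p : ι → Cell d)
    (hp : Function.Injective p) (b : Cell d) (m : ℕ) (I : Finset ι)
    (h : ∀ i ∈ I, ∀ k, |p i k - b k| ≤ m) : I.card ≤ (4 * m + 2) ^ d := by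
  classical
  rw [← Finset.card_image_of_injective I hp]
  refine (MeshHierarchy.card_le_of_abs_sub_le (T := b) (m := m) ?_).trans
    (Nat.pow_le_pow_left (by omega) d)
  simpa using h

/-- An integer whose half, rounded down, is within `m` of `b` lies between `2 (b - m)` and `2 (b +
m) + 1`, which leaves `4m + 2` values. The preceding lemma uses the same, there wasteful, bound so
that one constant serves all levels. -/
theorem card_le_of_injective_of_abs_half_sub_le {ι : Type*} {d : ℕ} (p : ι → Cell d)
    (hp : Function.Injective p) (b : Cell d) (m : ℕ) (I : Finset ι)
    (h : ∀ i ∈ I, ∀ k, |p i k / 2 - b k| ≤ m) : I.card ≤ (4 * m + 2) ^ d := by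
  classical
  rw [← Finset.card_image_of_injective I hp]
  refine MeshHierarchy.card_le_of_forall_mem_Icc (a := fun k => 2 * (b k - m))
    (b := fun k => 2 * (b k + m) + 1) (fun k => by omega) fun z hz k => ?_
  obtain ⟨i, hi, rfl⟩ := Finset.mem_image.1 hz
  have := abs_le.1 (h i hi k)
  omega

end Perturbation

namespace MeshHierarchy

variable {d : ℕ} {G : MeshHierarchy d} {ℓ : ℕ} {v : E d → ℝ}

theorem exists_mem_notMem_skel {U : Set (E d)} (hU : IsOpen U) (hne : U.Nonempty) (H : ℝ) :
    ∃ x ∈ U, x ∉ G.skel H := by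
  by_contra! h
  exact (hU.measure_pos volume hne).ne' (measure_mono_null h (G.volume_skel H))

theorem mean_succ_eq_zero_of_notMem {P : Finset (Cell d)} {K : Cell d}
    (hK : (fun k => K k / 2) ∉ P) (hv : ∀ x ∉ G.region ℓ P, v x = 0) :
    G.mean (ℓ + 1) K v = 0 := by
  rw [mean_eq, setIntegral_eq_zero_of_ae_eq_zero, mul_zero]
  filter_upwards [G.ae_notMem_skel (G.size (ℓ + 1))] with x hx hxK
  refine hv x fun h => hK ?_
  rw [G.mem_region_iff (fun h => hx (G.skel_size_succ_subset ℓ h)), idx_size_succ,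
    (G.mem_cube_iff (G.size_pos _) hx K).1 hxK] at h
  exact h

theorem FE.sum_mean_children (hv : v ∈ G.FE) {T : Cell d} (hT : T ∈ G.mesh ℓ) :
    G.size (ℓ + 1) ^ d * ∑ K ∈ children G ℓ T, G.mean (ℓ + 1) K v =
      G.size ℓ ^ d * G.mean ℓ T v := by
  rw [size_pow_mul_mean, setIntegral_congr_set (G.elem_ae_eq_children hT), region]
  simp only [elem]
  rw [G.setIntegral_biUnion_cube (G.size_pos _) _ fun z _ => (FE.integrable hv).integrableOn,
    Finset.mul_sum]
  exact Finset.sum_congr rfl fun K _ => size_pow_mul_mean K v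

theorem tsupport_subset_region {P : Finset (Cell d)} (hv : ∀ x ∉ G.region ℓ P, v x = 0) :
    tsupport v ⊆ G.region ℓ P := by
  refine closure_minimal (fun x hx => ?_) (G.isCompact_region ℓ P).isClosed
  by_contra h
  exact hx (hv x h)

theorem abs_idx_sub_le {T : Cell d} {m m₀ : ℕ} (hm : m ≤ m₀) {x : E d}
    (hx : x ∉ G.skel (G.size ℓ)) (h : x ∈ G.region ℓ (G.patch ℓ T m)) (k : Fin d) :
    |T k - G.idx (G.size ℓ) x k| ≤ m₀ := by
  rw [abs_sub_comm]
  exact (G.abs_sub_le_of_mem_patch ((G.mem_region_iff hx _).1 h) k).trans (by exact_mod_cast hm)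

end MeshHierarchy

namespace SLODFamily

variable {d : ℕ} {G : MeshHierarchy d} {A : E d → Matrix (Fin d) (Fin d) ℝ} {α β δs : ℝ}
  (F : SLODFamily G A δs) {ℓ : ℕ}

open MeshHierarchy

theorem slod_eq_zero (hd : 1 ≤ d) (hα : 0 < α) (hαβ : α ≤ β) (hA : IsCoefficient G.Ω α β A)
    (hℓ : ℓ ≤ G.L) (T : G.mesh ℓ) {x : E d} (hx : x ∉ G.region ℓ (G.patch ℓ T (F.m ℓ))) :
    F.slod ℓ T x = 0 :=
  (F.slod_mem hd hα hαβ hA hℓ T).2.1 x fun h => hx (interior_subset h)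

/-- Inside `Ω` this is the selection rule for the SLOD functions in the combination; outside `Ω` it
is the zero extension. -/
theorem combo_eq_zero (hd : 1 ≤ d) (hα : 0 < α) (hαβ : α ≤ β) (hA : IsCoefficient G.Ω α β A)
    (hℓ : ℓ + 1 ≤ G.L) (T : G.mesh ℓ) (c : G.mesh (ℓ + 1) → ℝ) {x : E d}
    (hx : x ∉ G.region ℓ (G.patch ℓ T (F.m (ℓ + 1)))) : F.combo ℓ T c x = 0 := by
  by_cases hΩ : x ∈ G.Ω
  · refine Finset.sum_eq_zero fun K hK => ?_
    simp only [sSet, Finset.mem_filter] at hK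
    rw [hK.2.2 x ⟨hΩ, hx⟩, mul_zero]
  · exact FE.eq_zero (F.combo_mem_FE hd hα hαβ hA hℓ T c) hΩ

theorem mem_patch_of_mem_sSet {T : G.mesh ℓ} {K : G.mesh (ℓ + 1)} (hK : K ∈ F.sSet ℓ T) :
    (fun k => K.1 k / 2) ∈ G.patch ℓ T (F.m (ℓ + 1)) := by
  simp only [sSet, Finset.mem_filter] at hK
  exact G.elem_succ_subset_region_iff.1 hK.2.1

theorem card_sSet_le {m₀ : ℕ} (hm : F.m (ℓ + 1) ≤ m₀) (T : G.mesh ℓ) :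
    (F.sSet ℓ T).card ≤ (4 * m₀ + 2) ^ d :=
  card_le_of_injective_of_abs_half_sub_le (fun K : G.mesh (ℓ + 1) => K.1) Subtype.val_injective T
    m₀ _ fun _ hK k => (G.abs_sub_le_of_mem_patch (F.mem_patch_of_mem_sSet hK) k).trans
      (by exact_mod_cast hm)

/-- The energy of a combination of SLOD functions is controlled by its means. -/
theorem aForm_combo_le (hd : 1 ≤ d) (hα : 0 < α) (hαβ : α ≤ β) (hA : IsCoefficient G.Ω α β A)
    (hℓ : ℓ + 1 ≤ G.L) {m₀ : ℕ} (hm : F.m (ℓ + 1) ≤ m₀)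
    (hδ : (((4 * m₀ + 2) ^ d : ℕ) : ℝ) * δs ≤ 1 / 4) (T : G.mesh ℓ) (c : G.mesh (ℓ + 1) → ℝ)
    {M : ℝ} (hM : ∀ K ∈ F.sSet ℓ T, |G.mean (ℓ + 1) K (F.combo ℓ T c)| ≤ M) :
    aForm A G.Ω (F.combo ℓ T c) (F.combo ℓ T c) ≤
      2 * (((4 * m₀ + 2) ^ d : ℕ) : ℝ) ^ 2 * M ^ 2 *
        ((((2 * m₀ + 1) ^ d : ℕ) : ℝ) ^ 2 * (d * 81 ^ d * β)) *
        (G.size (ℓ + 1) ^ d / G.size (ℓ + 1) ^ 2) := by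
  set N : ℝ := (((4 * m₀ + 2) ^ d : ℕ) : ℝ) with hN
  have hN1 : 1 ≤ N := by
    rw [hN]; exact_mod_cast Nat.one_le_pow _ _ (by omega)
  have hδ1 : δs < 1 := by nlinarith
  choose t ht z hz hslod hone hoff hzero hen hnorm using
    F.exists_slod_eq_smul hd hα hαβ hA hℓ hδ1 hm
  set S := F.sSet ℓ T
  set Cθ := (((2 * m₀ + 1) ^ d : ℕ) : ℝ) ^ 2 * (d * 81 ^ d * β) *
    (G.size (ℓ + 1) ^ d / G.size (ℓ + 1) ^ 2) with hCθ
  let t' : G.mesh (ℓ + 1) → G.FE := fun K => ⟨t K, ht K⟩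
  -- Coefficients with respect to the functions of mean one, for which the energies are bounded and
  -- the matrix of means is close to the identity.
  set y : S → ℝ := fun K => c K * z K with hy
  have hφ : F.combo ℓ T c = ((∑ K : S, y K • t' K : G.FE) : E d → ℝ) := by
    rw [combo_eq_sum, ← Finset.sum_coe_sort]
    push_cast
    refine Finset.sum_congr rfl fun K _ => ?_
    rw [hslod, smul_smul]
  have hcard : (S.card : ℝ) ≤ N := Nat.cast_le.2 (F.card_sSet_le hm T)
  have hsub : ∀ J : Finset S, (J.card : ℝ) ≤ N := fun J =>
    le_trans (by exact_mod_cast (Finset.card_le_univ J).trans_eq (Fintype.card_coe S)) hcard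
  -- Nonnegativity of `δs` is not a hypothesis; it is read off from one instance of the stability
  -- condition.
  have hδ0 : 0 ≤ δs := by
    have := F.stable _ hℓ (Classical.arbitrary _) _ (Classical.arbitrary (G.mesh (ℓ + 1))).2
    exact (abs_nonneg _).trans this
  have hmean : ∀ K' : S, G.mean (ℓ + 1) K' (F.combo ℓ T c) =
      ∑ K : S, G.mean (ℓ + 1) K' (t K) * y K := fun K' => by
    rw [hφ]
    change meanL G (ℓ + 1) K' (∑ K : S, y K • t' K) = _
    rw [map_sum]
    refine Finset.sum_congr rfl fun K _ => ?_
    rw [map_smul, smul_eq_mul, mul_comm]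
    rfl
  -- No sparsity is needed here: the whole index set `S` has at most `N` elements, so every pair may
  -- count as related.
  have h1 := half_sum_sq_le (fun K' K : S => G.mean (ℓ + 1) K' (t K)) (fun _ _ => True)
    (δ := δs) (N := N) (fun _ _ h => absurd trivial h) (fun K' K => by
      split_ifs with h
      · rw [h, hone, sub_self, abs_zero]; exact hδ0
      · rw [sub_zero]
        exact hoff K K' K'.1.2 fun h' => h (Subtype.ext (Subtype.ext h')))
    (fun _ J _ => hsub J) (fun _ J _ => hsub J) hδ (zero_le_one.trans hN1) y
  have h2 : ∑ K' : S, (∑ K : S, G.mean (ℓ + 1) K' (t K) * y K) ^ 2 ≤ N * M ^ 2 := by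
    calc _ ≤ ∑ _K' : S, M ^ 2 := Finset.sum_le_sum fun K' _ => by
          rw [← hmean]
          have := abs_le.1 (hM K' K'.2)
          exact sq_le_sq' this.1 this.2
      _ = (S.card : ℝ) * M ^ 2 := by
          rw [Finset.sum_const, Finset.card_univ, Fintype.card_coe, nsmul_eq_mul]
      _ ≤ _ := by gcongr
  have hCθ0 : 0 ≤ Cθ := (aForm_self_nonneg hα hA _).trans (hen (Classical.arbitrary _))
  have h3 := energy_sum_le hα hαβ hA (Finset.univ : Finset S) fun K => y K • t' K
  have h4 : ∀ K : S, energy hα hαβ hA (y K • t' K) (y K • t' K) ≤ y K ^ 2 * Cθ := fun K => by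
    rw [map_smul, map_smul, LinearMap.smul_apply, smul_eq_mul, smul_eq_mul, ← mul_assoc, ← sq]
    exact mul_le_mul_of_nonneg_left (hen K) (sq_nonneg _)
  rw [hφ]
  calc _ ≤ _ := h3
    _ ≤ N * ∑ K : S, y K ^ 2 * Cθ := mul_le_mul (hsub _)
        (Finset.sum_le_sum fun K _ => h4 K)
        (Finset.sum_nonneg fun K _ => energy_self_nonneg hα hαβ hA _) (zero_le_one.trans hN1)
    _ = N * Cθ * ∑ K : S, y K ^ 2 := by rw [← Finset.sum_mul]; ring
    _ ≤ N * Cθ * (2 * (N * M ^ 2)) := by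
        refine mul_le_mul_of_nonneg_left (by linarith) (by positivity)
    _ = _ := by rw [hCθ]; ring

end SLODFamily

/-! ### Level-wise bounds for the overlap and for the projection matrices -/

namespace HSLODFamily

variable {d : ℕ} {G : MeshHierarchy d} {A : E d → Matrix (Fin d) (Fin d) ℝ} {α β δs : ℝ}
  (F : HSLODFamily G A δs) {ℓ : ℕ}

open MeshHierarchy

theorem tsupport_basisFun_subset (i : F.Idx ℓ) :
    tsupport (F.basisFun ℓ i) ⊆ tsupport (F.hslod ℓ i) := by
  rw [basisFun_eq_smul]
  exact tsupport_smul_subset_right (fun _ => (aNorm A G.Ω (F.hslod ℓ i))⁻¹) _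

/-- The functions of level `0` are indexed by the elements of the initial mesh. -/
def zeroEquiv : F.Idx 0 ≃ G.mesh 0 := Equiv.refl _

/-- The element of level `ℓ` to which a function of level `ℓ + 1` belongs. -/
def parent (i : F.Idx (ℓ + 1)) : G.mesh ℓ := Sigma.fst i

/-- The selected child to which a function of level `ℓ + 1` belongs. -/
def child (i : F.Idx (ℓ + 1)) : Cell d := (Sigma.snd i).1

theorem child_mem_keep (i : F.Idx (ℓ + 1)) : F.child i ∈ F.keep ℓ (F.parent i) := (Sigma.snd i).2

theorem hslod_zero (i : F.Idx 0) : F.hslod 0 i = F.slod 0 (F.zeroEquiv i) := rfl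

theorem hslod_succ (i : F.Idx (ℓ + 1)) :
    F.hslod (ℓ + 1) i = F.combo ℓ (F.parent i) (F.coef ℓ (F.parent i) ⟨_, F.child_mem_keep i⟩) :=
  rfl

theorem half_of_mem_keep (hℓ : ℓ + 1 ≤ G.L) (T : G.mesh ℓ) {τ : Cell d} (hτ : τ ∈ F.keep ℓ T) :
    (fun k => τ k / 2) = T.1 :=
  (G.mem_children T.2).1 (F.keep_subset ℓ hℓ T hτ)

theorem half_child (hℓ : ℓ + 1 ≤ G.L) (i : F.Idx (ℓ + 1)) :
    (fun k => F.child i k / 2) = (F.parent i).1 :=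
  F.half_of_mem_keep hℓ _ (F.child_mem_keep i)

/-- Halving the index of the child recovers the parent, so the child alone determines the basis
function. -/
theorem child_injective (hℓ : ℓ + 1 ≤ G.L) :
    Function.Injective (F.child : F.Idx (ℓ + 1) → Cell d) := by
  intro i j h
  have hp : F.parent i = F.parent j := Subtype.ext (by
    rw [← F.half_child hℓ i, ← F.half_child hℓ j, h])
  obtain ⟨T, τ, hτ⟩ := i
  obtain ⟨T', τ', hτ'⟩ := j
  change T = T' at hp
  change τ = τ' at h
  subst hp h
  rfl

theorem card_le_of_abs_zero_sub_le (b : Cell d) (m : ℕ) (I : Finset (F.Idx 0))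
    (h : ∀ i ∈ I, ∀ k, |(F.zeroEquiv i).1 k - b k| ≤ m) : I.card ≤ (4 * m + 2) ^ d :=
  card_le_of_injective_of_abs_sub_le (fun i => (F.zeroEquiv i).1)
    (Subtype.val_injective.comp F.zeroEquiv.injective) b m I h

theorem card_le_of_abs_parent_sub_le (hℓ : ℓ + 1 ≤ G.L) (b : Cell d) (m : ℕ)
    (I : Finset (F.Idx (ℓ + 1))) (h : ∀ i ∈ I, ∀ k, |(F.parent i).1 k - b k| ≤ m) :
    I.card ≤ (4 * m + 2) ^ d :=
  card_le_of_injective_of_abs_half_sub_le _ (F.child_injective hℓ) b m I fun i hi k => by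
    have := congrFun (F.half_child hℓ i) k
    rw [this]
    exact h i hi k

/-- Pick a point of the common open set off the grid planes: each support containing it belongs to
an element whose index is within `m₀` of the index of that point. -/
theorem overlap_zero_le (hd : 1 ≤ d) (hα : 0 < α) (hαβ : α ≤ β)
    (hA : IsCoefficient G.Ω α β A) {m₀ : ℕ} (hm : F.m 0 ≤ m₀) :
    F.overlap 0 ≤ (4 * m₀ + 2) ^ d := by
  classical
  refine Finset.sup_le fun I hI => ?_
  obtain ⟨U, hU, hne, -, h⟩ := (Finset.mem_filter.1 hI).2
  obtain ⟨x, hxU, hx⟩ := exists_mem_notMem_skel (G := G) hU hne (G.size 0)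
  refine F.card_le_of_abs_zero_sub_le (G.idx (G.size 0) x) m₀ I fun i hi k =>
    abs_idx_sub_le hm hx ?_ k
  refine tsupport_subset_region (fun y hy => ?_) (F.tsupport_basisFun_subset i (h i hi hxU))
  rw [hslod_zero]
  exact F.slod_eq_zero hd hα hαβ hA (Nat.zero_le _) _ hy

theorem hslod_succ_eq_zero (hd : 1 ≤ d) (hα : 0 < α) (hαβ : α ≤ β)
    (hA : IsCoefficient G.Ω α β A) (hℓ : ℓ + 1 ≤ G.L) (i : F.Idx (ℓ + 1)) {x : E d}
    (hx : x ∉ G.region ℓ (G.patch ℓ (F.parent i) (F.m (ℓ + 1)))) : F.hslod (ℓ + 1) i x = 0 := by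
  rw [hslod_succ]
  exact F.combo_eq_zero hd hα hαβ hA hℓ _ _ hx

theorem overlap_succ_le (hd : 1 ≤ d) (hα : 0 < α) (hαβ : α ≤ β)
    (hA : IsCoefficient G.Ω α β A) (hℓ : ℓ + 1 ≤ G.L) {m₀ : ℕ} (hm : F.m (ℓ + 1) ≤ m₀) :
    F.overlap (ℓ + 1) ≤ (4 * m₀ + 2) ^ d := by
  classical
  refine Finset.sup_le fun I hI => ?_
  obtain ⟨U, hU, hne, -, h⟩ := (Finset.mem_filter.1 hI).2
  obtain ⟨x, hxU, hx⟩ := exists_mem_notMem_skel (G := G) hU hne (G.size ℓ)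
  exact F.card_le_of_abs_parent_sub_le hℓ (G.idx (G.size ℓ) x) m₀ I fun i hi k =>
    abs_idx_sub_le hm hx (tsupport_subset_region
      (fun y hy => F.hslod_succ_eq_zero hd hα hαβ hA hℓ i hy)
      (F.tsupport_basisFun_subset i (h i hi hxU))) k

theorem le_lamMin_gram {ι κ : Type} [Fintype ι] [DecidableEq ι] [Fintype κ] [Nonempty ι]
    {P : Matrix κ ι ℝ} {c : ℝ} (h : ∀ x, c * ∑ i, x i ^ 2 ≤ ∑ k, (P *ᵥ x) k ^ 2) :
    c ≤ lamMin (Pᵀ * P) := by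
  refine le_lamMin (isHermitian_gram P) fun x => ?_
  rw [dotProduct_gram]
  simpa [dotProduct, sq] using h x

theorem lamMin_gram_mul_le {ι κ : Type} [Fintype ι] [DecidableEq ι] [Fintype κ]
    (P : Matrix κ ι ℝ) (x : ι → ℝ) :
    lamMin (Pᵀ * P) * ∑ i, x i ^ 2 ≤ ∑ k, (P *ᵥ x) k ^ 2 := by
  have h := lamMin_mul_le (isHermitian_gram P) x
  rw [dotProduct_gram] at h
  simpa [dotProduct, sq] using h

/-- `P` is the matrix of means of the rescaled functions times the diagonal matrix of the factors
`z`. The first is a sparse perturbation of the identity; the normalization `z² a(t, t) = 1` and the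
energy bound give `z² H^(d-2) ≥ 1/c`. -/
theorem le_lamMin_pHat_zero (hd : 1 ≤ d) (hα : 0 < α) (hαβ : α ≤ β)
    (hA : IsCoefficient G.Ω α β A) {m₀ : ℕ} (hm : F.m 0 ≤ m₀)
    (hδ : (((4 * m₀ + 2) ^ d : ℕ) : ℝ) * δs ≤ 1 / 4) :
    1 / (2 * ((((2 * m₀ + 1) ^ d : ℕ) : ℝ) ^ 2 * (d * 81 ^ d * β))) ≤
      lamMin ((F.pHat 0)ᵀ * F.pHat 0) := by
  set N : ℝ := (((4 * m₀ + 2) ^ d : ℕ) : ℝ) with hN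
  have hN1 : 1 ≤ N := by
    rw [hN]; exact_mod_cast Nat.one_le_pow _ _ (by omega)
  have hδ1 : δs < 1 := by nlinarith
  have := F.nonempty_idx hd (Nat.zero_le G.L)
  choose t ht z hz hslod hone hoff hzero hen hnorm using
    F.exists_slod_eq_smul hd hα hαβ hA (Nat.zero_le G.L) hδ1 hm
  have hδ0 : 0 ≤ δs := by
    have := F.stable _ (Nat.zero_le G.L) (Classical.arbitrary _) _
      (Classical.arbitrary (G.mesh 0)).2
    exact (abs_nonneg _).trans this
  set c := (((2 * m₀ + 1) ^ d : ℕ) : ℝ) ^ 2 * (d * 81 ^ d * β) with hc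
  have hd0 : (0 : ℝ) < d := by exact_mod_cast hd
  have hβ : 0 < β := hα.trans_le hαβ
  have hc0 : 0 < c := by positivity
  set s := G.size 0 ^ d / G.size 0 ^ 2 with hs
  have hs0 : 0 < s := by have := G.size_pos 0; positivity
  have hz2 : ∀ T, 1 ≤ c * (s * z T ^ 2) := fun T => by
    calc 1 = z T ^ 2 * aForm A G.Ω (t T) (t T) := (hnorm T).symm
      _ ≤ z T ^ 2 * (c * s) := mul_le_mul_of_nonneg_left (hen T) (sq_nonneg _)
      _ = _ := by ring
  let e := F.zeroEquiv
  have hP : ∀ (K : G.mesh 0) (i : F.Idx 0), F.pMat 0 K i = z (e i) * G.mean 0 K (t (e i)) := by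
    intro K i
    have h1 : F.basisFun 0 i = z (e i) • t (e i) := by
      -- The SLOD function already has unit energy on `Ω`, so the normalization of the hierarchical
      -- basis does nothing on level `0`.
      have h2 : aForm A G.Ω (z (e i) • t (e i)) (z (e i) • t (e i)) = 1 := by
        rw [← hnorm (e i)]
        change energy hα hαβ hA (z (e i) • ⟨_, ht (e i)⟩) (z (e i) • ⟨_, ht (e i)⟩) = _
        rw [map_smul, map_smul, LinearMap.smul_apply, smul_eq_mul, smul_eq_mul, ← mul_assoc, ← sq]
        rfl
      rw [basisFun_eq_smul, hslod_zero, hslod, aNorm, h2, Real.sqrt_one, inv_one, one_smul]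
    change G.mean 0 K (F.basisFun 0 i) = _
    rw [h1]
    exact (meanL G 0 K).map_smul (z (e i)) ⟨t (e i), ht (e i)⟩
  refine le_lamMin_gram fun x => ?_
  rw [sum_pHat_mulVec_sq, ← hs]
  have h1 := half_sum_sq_le (fun i j : F.Idx 0 => G.mean 0 (e i) (t (e j)))
    (fun i j => ∀ k, |(e i).1 k - (e j).1 k| ≤ m₀) (δ := δs) (N := N)
    (fun i j h => by
      rw [if_neg]
      · refine hzero (e j) (e i) fun hK => h fun k =>
          (G.abs_sub_le_of_mem_patch hK k).trans ?_
        exact_mod_cast hm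
      · rintro rfl
        exact h fun k => by simp)
    (fun i j => by
      split_ifs with h
      · rw [h, hone, sub_self, abs_zero]; exact hδ0
      · rw [sub_zero]
        exact hoff _ _ (e i).2 fun h' => h (e.injective (Subtype.ext h')))
    (fun i J h => Nat.cast_le.2 (F.card_le_of_abs_zero_sub_le (e i).1 m₀ J fun j hj k => by
      rw [abs_sub_comm]; exact h j hj k))
    (fun j I h => Nat.cast_le.2 (F.card_le_of_abs_zero_sub_le (e j).1 m₀ I h))
    hδ (zero_le_one.trans hN1) fun i => z (e i) * x i
  have h2 : ∀ K : G.mesh 0, (F.pMat 0 *ᵥ x) K =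
      ∑ j, G.mean 0 K (t (e j)) * (z (e j) * x j) :=
    fun K => Finset.sum_congr rfl fun j _ => by
      simp only
      rw [hP]; ring
  calc 1 / (2 * c) * ∑ i, x i ^ 2
      ≤ 1 / (2 * c) * ∑ i, c * (s * z (e i) ^ 2) * x i ^ 2 := by
        gcongr with i
        exact le_mul_of_one_le_left (sq_nonneg _) (hz2 (e i))
    _ = s * (1 / 2 * ∑ i, (z (e i) * x i) ^ 2) := by
        rw [Finset.mul_sum, Finset.mul_sum, Finset.mul_sum]
        refine Finset.sum_congr rfl fun T _ => ?_
        field_simp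
    _ ≤ s * ∑ K, (F.pMat 0 *ᵥ x) K ^ 2 := by
        simp only [h2]
        rw [← e.sum_comp]
        exact mul_le_mul_of_nonneg_left h1 hs0.le

end HSLODFamily

namespace HSLODFamily

variable {d : ℕ} {G : MeshHierarchy d} {A : E d → Matrix (Fin d) (Fin d) ℝ} {α β δs : ℝ}
  (F : HSLODFamily G A δs) {ℓ : ℕ}

open MeshHierarchy

theorem sq_mean_sub_le_residual {T T' : G.mesh ℓ} (hT' : T'.1 ∈ G.patch ℓ T (F.m (ℓ + 1)))
    {K : Cell d} (hK : K ∈ F.keep ℓ T') (τ : Cell d) (v : E d → ℝ) :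
    (G.mean (ℓ + 1) K v - if K = τ then 1 else 0) ^ 2 ≤ F.residual ℓ (F.keep ℓ) T τ v := by
  classical
  rw [SLODFamily.residual]
  refine le_trans ?_ (Finset.single_le_sum
    (f := fun T' => ∑ K ∈ F.keep ℓ T', (G.mean (ℓ + 1) K v - if K = τ then 1 else 0) ^ 2)
    (fun T' _ => Finset.sum_nonneg fun K _ => sq_nonneg _)
    (Finset.mem_filter.2 ⟨Finset.mem_univ T', G.elem_subset_region_iff.2 hT'⟩))
  refine le_of_eq_of_le ?_ (Finset.single_le_sum
    (f := fun K => (G.mean (ℓ + 1) K v - if K = τ then 1 else 0) ^ 2)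
    (fun K _ => sq_nonneg _) hK)
  congr

/-- A crude count suffices: every term is at most one, and there are at most `(2 m₀ + 1)^d` parents
with at most `2^d` selected children each. -/
theorem residual_zero_le (hℓ : ℓ + 1 ≤ G.L) {m₀ : ℕ} (hm : F.m (ℓ + 1) ≤ m₀) (T : G.mesh ℓ)
    (τ : Cell d) :
    F.residual ℓ (F.keep ℓ) T τ 0 ≤ (((4 * m₀ + 2) ^ d : ℕ) : ℝ) := by
  classical
  have h0 : ∀ K, G.mean (ℓ + 1) K (0 : E d → ℝ) = 0 := fun K => (meanL G (ℓ + 1) K).map_zero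
  rw [SLODFamily.residual]
  set S := (Finset.univ : Finset (G.mesh ℓ)).filter fun T' : G.mesh ℓ =>
    G.elem ℓ T' ⊆ F.bigPatch ℓ T with hS
  have hcard : S.card ≤ (2 * m₀ + 1) ^ d := by
    rw [← Finset.card_image_of_injective S Subtype.val_injective]
    refine card_le_of_abs_sub_le (T := T) fun z hz k => ?_
    obtain ⟨T', hT', rfl⟩ := Finset.mem_image.1 hz
    exact (G.abs_sub_le_of_mem_patch
      (G.elem_subset_region_iff.1 (Finset.mem_filter.1 hT').2) k).trans (by exact_mod_cast hm)
  calc _ ≤ ∑ T' ∈ S, ∑ _K ∈ F.keep ℓ T', (1 : ℝ) := by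
        refine Finset.sum_le_sum fun T' _ => Finset.sum_le_sum fun K _ => ?_
        rw [h0]
        split_ifs <;> norm_num
    _ ≤ ∑ _T' ∈ S, (2 : ℝ) ^ d := by
        refine Finset.sum_le_sum fun T' _ => ?_
        rw [Finset.sum_const, nsmul_eq_mul, mul_one, F.keep_card ℓ hℓ T']
        exact_mod_cast Nat.sub_le _ _
    _ = S.card * (2 : ℝ) ^ d := by rw [Finset.sum_const, nsmul_eq_mul]
    _ ≤ ((2 * m₀ + 1) ^ d : ℕ) * (2 : ℝ) ^ d := by gcongr
    _ = _ := by push_cast; rw [← mul_pow]; ring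

theorem combo_zero (T : G.mesh ℓ) : F.combo ℓ T 0 = 0 := by
  funext x
  simp [SLODFamily.combo]

/-- The zero combination satisfies the mean constraint and so competes in the least-squares problem.
-/
theorem residual_hslod_le (hℓ : ℓ + 1 ≤ G.L) {m₀ : ℕ} (hm : F.m (ℓ + 1) ≤ m₀)
    (i : F.Idx (ℓ + 1)) :
    F.residual ℓ (F.keep ℓ) (F.parent i) (F.child i) (F.hslod (ℓ + 1) i) ≤
      (((4 * m₀ + 2) ^ d : ℕ) : ℝ) := by
  refine le_trans ?_ (F.residual_zero_le hℓ hm (F.parent i) (F.child i))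
  rw [← F.combo_zero (F.parent i), hslod_succ]
  refine F.leastSquares ℓ hℓ (F.parent i) ⟨_, F.child_mem_keep i⟩ 0 fun T _ => ?_
  rw [combo_zero]
  exact (meanL G ℓ T).map_zero

theorem mean_hslod_succ (hℓ : ℓ + 1 ≤ G.L) (i : F.Idx (ℓ + 1)) {T : Cell d}
    (hT : T ∈ G.mesh ℓ) : G.mean ℓ T (F.hslod (ℓ + 1) i) = 0 :=
  F.meanFree ℓ hℓ (F.parent i) ⟨_, F.child_mem_keep i⟩ T hT

/-- The means on all elements in the patch are bounded. -/
theorem abs_mean_hslod_le (hd : 1 ≤ d) (hα : 0 < α) (hαβ : α ≤ β)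
    (hA : IsCoefficient G.Ω α β A) (hℓ : ℓ + 1 ≤ G.L) {m₀ : ℕ} (hm : F.m (ℓ + 1) ≤ m₀)
    (i : F.Idx (ℓ + 1)) {K : Cell d}
    (hK : (fun k => K k / 2) ∈ G.patch ℓ (F.parent i) (F.m (ℓ + 1))) :
    |G.mean (ℓ + 1) K (F.hslod (ℓ + 1) i)| ≤ 2 ^ d * (2 * (((4 * m₀ + 2) ^ d : ℕ) : ℝ)) := by
  classical
  set N : ℝ := (((4 * m₀ + 2) ^ d : ℕ) : ℝ) with hN
  have hN1 : 1 ≤ N := by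
    rw [hN]; exact_mod_cast Nat.one_le_pow _ _ (by omega)
  have h2d : (1 : ℝ) ≤ 2 ^ d := one_le_pow₀ (by norm_num)
  set T' : G.mesh ℓ := ⟨_, G.patch_subset_mesh (F.parent i).2 _ hK⟩ with hT'
  have hkeep : ∀ K' ∈ F.keep ℓ T', |G.mean (ℓ + 1) K' (F.hslod (ℓ + 1) i)| ≤ 2 * N := by
    intro K' hK'
    have h1 := (F.sq_mean_sub_le_residual (T' := T') hK hK' (F.child i)
      (F.hslod (ℓ + 1) i)).trans (F.residual_hslod_le hℓ hm i)
    -- The square is at most `N`, hence at most `N²` because `N ≥ 1`.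
    have h2 : |G.mean (ℓ + 1) K' (F.hslod (ℓ + 1) i) - if K' = F.child i then 1 else 0| ≤ N :=
      abs_le_of_sq_le_sq (h1.trans (by nlinarith)) (by linarith)
    have h3 : |(if K' = F.child i then (1 : ℝ) else 0)| ≤ 1 := by split_ifs <;> norm_num
    rw [abs_le] at h2 h3 ⊢
    constructor <;> linarith
  by_cases hKk : K ∈ F.keep ℓ T'
  · exact (hkeep K hKk).trans (le_mul_of_one_le_left (by positivity) h2d)
  -- `K` is the only child of `T'` that is not selected. The mean on `T'` vanishes, so the mean on
  -- `K` is minus the sum of those on the selected siblings.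
  · have hKc : K ∈ children G ℓ T' := (G.mem_children T'.2).2 rfl
    have hins : insert K (F.keep ℓ T') = children G ℓ T' := by
      refine Finset.eq_of_subset_of_card_le
        (Finset.insert_subset hKc (F.keep_subset ℓ hℓ T')) ?_
      rw [Finset.card_insert_of_notMem hKk, F.keep_card ℓ hℓ, G.card_children T'.2]
      have : 1 ≤ 2 ^ d := Nat.one_le_two_pow
      omega
    have hsum := FE.sum_mean_children (F.hslod_mem_FE hd hα hαβ hA hℓ i) T'.2
    rw [F.mean_hslod_succ hℓ i T'.2, mul_zero] at hsum
    replace hsum := (mul_eq_zero.1 hsum).resolve_left (pow_pos (G.size_pos _) d).ne'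
    rw [← hins, Finset.sum_insert hKk, add_eq_zero_iff_eq_neg] at hsum
    rw [hsum, abs_neg]
    refine (Finset.abs_sum_le_sum_abs _ _).trans ((Finset.sum_le_sum hkeep).trans ?_)
    rw [Finset.sum_const, nsmul_eq_mul, F.keep_card ℓ hℓ]
    gcongr
    exact_mod_cast Nat.sub_le _ _

/-- The constant in the bound for the energy of the functions before normalization. -/
noncomputable def energyConst (d m₀ : ℕ) (β : ℝ) : ℝ :=
  2 * (((4 * m₀ + 2) ^ d : ℕ) : ℝ) ^ 2 * (2 ^ d * (2 * (((4 * m₀ + 2) ^ d : ℕ) : ℝ))) ^ 2 *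
    ((((2 * m₀ + 1) ^ d : ℕ) : ℝ) ^ 2 * (d * 81 ^ d * β))

theorem aForm_hslod_le (hd : 1 ≤ d) (hα : 0 < α) (hαβ : α ≤ β)
    (hA : IsCoefficient G.Ω α β A) (hℓ : ℓ + 1 ≤ G.L) {m₀ : ℕ} (hm : F.m (ℓ + 1) ≤ m₀)
    (hδ : (((4 * m₀ + 2) ^ d : ℕ) : ℝ) * δs ≤ 1 / 4) (i : F.Idx (ℓ + 1)) :
    aForm A G.Ω (F.hslod (ℓ + 1) i) (F.hslod (ℓ + 1) i) ≤
      energyConst d m₀ β * (G.size (ℓ + 1) ^ d / G.size (ℓ + 1) ^ 2) := by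
  have h := fun K hK => F.abs_mean_hslod_le hd hα hαβ hA hℓ hm i (K := K) hK
  rw [hslod_succ] at h ⊢
  exact F.aForm_combo_le hd hα hαβ hA hℓ hm hδ (F.parent i) _ fun K hK =>
    h K (F.mem_patch_of_mem_sSet hK)

theorem energyConst_pos (hd : 1 ≤ d) (hβ : 0 < β) (m₀ : ℕ) : 0 < energyConst d m₀ β := by
  have hd0 : (0 : ℝ) < d := by exact_mod_cast hd
  rw [energyConst]
  positivity

/-- The constant of level `0` is dominated by that of the other levels, so one constant serves in
the final statement. -/
theorem le_energyConst (hβ : 0 < β) (m₀ : ℕ) :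
    2 * ((((2 * m₀ + 1) ^ d : ℕ) : ℝ) ^ 2 * (d * 81 ^ d * β)) ≤ energyConst d m₀ β := by
  have hN1 : (1 : ℝ) ≤ (((4 * m₀ + 2) ^ d : ℕ) : ℝ) := by
    exact_mod_cast Nat.one_le_pow _ _ (by omega)
  have h2d : (1 : ℝ) ≤ 2 ^ d := one_le_pow₀ (by norm_num)
  refine mul_le_mul_of_nonneg_right ?_ (by positivity)
  rw [mul_assoc]
  refine le_mul_of_one_le_right (by norm_num) ?_
  exact one_le_mul_of_one_le_of_one_le (one_le_pow₀ hN1)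
    (one_le_pow₀ (one_le_mul_of_one_le_of_one_le h2d (by linarith)))

/-- A function of zero energy vanishes and produces a zero column of `P̃`, which would make the
smallest eigenvalue of the Gram matrix nonpositive. -/
theorem aNorm_hslod_pos (hd : 1 ≤ d) (hα : 0 < α) (hαβ : α ≤ β)
    (hA : IsCoefficient G.Ω α β A) (hℓ : ℓ ≤ G.L)
    (h : 0 < lamMin ((F.pTilde ℓ)ᵀ * F.pTilde ℓ)) (i : F.Idx ℓ) :
    0 < aNorm A G.Ω (F.hslod ℓ i) := by
  refine lt_of_le_of_ne (Real.sqrt_nonneg _) fun h0 => ?_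
  have h1 : F.hslod ℓ i = 0 :=
    FE.eq_zero_of_aForm_eq_zero hd hα hαβ hA (F.hslod_mem_FE hd hα hαβ hA hℓ i)
      ((Real.sqrt_eq_zero (aForm_self_nonneg hα hA _)).1 h0.symm)
  have h2 := lamMin_gram_mul_le (F.pTilde ℓ) (Pi.single i 1)
  have h3 : ∀ K, (F.pTilde ℓ *ᵥ Pi.single i 1) K = 0 := fun K => by
    rw [Matrix.mulVec_single_one]
    change G.mean ℓ K (F.hslod ℓ i) = 0
    rw [h1]
    exact (meanL G ℓ K).map_zero
  have h4 : ∑ j, (Pi.single i 1 : F.Idx ℓ → ℝ) j ^ 2 = 1 := by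
    simp [Pi.single_apply]
  rw [h4] at h2
  simp only [h3] at h2
  norm_num at h2
  linarith

/-- `P` is `P̃` with its columns divided by the energy norms, whose squares are at most `c H^(d-2)`;
the scaling of `P̂` cancels the power of `H`. -/
theorem le_lamMin_pHat_succ (hd : 1 ≤ d) (hα : 0 < α) (hαβ : α ≤ β)
    (hA : IsCoefficient G.Ω α β A) (hℓ : ℓ + 1 ≤ G.L) {m₀ : ℕ} (hm : F.m (ℓ + 1) ≤ m₀)
    (hδ : (((4 * m₀ + 2) ^ d : ℕ) : ℝ) * δs ≤ 1 / 4)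
    (h : 0 < lamMin ((F.pTilde (ℓ + 1))ᵀ * F.pTilde (ℓ + 1))) :
    lamMin ((F.pTilde (ℓ + 1))ᵀ * F.pTilde (ℓ + 1)) / energyConst d m₀ β ≤
      lamMin ((F.pHat (ℓ + 1))ᵀ * F.pHat (ℓ + 1)) := by
  have := F.nonempty_idx hd hℓ
  have hc := energyConst_pos hd (hα.trans_le hαβ) m₀
  set c := energyConst d m₀ β
  set lam := lamMin ((F.pTilde (ℓ + 1))ᵀ * F.pTilde (ℓ + 1))
  set s := G.size (ℓ + 1) ^ d / G.size (ℓ + 1) ^ 2 with hs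
  have hs0 : 0 < s := by have := G.size_pos (ℓ + 1); positivity
  set n := fun i => aNorm A G.Ω (F.hslod (ℓ + 1) i) with hn
  have hn0 : ∀ i, 0 < n i := F.aNorm_hslod_pos hd hα hαβ hA hℓ h
  have hn2 : ∀ i, n i ^ 2 ≤ c * s := fun i => by
    rw [hn]
    simp only [aNorm]
    rw [Real.sq_sqrt (aForm_self_nonneg hα hA _)]
    exact F.aForm_hslod_le hd hα hαβ hA hℓ hm hδ i
  refine le_lamMin_gram fun x => ?_
  rw [sum_pHat_mulVec_sq, ← hs]
  have h1 := lamMin_gram_mul_le (F.pTilde (ℓ + 1)) fun i => (n i)⁻¹ * x i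
  have h2 : F.pTilde (ℓ + 1) *ᵥ (fun i => (n i)⁻¹ * x i) = F.pMat (ℓ + 1) *ᵥ x := by
    funext K
    refine Finset.sum_congr rfl fun i _ => ?_
    have h3 : F.pMat (ℓ + 1) K i = (n i)⁻¹ * F.pTilde (ℓ + 1) K i := by
      change G.mean (ℓ + 1) K (F.basisFun (ℓ + 1) i) = _
      rw [basisFun_eq_smul]
      exact (meanL G (ℓ + 1) K).map_smul (n i)⁻¹ ⟨_, F.hslod_mem_FE hd hα hαβ hA hℓ i⟩
    simp only [h3]
    ring
  rw [h2] at h1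
  calc lam / c * ∑ i, x i ^ 2 ≤ s * (lam * ∑ i, ((n i)⁻¹ * x i) ^ 2) := by
        rw [Finset.mul_sum, Finset.mul_sum, Finset.mul_sum]
        refine Finset.sum_le_sum fun i _ => ?_
        have h4 : s * (lam * ((n i)⁻¹ * x i) ^ 2) = lam * x i ^ 2 * (s / n i ^ 2) := by
          rw [mul_pow, inv_pow]; ring
        have h5 : lam / c * x i ^ 2 = lam * x i ^ 2 * (1 / c) := by ring
        rw [h4, h5]
        refine mul_le_mul_of_nonneg_left ?_ (by positivity)
        rw [div_le_div_iff₀ hc (pow_pos (hn0 i) 2), one_mul, mul_comm s]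
        exact hn2 i
    _ ≤ _ := mul_le_mul_of_nonneg_left h1 hs0.le

/-- The rows of `P̃` at the selected children form a square matrix. Within a patch its entries
differ from those of the identity by at most the least-squares error; outside the patch they vanish.
-/
theorem half_le_lamMin_pTilde (hd : 1 ≤ d) (hα : 0 < α) (hαβ : α ≤ β)
    (hA : IsCoefficient G.Ω α β A) (hℓ : ℓ + 1 ≤ G.L) {m₀ : ℕ} (hm : F.m (ℓ + 1) ≤ m₀)
    {ε : ℝ} (hε : (((4 * m₀ + 2) ^ d : ℕ) : ℝ) * ε ≤ 1 / 4)
    (he : ∀ i, F.lsqError (ℓ + 1) i ≤ ε) :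
    1 / 2 ≤ lamMin ((F.pTilde (ℓ + 1))ᵀ * F.pTilde (ℓ + 1)) := by
  have := F.nonempty_idx hd hℓ
  have hε0 : 0 ≤ ε := by
    obtain ⟨i⟩ := this
    exact (Real.sqrt_nonneg _).trans (he i)
  have hzero : ∀ i j : F.Idx (ℓ + 1),
      (F.parent i).1 ∉ G.patch ℓ (F.parent j) (F.m (ℓ + 1)) →
        G.mean (ℓ + 1) (F.child i) (F.hslod (ℓ + 1) j) = 0 := fun i j h => by
    refine mean_succ_eq_zero_of_notMem ?_ fun x hx =>
      F.hslod_succ_eq_zero hd hα hαβ hA hℓ j hx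
    rwa [F.half_child hℓ]
  have hdelta : ∀ i j : F.Idx (ℓ + 1),
      (if i = j then (1 : ℝ) else 0) = if F.child i = F.child j then 1 else 0 := fun i j => by
    simp only [(F.child_injective hℓ).eq_iff]
  have hself : ∀ i j : F.Idx (ℓ + 1),
      (F.parent i).1 ∉ G.patch ℓ (F.parent j) (F.m (ℓ + 1)) → i ≠ j := by
    rintro i j h rfl
    exact h (G.self_mem_patch ℓ (F.parent i).2 _)
  refine le_lamMin_gram fun x => ?_
  have h1 := half_sum_sq_le
    (fun i j : F.Idx (ℓ + 1) => G.mean (ℓ + 1) (F.child i) (F.hslod (ℓ + 1) j))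
    (fun i j => ∀ k, |(F.parent i).1 k - (F.parent j).1 k| ≤ m₀) (δ := ε)
    (N := (((4 * m₀ + 2) ^ d : ℕ) : ℝ))
    (fun i j h => by
      have h' : (F.parent i).1 ∉ G.patch ℓ (F.parent j) (F.m (ℓ + 1)) := fun hK =>
        h fun k => (G.abs_sub_le_of_mem_patch hK k).trans (by exact_mod_cast hm)
      rw [if_neg (hself i j h'), hzero i j h'])
    (fun i j => by
      by_cases h' : (F.parent i).1 ∈ G.patch ℓ (F.parent j) (F.m (ℓ + 1))
      · rw [hdelta]
        exact (Real.abs_le_sqrt (F.sq_mean_sub_le_residual h' (F.child_mem_keep i) _ _)).trans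
          (he j)
      · rw [if_neg (hself i j h'), hzero i j h', sub_zero, abs_zero]
        exact hε0)
    (fun i J h => Nat.cast_le.2
      (F.card_le_of_abs_parent_sub_le hℓ (F.parent i).1 m₀ J fun j hj k => by
        rw [abs_sub_comm]; exact h j hj k))
    (fun j I h => Nat.cast_le.2 (F.card_le_of_abs_parent_sub_le hℓ (F.parent j).1 m₀ I h))
    hε (Nat.cast_nonneg _) x
  refine h1.trans ?_
  have hmem : ∀ i : F.Idx (ℓ + 1), F.child i ∈ G.mesh (ℓ + 1) := fun i => by
    rw [mem_mesh_succ, F.half_child hℓ]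
    exact (F.parent i).2
  -- The embedding picks the rows of the selected children; the remaining rows only add nonnegative
  -- squares.
  let e : F.Idx (ℓ + 1) ↪ G.mesh (ℓ + 1) :=
    ⟨fun i => ⟨F.child i, hmem i⟩, fun i j h => F.child_injective hℓ (congrArg Subtype.val h)⟩
  calc _ = ∑ K ∈ Finset.univ.map e, (F.pTilde (ℓ + 1) *ᵥ x) K ^ 2 := by
        rw [Finset.sum_map]; rfl
    _ ≤ _ := Finset.sum_le_univ_sum_of_nonneg fun K => sq_nonneg _

end HSLODFamily

end HSLOD

/-! ### Assembly of the constants -/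

theorem mainTheorem1 (d : ℕ) (hd : 1 ≤ d) (hd3 : d ≤ 3) :
    (∀ (α β : ℝ), 0 < α → α ≤ β →
      ∀ (G : MeshHierarchy d) (A : E d → Matrix (Fin d) (Fin d) ℝ), IsCoefficient G.Ω α β A →
      ∀ (δs : ℝ) (F : HSLODFamily G A δs) (ℓ : Fin (G.L + 1)),
        (0 < ℓ.val →
          Real.pi ^ 2 * α / 4 * lamMin ((F.pHat ℓ)ᵀ * F.pHat ℓ) ≤ lamMin (F.block ℓ)) ∧
        (ℓ.val = 0 →
          Real.pi ^ 2 * α / Metric.diam G.Ω ^ 2 * G.size ℓ ^ 2 *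
            lamMin ((F.pHat ℓ)ᵀ * F.pHat ℓ) ≤ lamMin (F.block ℓ)) ∧
        (0 < lamMin ((F.pHat ℓ)ᵀ * F.pHat ℓ) →
          0 < lamMin (F.block ℓ) ∧
          (0 < ℓ.val →
            condNum (F.block ℓ) ≤
              4 * F.overlap ℓ / (Real.pi ^ 2 * α * lamMin ((F.pHat ℓ)ᵀ * F.pHat ℓ))) ∧
          (ℓ.val = 0 →
            condNum (F.block ℓ) ≤
              Metric.diam G.Ω ^ 2 * F.overlap ℓ /
                (Real.pi ^ 2 * α * lamMin ((F.pHat ℓ)ᵀ * F.pHat ℓ)) * (G.size ℓ ^ 2)⁻¹))) ∧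
    (∀ m₀ : ℕ, ∃ δ₀ > 0, ∃ ε₀ > 0, ∀ (α β : ℝ), 0 < α → α ≤ β → ∃ C > 0,
      ∀ (G : MeshHierarchy d) (A : E d → Matrix (Fin d) (Fin d) ℝ), IsCoefficient G.Ω α β A →
      ∀ (δs : ℝ), δs ≤ δ₀ → ∀ F : HSLODFamily G A δs, (∀ ℓ ≤ G.L, F.m ℓ ≤ m₀) →
      ∀ ℓ : Fin (G.L + 1),
        (ℓ.val = 0 →
          0 < lamMin ((F.pHat ℓ)ᵀ * F.pHat ℓ) ∧
          (lamMin ((F.pHat ℓ)ᵀ * F.pHat ℓ))⁻¹ ≤ C ∧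
          condNum (F.block ℓ) ≤ C * Metric.diam G.Ω ^ 2 * (G.size ℓ ^ 2)⁻¹) ∧
        (0 < ℓ.val → 0 < lamMin ((F.pTilde ℓ)ᵀ * F.pTilde ℓ) →
          0 < lamMin ((F.pHat ℓ)ᵀ * F.pHat ℓ) ∧
          (lamMin ((F.pHat ℓ)ᵀ * F.pHat ℓ))⁻¹ ≤ C / lamMin ((F.pTilde ℓ)ᵀ * F.pTilde ℓ) ∧
          condNum (F.block ℓ) ≤ C / lamMin ((F.pTilde ℓ)ᵀ * F.pTilde ℓ)) ∧
        (0 < ℓ.val → (∀ i, F.lsqError ℓ i ≤ ε₀) →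
          1 / 2 ≤ lamMin ((F.pTilde ℓ)ᵀ * F.pTilde ℓ) ∧
          0 < lamMin ((F.pHat ℓ)ᵀ * F.pHat ℓ) ∧
          (lamMin ((F.pHat ℓ)ᵀ * F.pHat ℓ))⁻¹ ≤ C ∧
          condNum (F.block ℓ) ≤ C)) := by
  refine ⟨fun α β hα hαβ G A hA δs F ℓ => ⟨F.lamMin_block_ge_of_pos hd hα hαβ hA ℓ,
    fun _ => F.lamMin_block_ge_of_eq_zero hd hα hαβ hA ℓ, fun h =>
      ⟨F.lamMin_block_pos hd hα hαβ hA ℓ h, fun h0 => F.condNum_block_le_of_pos hd hα hαβ hA ℓ h0 h,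
        fun _ => F.condNum_block_le_diam hd hα hαβ hA ℓ h⟩⟩, fun m₀ => ?_⟩
  set N : ℝ := (((4 * m₀ + 2) ^ d : ℕ) : ℝ) with hN
  have hN1 : 1 ≤ N := by
    rw [hN]; exact_mod_cast Nat.one_le_pow _ _ (by omega)
  have hN0 : 0 < N := zero_lt_one.trans_le hN1
  have hpi := Real.pi_pos
  -- Both thresholds are what the perturbation lemma asks for, `N δ ≤ 1/4`, and they do not depend
  -- on `α` and `β`.
  refine ⟨1 / (4 * N), by positivity, 1 / (4 * N), by positivity, fun α β hα hαβ => ?_⟩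
  have hβ : 0 < β := hα.trans_le hαβ
  have hsmall : ∀ {t : ℝ}, t ≤ 1 / (4 * N) → N * t ≤ 1 / 4 := fun {t} ht => by
    calc N * t ≤ N * (1 / (4 * N)) := by gcongr
      _ = 1 / 4 := by field_simp
  set c := HSLODFamily.energyConst d m₀ β with hc
  have hc0 : 0 < c := HSLODFamily.energyConst_pos hd hβ m₀
  -- The first summand serves the inverse eigenvalues, the second the condition numbers. Each
  -- carries a factor `2` for the case `lamMin (P̃ᵀ P̃) ≥ 1/2`.
  set C := 2 * c + 8 * N * c / (Real.pi ^ 2 * α) with hC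
  have hC1 : 2 * c ≤ C := le_add_of_nonneg_right (by positivity)
  have hC2 : 8 * N * c / (Real.pi ^ 2 * α) ≤ C := le_add_of_nonneg_left (by positivity)
  refine ⟨C, by positivity, fun G A hA δs hδ F hm ℓ => ?_⟩
  obtain ⟨ℓ, hℓ'⟩ := ℓ
  have hℓ : ℓ ≤ G.L := Nat.lt_succ_iff.1 hℓ'
  rcases ℓ with _ | ℓ
  · refine ⟨fun _ => ?_, fun h => absurd h (lt_irrefl _), fun h => absurd h (lt_irrefl _)⟩
    have h1 : 1 / c ≤ lamMin ((F.pHat 0)ᵀ * F.pHat 0) := by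
      refine le_trans ?_ (F.le_lamMin_pHat_zero hd hα hαβ hA (hm 0 hℓ) (hsmall hδ))
      have hd0 : (0 : ℝ) < d := by exact_mod_cast hd
      exact one_div_le_one_div_of_le (by positivity) (HSLODFamily.le_energyConst hβ m₀)
    have hlam : 0 < lamMin ((F.pHat 0)ᵀ * F.pHat 0) := lt_of_lt_of_le (by positivity) h1
    have hinv : (lamMin ((F.pHat 0)ᵀ * F.pHat 0))⁻¹ ≤ c := by
      rw [inv_le_comm₀ hlam hc0, ← one_div]; exact h1
    refine ⟨hlam, hinv.trans (by linarith), ?_⟩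
    have hov : (F.overlap 0 : ℝ) ≤ N := Nat.cast_le.2 (F.overlap_zero_le hd hα hαβ hA (hm 0 hℓ))
    refine (F.condNum_block_le_diam hd hα hαβ hA ⟨0, hℓ'⟩ hlam).trans ?_
    refine mul_le_mul_of_nonneg_right ?_ (inv_nonneg.2 (sq_nonneg _))
    calc Metric.diam G.Ω ^ 2 * F.overlap 0 / (Real.pi ^ 2 * α * lamMin ((F.pHat 0)ᵀ * F.pHat 0))
        = F.overlap 0 * (lamMin ((F.pHat 0)ᵀ * F.pHat 0))⁻¹ / (Real.pi ^ 2 * α) *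
          Metric.diam G.Ω ^ 2 := by field_simp
      _ ≤ C * Metric.diam G.Ω ^ 2 := by
        refine mul_le_mul_of_nonneg_right (le_trans ?_ hC2) (sq_nonneg _)
        refine div_le_div_of_nonneg_right ?_ (by positivity)
        calc (F.overlap 0 : ℝ) * (lamMin ((F.pHat 0)ᵀ * F.pHat 0))⁻¹ ≤ N * c :=
              mul_le_mul hov hinv (inv_nonneg.2 hlam.le) hN0.le
          _ ≤ 8 * N * c := by nlinarith [mul_pos hN0 hc0]
  · have hmℓ := hm (ℓ + 1) hℓ
    have hov : (F.overlap (ℓ + 1) : ℝ) ≤ N :=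
      Nat.cast_le.2 (F.overlap_succ_le hd hα hαβ hA hℓ hmℓ)
    have key : 0 < lamMin ((F.pTilde (ℓ + 1))ᵀ * F.pTilde (ℓ + 1)) →
        0 < lamMin ((F.pHat (ℓ + 1))ᵀ * F.pHat (ℓ + 1)) ∧
        (lamMin ((F.pHat (ℓ + 1))ᵀ * F.pHat (ℓ + 1)))⁻¹ ≤
          c / lamMin ((F.pTilde (ℓ + 1))ᵀ * F.pTilde (ℓ + 1)) ∧
        condNum (F.block ⟨ℓ + 1, hℓ'⟩) ≤ 4 * N * c / (Real.pi ^ 2 * α) /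
          lamMin ((F.pTilde (ℓ + 1))ᵀ * F.pTilde (ℓ + 1)) := by
      intro h
      have h1 := F.le_lamMin_pHat_succ hd hα hαβ hA hℓ hmℓ (hsmall hδ) h
      have hlam : 0 < lamMin ((F.pHat (ℓ + 1))ᵀ * F.pHat (ℓ + 1)) :=
        lt_of_lt_of_le (by positivity) h1
      have hinv : (lamMin ((F.pHat (ℓ + 1))ᵀ * F.pHat (ℓ + 1)))⁻¹ ≤
          c / lamMin ((F.pTilde (ℓ + 1))ᵀ * F.pTilde (ℓ + 1)) := by
        rw [inv_le_comm₀ hlam (by positivity), inv_div]; exact h1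
      refine ⟨hlam, hinv, ?_⟩
      refine (F.condNum_block_le_of_pos hd hα hαβ hA ⟨ℓ + 1, hℓ'⟩ (Nat.succ_pos ℓ) hlam).trans ?_
      calc 4 * F.overlap (ℓ + 1) /
            (Real.pi ^ 2 * α * lamMin ((F.pHat (ℓ + 1))ᵀ * F.pHat (ℓ + 1)))
          = 4 * (F.overlap (ℓ + 1) * (lamMin ((F.pHat (ℓ + 1))ᵀ * F.pHat (ℓ + 1)))⁻¹) /
            (Real.pi ^ 2 * α) := by field_simp
        _ ≤ 4 * (N * (c / lamMin ((F.pTilde (ℓ + 1))ᵀ * F.pTilde (ℓ + 1)))) /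
            (Real.pi ^ 2 * α) := by
          refine div_le_div_of_nonneg_right (mul_le_mul_of_nonneg_left ?_ (by norm_num))
            (by positivity)
          exact mul_le_mul hov hinv (inv_nonneg.2 hlam.le) hN0.le
        _ = _ := by ring
    have hcN : 4 * N * c / (Real.pi ^ 2 * α) ≤ 8 * N * c / (Real.pi ^ 2 * α) := by
      gcongr; norm_num
    refine ⟨fun h => absurd h (Nat.succ_ne_zero ℓ), fun _ h => ?_, fun _ he => ?_⟩
    · obtain ⟨h1, h2, h3⟩ := key h
      refine ⟨h1, h2.trans ?_, h3.trans ?_⟩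
      · exact div_le_div_of_nonneg_right (by linarith) h.le
      · exact div_le_div_of_nonneg_right (hcN.trans hC2) h.le
    · have hhalf := F.half_le_lamMin_pTilde hd hα hαβ hA hℓ hmℓ (hsmall le_rfl) he
      have h : 0 < lamMin ((F.pTilde (ℓ + 1))ᵀ * F.pTilde (ℓ + 1)) :=
        lt_of_lt_of_le (by norm_num) hhalf
      obtain ⟨h1, h2, h3⟩ := key h
      have hdiv : ∀ {t : ℝ}, 0 ≤ t →
          t / lamMin ((F.pTilde (ℓ + 1))ᵀ * F.pTilde (ℓ + 1)) ≤ 2 * t := fun {t} ht => by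
        rw [div_le_iff₀ h]
        nlinarith
      refine ⟨hhalf, h1, (h2.trans (hdiv hc0.le)).trans hC1, ?_⟩
      refine (h3.trans (hdiv (by positivity))).trans (le_trans (le_of_eq ?_) hC2)
      ring
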